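/- **Setting.** Let $B\subset\mathbb R^3$ be the open unit ball, $\mathbb S^2=\partial B$ with surface measure $\sin\theta\,d\varphi\,d\theta$, polar angle $\theta$ measured from the $x_3$-axis and $e_\varphi=(-\sin\varphi,\cos\varphi,0)$. Let $\Delta_{\mathbb S^2}$ be the Laplace–Beltrami operator, understood weakly in $L^2(\mathbb S^2)$, and let $\Lambda$ be the Dirichlet-to-Neumann operator of $B$, acting componentwise on vector fields: $\Lambda g=\partial_s f|_{s=1}$, where $s=|x|$, $\Delta f=0$ in $B$ and $f=g$ on $\partial B$ (boundary values of $f$ and $\partial_s f$ taken as $L^2(\mathbb S^2)$-limits along the spheres of radius $s\nearrow1$). For $\mu\in\mathbb R$ put $$\mathcal A(\mu)\eta=\sin\theta\,e_\varphi\cdot(2\,\mathrm{Id}-\Lambda)(\sin\theta\,\eta\,e_\varphi)-\mu(\Delta_{\mathbb S^2}+2\,\mathrm{Id})\eta .$$ Let $Y_l^0(\theta)=\sqrt{\tfrac{2l+1}{4\pi}}\,P_l(\cos\theta)$, with $P_l$ the Legendre polynomials, and for $\alpha\ge0$ let $\mathrm h^\alpha$ be the space of real sequences $v=(v_k)_{k\ge1}$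 with $\|v\|_{\mathrm h^\alpha}^2=\sum_{k\ge1}k^{2\alpha}v_k^2<\infty$. A sequence $v$ is identified with the function $\sum_{k\ge1}v_kY_{2k}^0$, the series converging in $L^2(\mathbb S^2)$; values of $\mathcal A(\mu)$ are regarded modulo constants, i.e. modulo multiples of $Y_0^0$, when $\mathcal A(\mu)$ is read as an operator on sequences. **Lemma.** Let $\alpha\ge0$ and $\mu\in\mathbb R$. For every $v\in\mathrm h^{\alpha+2}$ the function $\mathcal A(\mu)\big(\sum_k v_kY_{2k}^0\big)\in L^2(\mathbb S^2)$ is well defined, and $$\mathcal A(\mu)\Big(\sum_{k=1}^\infty v_kY_{2k}^0\Big)=\sum_{k=2}^\infty\big(A_k(\mu)v_k+B_kv_{k-1}+C_kv_{k+1}\big)Y_{2k}^0+\big(A_1(\mu)v_1+C_1v_2\big)Y_2^0+C_0v_1Y_0^0$$ with convergence in $L^2(\mathbb S^2)$, where $$A_k(\mu)=\mu(2k-1)(2k+2)-\frac{2k(2k-3)(2k-1)}{(4k+1)(4k-1)}-\frac{(2k-1)(2k+1)(2k+2)}{(4k+1)(4k+3)},$$ $$B_k=\frac{2k(2k-3)(2k-1)}{(4k-3)(4k-1)}\sqrt{\frac{4k-3}{4k+1}},\qquad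 C_k=\frac{(2k-1)(2k+1)(2k+2)}{(4k+3)(4k+5)}\sqrt{\frac{4k+5}{4k+1}} .$$ Modulo constants, $\mathcal A(\mu)$ thus acts as a bounded linear operator $\mathrm h^{\alpha+2}\to\mathrm h^\alpha$, given by a tridiagonal matrix with $B_{k+1}=C_k$ for $k\ge1$, and it is symmetric: $\sum_k(\mathcal A(\mu)v)_kw_k=\sum_kv_k(\mathcal A(\mu)w)_k$ for all $v,w\in\mathrm h^{\alpha+2}$, both series being convergent. -/

import Mathlib

open MeasureTheory Filter Topology
open scoped ContDiff

noncomputable section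

/-- Euclidean three-space. -/
abbrev Space3 : Type := EuclideanSpace ℝ (Fin 3)

/-- The unit sphere `𝕊²` in three-space. -/
abbrev Sphere2 : Type := Metric.sphere (0 : Space3) 1

/-- The surface measure on `𝕊²` (total mass `4π`), in spherical coordinates
`sin θ dφ dθ`. -/
abbrev sphereMeasure : Measure Sphere2 := (volume : Measure Space3).toSphere

/-- The Hilbert space `L²(𝕊²)` of real functions. -/
abbrev L2Sphere : Type := Lp ℝ 2 sphereMeasure

/-! ### Zonal spherical harmonics -/

/-- The Legendre polynomial `P_l = P_l^0`, by the Rodrigues formula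
`P_l(t) = 1 / (2^l l!) (d/dt)^l (t^2 - 1)^l`. -/
def legendrePoly (l : ℕ) : Polynomial ℝ :=
  Polynomial.C (1 / ((2 : ℝ) ^ l * (l.factorial : ℝ))) *
    (Polynomial.derivative^[l]) ((Polynomial.X ^ 2 - 1) ^ l)

/-- The zonal spherical harmonic `Y_l^0(θ) = √((2l+1)/(4π)) P_l(cos θ)` as a continuous function
on the sphere; the polar angle is measured from the `x₃`-axis, so that `cos θ = x₃`. -/
def zonalHarmonic (l : ℕ) : C(Sphere2, ℝ) where
  toFun x := Real.sqrt ((2 * (l : ℝ) + 1) / (4 * Real.pi)) * (legendrePoly l).eval ((x : Space3) 2)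
  continuous_toFun := by
    have h : Continuous fun x : Sphere2 => (x : Space3) 2 := by fun_prop
    exact continuous_const.mul ((legendrePoly l).continuous.comp h)

/-- `Y_l^0` as an element of `L²(𝕊²)`. -/
def zonalL2 (l : ℕ) : L2Sphere := ContinuousMap.toLp 2 sphereMeasure ℝ (zonalHarmonic l)

/-! ### The azimuthal field -/

/-- The vector field `sin θ e_φ = (-x₂, x₁, 0)`. -/
def sinAzimuth (x : Space3) : Space3 := !₂[-x 1, x 0, 0]

/-- In spherical coordinates `sinAzimuth` is `sin θ` times the unit vector
`e_φ = (-sin φ, cos φ, 0)`. -/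
theorem sinAzimuth_spherical (θ φ : ℝ) :
    sinAzimuth !₂[Real.sin θ * Real.cos φ, Real.sin θ * Real.sin φ, Real.cos θ] =
      Real.sin θ • (!₂[-Real.sin φ, Real.cos φ, 0] : Space3) := by
  ext i
  fin_cases i <;> simp [sinAzimuth]

/-! ### The Laplace-Beltrami operator on the sphere -/

/-- The Laplace-Beltrami operator applied to (the restriction to `𝕊²` of) a smooth function `f`:
the Euclidean Laplacian of the extension `y ↦ f (y / |y|)`, homogeneous of degree zero,
evaluated on the sphere. -/
def sphereLaplacian (f : Space3 → ℝ) (x : Sphere2) : ℝ :=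
  Laplacian.laplacian (fun y : Space3 => f (‖y‖⁻¹ • y)) (x : Space3)

/-- `w = Δ_{𝕊²} u` weakly in `L²(𝕊²)`. -/
def IsLaplaceBeltrami (u w : Sphere2 → ℝ) : Prop :=
  MemLp u 2 sphereMeasure ∧ MemLp w 2 sphereMeasure ∧
    ∀ f : Space3 → ℝ, ContDiff ℝ ∞ f →
      ∫ x, u x * sphereLaplacian f x ∂sphereMeasure =
        ∫ x : Sphere2, w x * f (x : Space3) ∂sphereMeasure

/-! ### The Dirichlet-to-Neumann operator of the unit ball -/

/-- `w = Λ g` for vector fields on the sphere: `w` is the normal derivative `∂_s f` on `∂B` of the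
harmonic extension `f` of `g` to the unit ball `B`. The boundary values of `f` and of its radial
derivative are attained in `L²(𝕊²)`, along the spheres of radius `s ↗ 1`. -/
def IsDirichletToNeumann (g w : Sphere2 → Space3) : Prop :=
  MemLp g 2 sphereMeasure ∧ MemLp w 2 sphereMeasure ∧
    ∃ f : Space3 → Space3,
      InnerProductSpace.HarmonicOnNhd f (Metric.ball 0 1) ∧
      Tendsto (fun s : ℝ =>
          eLpNorm (fun x : Sphere2 => f (s • (x : Space3)) - g x) 2 sphereMeasure)
        (𝓝[<] 1) (𝓝 0) ∧
      Tendsto (fun s : ℝ =>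
          eLpNorm (fun x : Sphere2 => deriv (fun r : ℝ => f (r • (x : Space3))) s - w x)
            2 sphereMeasure)
        (𝓝[<] 1) (𝓝 0)

/-! ### The linearized operator -/

/-- The graph of the linearized operator: `w = 𝒜(μ) u`, where
`𝒜(μ) u = sin θ e_φ · (2 Id - Λ)(sin θ u e_φ) - μ (Δ_{𝕊²} + 2 Id) u`. -/
def IsLinearizedOperator (μ : ℝ) (u w : L2Sphere) : Prop :=
  ∃ (G : Sphere2 → Space3) (L : Sphere2 → ℝ),
    IsDirichletToNeumann (fun x => u x • sinAzimuth x) G ∧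
    IsLaplaceBeltrami u L ∧
    ∀ᵐ x ∂sphereMeasure,
      w x = inner ℝ (sinAzimuth x) ((2 : ℝ) • (u x • sinAzimuth x) - G x) - μ * (L x + 2 * u x)

/-! ### Sequence spaces -/

/-- The sequence space `h^α` of all real `(v_k)_{k ≥ 1}` with `∑ k^{2α} v_k^2 < ∞`. -/
def SeqSpace (α : ℝ) : Submodule ℝ (ℕ+ → ℝ) where
  carrier := {v | Summable fun k : ℕ+ => (k : ℝ) ^ (2 * α) * v k ^ 2}
  zero_mem' := by simp
  add_mem' := by
    intro v w hv hw
    refine Summable.of_nonneg_of_le (fun k => by positivity) (fun k => ?_)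
      ((hv.mul_left 2).add (hw.mul_left 2))
    have h : (0 : ℝ) ≤ (k : ℝ) ^ (2 * α) := by positivity
    have h2 := mul_nonneg h (sq_nonneg (v k - w k))
    simp only [Pi.add_apply]
    nlinarith
  smul_mem' := by
    intro c v hv
    refine (Summable.mul_left (c ^ 2) hv).congr (fun k => ?_)
    simp only [Pi.smul_apply, smul_eq_mul]
    ring

/-- The norm `‖v‖_{h^α} = (∑ k^{2α} v_k^2)^{1/2}`. -/
def seqNorm (α : ℝ) (v : SeqSpace α) : ℝ :=
  Real.sqrt (∑' k : ℕ+, (k : ℝ) ^ (2 * α) * v.1 k ^ 2)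

/-! ### The matrix coefficients -/

/-- The diagonal coefficient `A_k(μ)`. -/
def coeffA (μ : ℝ) (n : ℕ) : ℝ :=
  let k : ℝ := n
  μ * (2 * k - 1) * (2 * k + 2)
    - 2 * k * (2 * k - 3) * (2 * k - 1) / ((4 * k + 1) * (4 * k - 1))
    - (2 * k - 1) * (2 * k + 1) * (2 * k + 2) / ((4 * k + 1) * (4 * k + 3))

/-- The lower off-diagonal coefficient `B_k`. -/
def coeffB (n : ℕ) : ℝ :=
  let k : ℝ := n
  2 * k * (2 * k - 3) * (2 * k - 1) / ((4 * k - 3) * (4 * k - 1))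
    * Real.sqrt ((4 * k - 3) / (4 * k + 1))

/-- The upper off-diagonal coefficient `C_k`. -/
def coeffC (n : ℕ) : ℝ :=
  let k : ℝ := n
  (2 * k - 1) * (2 * k + 1) * (2 * k + 2) / ((4 * k + 3) * (4 * k + 5))
    * Real.sqrt ((4 * k + 5) / (4 * k + 1))

end

/-!
Put `H_n = P_n'(cos θ) sin θ e_φ`. The Legendre recurrence `(2l + 1) P_l = P_{l+1}' - P_{l-1}'` says
that `Y_l^0 sin θ e_φ` is a multiple of `H_{l+1} - H_{l-1}`, and `H_n` is the trace of a harmonic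
field that is homogeneous of degree `n`, so that `Λ H_n = n H_n`. The inner product with
`sin θ e_φ` sends `H_n` to `(1 - x²) P_n'(x)` at `x = cos θ`, a combination of `P_{n-1}` and
`P_{n+1}`. Hence `𝒜(μ)` maps `Y_l^0` into the span of `Y_{l-2}^0, Y_l^0, Y_{l+2}^0`, and on even
degrees it is tridiagonal with entries of order `k²`.

On infinite sums, the harmonic extension is a power series in the radius whose coefficients are
summable on the closed ball once weighted by the degree, so its boundary values and those of its
radial derivative are attained in `L²`. The value of `𝒜(μ)` is unique for two reasons: smooth
functions are dense in `L²`, and `∫ f(s x)² dσ(x)` is nondecreasing in `s` for harmonic `f`, which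
must therefore vanish if its boundary values do.
-/

section LegendrePolynomials

open Polynomial

theorem derivative_X_sq_sub_one_pow_succ {R : Type*} [CommRing R] (l : ℕ) :
    derivative ((X ^ 2 - 1 : R[X]) ^ (l + 1)) = C (2 * ((l : R) + 1)) * (X * (X ^ 2 - 1) ^ l) := by
  rw [derivative_pow_succ, derivative_sub, derivative_X_pow, derivative_one]
  simp only [C_mul, C_add, map_natCast, map_ofNat, map_one, Nat.cast_ofNat, Nat.reduceSub, pow_one,
    sub_zero]
  ring

theorem legendrePoly_zero : legendrePoly 0 = 1 := by
  simp [legendrePoly]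

theorem legendrePoly_succ (l : ℕ) :
    legendrePoly (l + 1) =
      C (1 / ((2 : ℝ) ^ l * (l.factorial : ℝ))) * derivative^[l] (X * (X ^ 2 - 1) ^ l) := by
  rw [legendrePoly, Function.iterate_succ_apply, derivative_X_sq_sub_one_pow_succ,
    iterate_derivative_C_mul, ← mul_assoc, ← C_mul]
  congr 2
  rw [Nat.factorial_succ]
  push_cast
  field_simp
  ring

theorem legendrePoly_one : legendrePoly 1 = X := by
  simp [legendrePoly_succ]

theorem derivative_legendrePoly_succ (l : ℕ) :
    derivative (legendrePoly (l + 1)) =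
      X * derivative (legendrePoly l) + C ((l : ℝ) + 1) * legendrePoly l := by
  rw [legendrePoly_succ, derivative_C_mul, ← Function.iterate_succ_apply' (⇑derivative), mul_comm X,
    iterate_derivative_mul_X, legendrePoly, derivative_C_mul,
    ← Function.iterate_succ_apply' (⇑derivative)]
  simp only [Nat.succ_eq_add_one, Nat.add_sub_cancel, nsmul_eq_mul, Nat.cast_add, Nat.cast_one,
    C_add, C_1, map_natCast]
  ring

theorem derivative_X_mul_X_sq_sub_one_pow_succ {R : Type*} [CommRing R] (l : ℕ) :
    derivative (X * (X ^ 2 - 1 : R[X]) ^ (l + 1)) =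
      C (2 * (l : R) + 3) * (X ^ 2 - 1) ^ (l + 1) + C (2 * ((l : R) + 1)) * (X ^ 2 - 1) ^ l := by
  rw [derivative_mul, derivative_X_sq_sub_one_pow_succ]
  simp only [derivative_X, C_mul, C_add, map_ofNat, map_natCast, map_one]
  ring

theorem derivative_legendrePoly_add_two (l : ℕ) :
    derivative (legendrePoly (l + 2)) =
      derivative (legendrePoly l) + C (2 * (l : ℝ) + 3) * legendrePoly (l + 1) := by
  have normalization :
      C (1 / ((2 : ℝ) ^ (l + 1) * ((l + 1).factorial : ℝ))) * C (2 * ((l : ℝ) + 1)) =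
        C (1 / ((2 : ℝ) ^ l * (l.factorial : ℝ))) := by
    rw [← C_mul, Nat.factorial_succ]
    congr 1
    push_cast
    field_simp
    ring
  rw [legendrePoly_succ, derivative_C_mul, ← Function.iterate_succ_apply' (⇑derivative),
    Function.iterate_succ_apply, derivative_X_mul_X_sq_sub_one_pow_succ, iterate_map_add,
    iterate_derivative_C_mul, iterate_derivative_C_mul, legendrePoly, legendrePoly,
    derivative_C_mul, ← Function.iterate_succ_apply' (⇑derivative)]
  linear_combination derivative^[l + 1] ((X ^ 2 - 1) ^ l) * normalization

theorem one_sub_X_sq_mul_derivative_legendrePoly_succ (l : ℕ) :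
    (1 - X ^ 2) * derivative (legendrePoly (l + 1)) =
      C ((l : ℝ) + 1) * (legendrePoly l - X * legendrePoly (l + 1)) := by
  have h₁ := derivative_legendrePoly_succ l
  have h₂ := derivative_legendrePoly_succ (l + 1)
  have h₃ := derivative_legendrePoly_add_two l
  simp only [C_add, C_mul, map_natCast, map_ofNat, map_one, Nat.cast_add, Nat.cast_one]
    at h₁ h₂ h₃ ⊢
  linear_combination h₁ + X * (h₂ - h₃)

theorem one_sub_X_sq_mul_derivative_legendrePoly (l : ℕ) :
    (1 - X ^ 2) * derivative (legendrePoly l) =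
      C ((l : ℝ) + 1) * (X * legendrePoly l - legendrePoly (l + 1)) := by
  have h₁ := derivative_legendrePoly_succ l
  have h₂ := derivative_legendrePoly_succ (l + 1)
  have h₃ := derivative_legendrePoly_add_two l
  simp only [C_add, C_mul, map_natCast, map_ofNat, map_one, Nat.cast_add, Nat.cast_one]
    at h₁ h₂ h₃ ⊢
  linear_combination h₂ - h₃ + X * h₁

theorem legendrePoly_add_two (l : ℕ) :
    C ((l : ℝ) + 2) * legendrePoly (l + 2) =
      C (2 * (l : ℝ) + 3) * (X * legendrePoly (l + 1)) - C ((l : ℝ) + 1) * legendrePoly l := by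
  have h₁ := one_sub_X_sq_mul_derivative_legendrePoly (l + 1)
  have h₂ := one_sub_X_sq_mul_derivative_legendrePoly_succ l
  simp only [C_add, C_mul, map_natCast, map_ofNat, map_one, Nat.cast_add, Nat.cast_one]
    at h₁ h₂ ⊢
  linear_combination h₁ - h₂

theorem derivative_one_sub_X_sq_mul_derivative_legendrePoly (l : ℕ) :
    derivative ((1 - X ^ 2) * derivative (legendrePoly l)) =
      -(C ((l : ℝ) * ((l : ℝ) + 1)) * legendrePoly l) := by
  rw [one_sub_X_sq_mul_derivative_legendrePoly, derivative_C_mul, derivative_sub,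
    derivative_legendrePoly_succ, derivative_mul, derivative_X, C_mul, C_add]
  simp only [C_1]
  ring

theorem one_sub_X_sq_mul_derivative_legendrePoly_eq_sub (l : ℕ) :
    C (2 * (l : ℝ) + 3) * ((1 - X ^ 2) * derivative (legendrePoly (l + 1))) =
      C (((l : ℝ) + 1) * ((l : ℝ) + 2)) * (legendrePoly l - legendrePoly (l + 2)) := by
  have h₁ := one_sub_X_sq_mul_derivative_legendrePoly_succ l
  have h₂ := legendrePoly_add_two l
  simp only [C_add, C_mul, map_natCast, map_ofNat, map_one] at h₁ h₂ ⊢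
  linear_combination (2 * (l : ℝ[X]) + 3) * h₁ + ((l : ℝ[X]) + 1) * h₂

theorem eval_one_legendrePoly (l : ℕ) : (legendrePoly l).eval 1 = 1 := by
  induction l with
  | zero => simp [legendrePoly_zero]
  | succ l ih =>
    have h := congrArg (eval 1) (one_sub_X_sq_mul_derivative_legendrePoly_succ l)
    simp only [eval_mul, eval_sub, eval_one, eval_pow, eval_X, eval_C, ih] at h
    have hl : (l : ℝ) + 1 ≠ 0 := by positivity
    refine mul_left_cancel₀ hl ?_
    linear_combination h

theorem eval_neg_legendrePoly (l : ℕ) (t : ℝ) :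
    (legendrePoly l).eval (-t) = (-1) ^ l * (legendrePoly l).eval t := by
  induction l using Nat.twoStepInduction with
  | zero => simp [legendrePoly_zero]
  | one => simp [legendrePoly_one]
  | more l ih₀ ih₁ =>
    have h_neg := congrArg (eval (-t)) (legendrePoly_add_two l)
    have h_pos := congrArg (eval t) (legendrePoly_add_two l)
    simp only [eval_mul, eval_sub, eval_X, eval_C, ih₀, ih₁] at h_neg h_pos
    have hl : (l : ℝ) + 2 ≠ 0 := by positivity
    refine mul_left_cancel₀ hl ?_
    linear_combination h_neg - (-1 : ℝ) ^ (l + 2) * h_pos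

-- Sonin's function: it is monotone away from `0`, and its value at `1` bounds `P_l²`.
theorem derivative_legendrePoly_sonin (l : ℕ) :
    derivative (C ((l : ℝ) * ((l : ℝ) + 1)) * legendrePoly l ^ 2 +
      (1 - X ^ 2) * derivative (legendrePoly l) ^ 2) = 2 * X * derivative (legendrePoly l) ^ 2 := by
  have h := derivative_one_sub_X_sq_mul_derivative_legendrePoly l
  simp only [derivative_mul, derivative_add, derivative_sub, derivative_pow, derivative_C,
    derivative_X, derivative_one, Nat.cast_ofNat, Nat.reduceSub, pow_one, map_ofNat] at h ⊢
  linear_combination 2 * derivative (legendrePoly l) * h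

theorem abs_eval_legendrePoly_le_one_of_nonneg (l : ℕ) {t : ℝ} (ht : t ∈ Set.Icc (0 : ℝ) 1) :
    |(legendrePoly l).eval t| ≤ 1 := by
  rcases Nat.eq_zero_or_pos l with rfl | hl
  · simp [legendrePoly_zero]
  set c : ℝ := (l : ℝ) * ((l : ℝ) + 1)
  have hc : 0 < c := by positivity
  set F : ℝ[X] := C c * legendrePoly l ^ 2 + (1 - X ^ 2) * derivative (legendrePoly l) ^ 2 with hF
  have hmono : MonotoneOn (fun x => F.eval x) (Set.Icc (0 : ℝ) 1) := by
    refine monotoneOn_of_deriv_nonneg (convex_Icc 0 1) F.continuous.continuousOn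
      F.differentiable.differentiableOn fun x hx => ?_
    rw [interior_Icc] at hx
    rw [Polynomial.deriv, derivative_legendrePoly_sonin]
    simp only [eval_mul, eval_pow, eval_X, eval_ofNat]
    exact mul_nonneg (mul_nonneg zero_le_two hx.1.le) (sq_nonneg _)
  have hle := hmono ht (Set.right_mem_Icc.2 zero_le_one) ht.2
  simp only [hF, eval_add, eval_mul, eval_C, eval_pow, eval_sub, eval_one, eval_X,
    eval_one_legendrePoly, one_pow, sub_self, zero_mul, add_zero] at hle
  have hnonneg : 0 ≤ (1 - t ^ 2) * (derivative (legendrePoly l)).eval t ^ 2 :=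
    mul_nonneg (sub_nonneg.2 (pow_le_one₀ ht.1 ht.2)) (sq_nonneg _)
  rw [← sq_le_one_iff_abs_le_one]
  exact le_of_mul_le_mul_left (by linarith) hc

theorem abs_eval_legendrePoly_le_one (l : ℕ) {t : ℝ} (ht : |t| ≤ 1) :
    |(legendrePoly l).eval t| ≤ 1 := by
  rcases le_total 0 t with h | h
  · exact abs_eval_legendrePoly_le_one_of_nonneg l ⟨h, (abs_le.1 ht).2⟩
  · have h_neg := abs_eval_legendrePoly_le_one_of_nonneg l (t := -t)
      ⟨neg_nonneg.2 h, neg_le.1 (abs_le.1 ht).1⟩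
    rwa [eval_neg_legendrePoly, abs_mul, abs_neg_one_pow, one_mul] at h_neg

end LegendrePolynomials

section SolidLegendre

open Polynomial

/-- The solid zonal function `|x|^(n - j) P_n^{(j)}(x₃ / |x|)`, for which `x₁` times the instance
`j = 1` is a solid harmonic of degree `n`. The recursion `P_{n+2}' = P_n' + (2n+3) P_{n+1}` in `j`
makes it a polynomial in `x₃` and `|x|²` that vanishes for `n < j`. -/
noncomputable def solidLegendre : ℕ → ℕ → Space3 → ℝ
  | 0, 0, _ => 1
  | 0, 1, x => x 2
  | 0, n + 2, x => ((2 * n + 3) * (x 2 * solidLegendre 0 (n + 1) x) -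
      (n + 1) * (‖x‖ ^ 2 * solidLegendre 0 n x)) / (n + 2)
  | _ + 1, 0, _ => 0
  | j + 1, 1, x => solidLegendre j 0 x
  | j + 1, n + 2, x => ‖x‖ ^ 2 * solidLegendre (j + 1) n x +
      (2 * n + 3) * solidLegendre j (n + 1) x

theorem solidLegendre_zero_zero (x : Space3) : solidLegendre 0 0 x = 1 := by
  rw [solidLegendre]

theorem solidLegendre_zero_one (x : Space3) : solidLegendre 0 1 x = x 2 := by
  rw [solidLegendre]

theorem solidLegendre_zero_add_two (n : ℕ) (x : Space3) :
    ((n : ℝ) + 2) * solidLegendre 0 (n + 2) x =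
      (2 * n + 3) * (x 2 * solidLegendre 0 (n + 1) x) -
        (n + 1) * (‖x‖ ^ 2 * solidLegendre 0 n x) := by
  rw [solidLegendre]
  field_simp

theorem solidLegendre_succ_zero (j : ℕ) (x : Space3) : solidLegendre (j + 1) 0 x = 0 := by
  rw [solidLegendre]

theorem solidLegendre_succ_one (j : ℕ) (x : Space3) :
    solidLegendre (j + 1) 1 x = solidLegendre j 0 x := by
  rw [solidLegendre]

theorem solidLegendre_succ_add_two (j n : ℕ) (x : Space3) :
    solidLegendre (j + 1) (n + 2) x =
      ‖x‖ ^ 2 * solidLegendre (j + 1) n x + (2 * n + 3) * solidLegendre j (n + 1) x := by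
  rw [solidLegendre]

theorem solidLegendre_of_norm_eq_one (j n : ℕ) {x : Space3} (hx : ‖x‖ = 1) :
    solidLegendre j n x = (derivative^[j] (legendrePoly n)).eval (x 2) := by
  induction j, n, x using solidLegendre.induct with
  | case1 => simp [solidLegendre_zero_zero, legendrePoly_zero]
  | case2 => simp [solidLegendre_zero_one, legendrePoly_one]
  | case3 n x ih₁ ih₀ =>
    simp only [Nat.succ_eq_add_one]
    have h := congrArg (eval (x 2)) (legendrePoly_add_two n)
    simp only [eval_mul, eval_sub, eval_X, eval_C] at h
    have hn : (n : ℝ) + 2 ≠ 0 := by positivity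
    refine mul_left_cancel₀ hn ?_
    rw [solidLegendre_zero_add_two, ih₀ hx, ih₁ hx, hx, one_pow, one_mul]
    exact h.symm
  | case4 j x => simp [solidLegendre_succ_zero, legendrePoly_zero]
  | case5 j x ih =>
    rw [solidLegendre_succ_one, ih hx, Function.iterate_succ_apply, legendrePoly_one,
      legendrePoly_zero, derivative_X]
  | case6 j n x ih₀ ih₁ =>
    simp only [Nat.succ_eq_add_one]
    rw [solidLegendre_succ_add_two, ih₀ hx, ih₁ hx, Function.iterate_succ_apply,
      Function.iterate_succ_apply, derivative_legendrePoly_add_two, iterate_map_add,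
      iterate_derivative_C_mul, eval_add, eval_mul, eval_C, hx, one_pow, one_mul]

theorem pow_mul_solidLegendre_smul (j n : ℕ) (s : ℝ) (x : Space3) :
    s ^ j * solidLegendre j n (s • x) = s ^ n * solidLegendre j n x := by
  induction j, n, x using solidLegendre.induct with
  | case1 => simp [solidLegendre_zero_zero]
  | case2 => simp [solidLegendre_zero_one]
  | case3 n x ih₁ ih₀ =>
    simp only [Nat.succ_eq_add_one]
    have hn : (n : ℝ) + 2 ≠ 0 := by positivity
    refine mul_left_cancel₀ hn ?_
    have h := solidLegendre_zero_add_two n (s • x)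
    rw [norm_smul, mul_pow, Real.norm_eq_abs, sq_abs, PiLp.smul_apply, smul_eq_mul] at h
    linear_combination h + (2 * n + 3) * s * x 2 * ih₁ - (n + 1) * s ^ 2 * ‖x‖ ^ 2 * ih₀ -
      s ^ (n + 2) * solidLegendre_zero_add_two n x
  | case4 => simp [solidLegendre_succ_zero]
  | case5 j x ih =>
    rw [solidLegendre_succ_one, solidLegendre_succ_one, Nat.succ_eq_add_one]
    linear_combination s * ih
  | case6 j n x ih₀ ih₁ =>
    simp only [Nat.succ_eq_add_one]
    rw [solidLegendre_succ_add_two, solidLegendre_succ_add_two, norm_smul, mul_pow,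
      Real.norm_eq_abs, sq_abs]
    linear_combination s ^ 2 * ‖x‖ ^ 2 * ih₀ + (2 * n + 3) * s * ih₁

theorem natCast_mul_solidLegendre_zero (j : ℕ) (x : Space3) : j * solidLegendre j 0 x = 0 := by
  cases j <;> simp [solidLegendre_succ_zero]

theorem one_sub_mul_solidLegendre_one (j : ℕ) (x : Space3) :
    (1 - (j : ℝ)) * solidLegendre j 1 x = x 2 * solidLegendre j 0 x := by
  cases j with
  | zero => simp [solidLegendre_zero_zero, solidLegendre_zero_one]
  | succ j =>
    rw [solidLegendre_succ_one, solidLegendre_succ_zero]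
    push_cast
    linear_combination -natCast_mul_solidLegendre_zero j x

theorem solidLegendre_ladder_of_three_term {j : ℕ} {x : Space3}
    (three_term : ∀ n : ℕ, ((n : ℝ) + 2 - j) * solidLegendre j (n + 2) x =
      (2 * n + 3) * (x 2 * solidLegendre j (n + 1) x) -
        (n + 1 + j) * (‖x‖ ^ 2 * solidLegendre j n x)) (n : ℕ) :
    solidLegendre (j + 1) (n + 1) x =
        x 2 * solidLegendre (j + 1) n x + (n + 1 + j) * solidLegendre j n x ∧
      ‖x‖ ^ 2 * solidLegendre (j + 1) n x =
        x 2 * solidLegendre (j + 1) (n + 1) x - (n + 1 - j) * solidLegendre j (n + 1) x := by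
  induction n with
  | zero =>
    simp only [solidLegendre_succ_zero, solidLegendre_succ_one, zero_add, Nat.cast_zero]
    exact ⟨by linear_combination -natCast_mul_solidLegendre_zero j x,
      by linear_combination one_sub_mul_solidLegendre_one j x⟩
  | succ n ih =>
    have raise := solidLegendre_succ_add_two j n x
    have first : solidLegendre (j + 1) (n + 2) x =
        x 2 * solidLegendre (j + 1) (n + 1) x + (n + 2 + j) * solidLegendre j (n + 1) x := by
      linear_combination raise + ih.2
    push_cast
    refine ⟨by linear_combination first, ?_⟩
    linear_combination ‖x‖ ^ 2 * ih.1 - x 2 * raise + three_term n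

theorem solidLegendre_add_two (j n : ℕ) (x : Space3) :
    ((n : ℝ) + 2 - j) * solidLegendre j (n + 2) x =
      (2 * n + 3) * (x 2 * solidLegendre j (n + 1) x) -
        (n + 1 + j) * (‖x‖ ^ 2 * solidLegendre j n x) := by
  induction j generalizing n with
  | zero => simpa using solidLegendre_zero_add_two n x
  | succ j ih =>
    have lower := (solidLegendre_ladder_of_three_term ih n).2
    have raise := (solidLegendre_ladder_of_three_term ih (n + 1)).1
    push_cast at raise ⊢
    linear_combination ((n : ℝ) + 1 - j) * raise + (n + 2 + j) * lower

theorem solidLegendre_succ_succ (j n : ℕ) (x : Space3) :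
    solidLegendre (j + 1) (n + 1) x =
      x 2 * solidLegendre (j + 1) n x + (n + 1 + j) * solidLegendre j n x :=
  (solidLegendre_ladder_of_three_term (solidLegendre_add_two j · x) n).1

theorem norm_sq_mul_solidLegendre_succ (j n : ℕ) (x : Space3) :
    ‖x‖ ^ 2 * solidLegendre (j + 1) n x =
      x 2 * solidLegendre (j + 1) (n + 1) x - (n + 1 - j) * solidLegendre j (n + 1) x :=
  (solidLegendre_ladder_of_three_term (solidLegendre_add_two j · x) n).2

-- The coefficient form of `(1 - 2 t x₃ + t² |x|²) F_{j+1} = (2j + 1) t F_j` for the generating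
-- functions `F_j(t) = ∑ₙ tⁿ Q_{j,n}` of the solid zonal functions `Q_{j,n}`.
theorem solidLegendre_generating (j n : ℕ) (x : Space3) :
    solidLegendre (j + 1) (n + 2) x - 2 * x 2 * solidLegendre (j + 1) (n + 1) x +
      ‖x‖ ^ 2 * solidLegendre (j + 1) n x = (2 * j + 1) * solidLegendre j (n + 1) x := by
  have raise := solidLegendre_succ_succ j (n + 1) x
  push_cast at raise
  linear_combination raise + norm_sq_mul_solidLegendre_succ j n x

/-- The gradient `Q_{j+1,n} e₃ - Q_{j+1,n-1} x` of `Q_{j,n} = solidLegendre j n`. The truncated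
`n - 1` at `n = 0` is harmless because both coefficients vanish there. -/
noncomputable def solidLegendreDeriv (j n : ℕ) (x : Space3) : Space3 →L[ℝ] ℝ :=
  solidLegendre (j + 1) n x • EuclideanSpace.proj 2 - solidLegendre (j + 1) (n - 1) x • innerSL ℝ x

theorem hasFDerivAt_const_solidLegendre (j : ℕ) (x : Space3) :
    HasFDerivAt (solidLegendre j 0) (solidLegendreDeriv j 0 x) x := by
  have hconst : solidLegendre j 0 = fun _ => solidLegendre j 0 0 := by
    funext y
    cases j <;> simp [solidLegendre_zero_zero, solidLegendre_succ_zero]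
  rw [hconst]
  exact (hasFDerivAt_const _ x).congr_fderiv (by
    simp [solidLegendreDeriv, solidLegendre_succ_zero])

theorem solidLegendre_one_radial (n : ℕ) (x : Space3) :
    (2 * n + 3) * (x 2 * solidLegendre 1 n x) + 2 * (n + 1) * solidLegendre 0 n x -
      (n + 1) * (‖x‖ ^ 2 * solidLegendre 1 (n - 1) x) = (n + 2) * solidLegendre 1 (n + 1) x := by
  cases n with
  | zero => simp [solidLegendre_succ_zero, solidLegendre_succ_one]
  | succ n =>
    have axial := solidLegendre_add_two 1 n x
    have ladder := solidLegendre_succ_succ 0 (n + 1) x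
    simp only [Nat.add_sub_cancel]
    push_cast at axial ladder ⊢
    linear_combination -axial - 2 * ladder

theorem hasFDerivAt_solidLegendre_zero (n : ℕ) (x : Space3) :
    HasFDerivAt (solidLegendre 0 n) (solidLegendreDeriv 0 n x) x := by
  induction n using Nat.twoStepInduction with
  | zero => exact hasFDerivAt_const_solidLegendre 0 x
  | one =>
    rw [funext solidLegendre_zero_one]
    exact (EuclideanSpace.proj (2 : Fin 3) : Space3 →L[ℝ] ℝ).hasFDerivAt.congr_fderiv (by
      simp [solidLegendreDeriv, solidLegendre_succ_zero, solidLegendre_succ_one,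
        solidLegendre_zero_zero])
  | more n ih₀ ih₁ =>
    have hrec : solidLegendre 0 (n + 2) = fun y : Space3 => ((n : ℝ) + 2)⁻¹ *
        ((2 * n + 3) * (y 2 * solidLegendre 0 (n + 1) y) -
          (n + 1) * (‖y‖ ^ 2 * solidLegendre 0 n y)) := by
      funext y
      rw [← solidLegendre_zero_add_two, inv_mul_cancel_left₀ (by positivity)]
    rw [hrec]
    have coord : HasFDerivAt (fun y : Space3 => y 2) (EuclideanSpace.proj 2 : Space3 →L[ℝ] ℝ) x :=
      (EuclideanSpace.proj (2 : Fin 3) : Space3 →L[ℝ] ℝ).hasFDerivAt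
    refine ((((coord.mul ih₁).const_mul _).sub
      (((hasStrictFDerivAt_norm_sq x).hasFDerivAt.mul ih₀).const_mul _)).const_mul _).congr_fderiv
        ?_
    have axial := solidLegendre_add_two 1 n x
    have raise := solidLegendre_succ_add_two 0 n x
    have radial := solidLegendre_one_radial n x
    ext h
    simp only [solidLegendreDeriv, _root_.smul_apply, _root_.sub_apply, _root_.add_apply,
      smul_eq_mul, Nat.reduceSubDiff, zero_add]
    rw [inv_mul_eq_iff_eq_mul₀ (by positivity)]
    push_cast at axial raise
    linear_combination (EuclideanSpace.proj 2 : Space3 →L[ℝ] ℝ) h * (-axial - raise) -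
      innerSL ℝ x h * radial

theorem hasFDerivAt_solidLegendre (j n : ℕ) (x : Space3) :
    HasFDerivAt (solidLegendre j n) (solidLegendreDeriv j n x) x := by
  induction j generalizing n with
  | zero => exact hasFDerivAt_solidLegendre_zero n x
  | succ j ihj =>
    induction n using Nat.twoStepInduction with
    | zero => exact hasFDerivAt_const_solidLegendre (j + 1) x
    | one =>
      rw [funext (solidLegendre_succ_one j)]
      exact (ihj 0).congr_fderiv (by
        simp [solidLegendreDeriv, solidLegendre_succ_zero, solidLegendre_succ_one])
    | more n ih₀ _ =>
      rw [funext (solidLegendre_succ_add_two j n)]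
      refine (((hasStrictFDerivAt_norm_sq x).hasFDerivAt.mul ih₀).add
        ((ihj (n + 1)).const_mul _)).congr_fderiv ?_
      have axial := solidLegendre_succ_add_two (j + 1) n x
      have radial : ‖x‖ ^ 2 * solidLegendre (j + 2) (n - 1) x +
          (2 * n + 1) * solidLegendre (j + 1) n x = solidLegendre (j + 2) (n + 1) x := by
        cases n with
        | zero => simp [solidLegendre_succ_zero, solidLegendre_succ_one]
        | succ n =>
          rw [solidLegendre_succ_add_two, Nat.add_sub_cancel]
          push_cast
          ring
      ext h
      simp only [solidLegendreDeriv, _root_.smul_apply, _root_.sub_apply, _root_.add_apply,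
        smul_eq_mul, Nat.add_one_sub_one]
      linear_combination (-(EuclideanSpace.proj 2 : Space3 →L[ℝ] ℝ) h) * axial -
        innerSL ℝ x h * radial

end SolidLegendre

section SolidSeries

theorem abs_solidLegendre_zero_le (n : ℕ) (x : Space3) : |solidLegendre 0 n x| ≤ ‖x‖ ^ n := by
  obtain ⟨e, he, hx⟩ : ∃ e : Space3, ‖e‖ = 1 ∧ x = ‖x‖ • e := by
    obtain rfl | hx := eq_or_ne x 0
    · exact ⟨EuclideanSpace.single 0 1, by simp, by simp⟩
    · exact ⟨‖x‖⁻¹ • x, norm_smul_inv_norm hx, by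
        rw [smul_smul, mul_inv_cancel₀ (norm_ne_zero_iff.2 hx), one_smul]⟩
  have hcoord : |e 2| ≤ 1 := he ▸ PiLp.norm_apply_le e 2
  have hhom := pow_mul_solidLegendre_smul 0 n ‖x‖ e
  rw [← hx, pow_zero, one_mul, solidLegendre_of_norm_eq_one 0 n he, Function.iterate_zero,
    id] at hhom
  rw [hhom, abs_mul, abs_of_nonneg (by positivity)]
  exact mul_le_of_le_one_right (by positivity) (abs_eval_legendrePoly_le_one n hcoord)

theorem pow_mul_abs_solidLegendre_succ_add_two_le (j n : ℕ) {x : Space3} {s : ℝ} (hx : ‖x‖ ≤ s) :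
    s ^ (j + 1) * |solidLegendre (j + 1) (n + 2) x| ≤
      s ^ 2 * (s ^ (j + 1) * |solidLegendre (j + 1) n x|) +
        (2 * n + 3) * s * (s ^ j * |solidLegendre j (n + 1) x|) := by
  have hs : 0 ≤ s := (norm_nonneg x).trans hx
  rw [solidLegendre_succ_add_two]
  calc s ^ (j + 1) * |‖x‖ ^ 2 * solidLegendre (j + 1) n x +
          (2 * n + 3) * solidLegendre j (n + 1) x|
      ≤ s ^ (j + 1) * (‖x‖ ^ 2 * |solidLegendre (j + 1) n x| +
          (2 * n + 3) * |solidLegendre j (n + 1) x|) := by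
        gcongr
        refine (abs_add_le _ _).trans_eq ?_
        rw [abs_mul, abs_mul, abs_of_nonneg (sq_nonneg ‖x‖),
          abs_of_nonneg (by positivity : (0 : ℝ) ≤ 2 * n + 3)]
    _ ≤ s ^ (j + 1) * (s ^ 2 * |solidLegendre (j + 1) n x| +
          (2 * n + 3) * |solidLegendre j (n + 1) x|) := by gcongr
    _ = s ^ 2 * (s ^ (j + 1) * |solidLegendre (j + 1) n x|) +
          (2 * n + 3) * s * (s ^ j * |solidLegendre j (n + 1) x|) := by ring

theorem pow_mul_abs_solidLegendre_le (j n : ℕ) {x : Space3} {s : ℝ} (hx : ‖x‖ ≤ s) :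
    s ^ j * |solidLegendre j n x| ≤ n ^ (2 * j) * s ^ n := by
  have hs : 0 ≤ s := (norm_nonneg x).trans hx
  induction j generalizing n with
  | zero => simpa using (abs_solidLegendre_zero_le n x).trans (by gcongr)
  | succ j ihj =>
    induction n using Nat.twoStepInduction with
    | zero => simp [solidLegendre_succ_zero]
    | one =>
      have hzero : s ^ j * |solidLegendre j 0 x| ≤ 1 := by
        refine (ihj 0).trans ?_
        rw [pow_zero, mul_one, Nat.cast_zero]
        exact pow_le_one₀ le_rfl zero_le_one
      rw [solidLegendre_succ_one, pow_succ', mul_assoc]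
      simpa using mul_le_mul_of_nonneg_left hzero hs
    | more n ih₀ _ =>
      have ihn := ihj (n + 1)
      rw [mul_add_one, pow_add _ (2 * j)] at ih₀ ⊢
      push_cast at ihn ⊢
      calc s ^ (j + 1) * |solidLegendre (j + 1) (n + 2) x|
          ≤ s ^ 2 * ((n : ℝ) ^ (2 * j) * n ^ 2 * s ^ n) +
              (2 * n + 3) * s * ((n + 1 : ℝ) ^ (2 * j) * s ^ (n + 1)) :=
            (pow_mul_abs_solidLegendre_succ_add_two_le j n hx).trans (by gcongr)
        _ ≤ s ^ 2 * ((n + 2 : ℝ) ^ (2 * j) * n ^ 2 * s ^ n) +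
              (2 * n + 3) * s * ((n + 2 : ℝ) ^ (2 * j) * s ^ (n + 1)) := by
            gcongr <;> linarith
        _ = (n + 2 : ℝ) ^ (2 * j) * (n ^ 2 + (2 * n + 3)) * s ^ (n + 2) := by ring
        _ ≤ (n + 2 : ℝ) ^ (2 * j) * (n + 2) ^ 2 * s ^ (n + 2) := by
            gcongr
            nlinarith [n.cast_nonneg (α := ℝ)]

theorem abs_solidLegendre_le (j n : ℕ) {x : Space3} {s : ℝ} (hs : 0 < s) (hx : ‖x‖ ≤ s) :
    |solidLegendre j n x| ≤ (s ^ j)⁻¹ * (n ^ (2 * j) * s ^ n) := by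
  rw [← div_eq_inv_mul, le_div_iff₀' (by positivity)]
  exact pow_mul_abs_solidLegendre_le j n hx

theorem norm_solidLegendreDeriv_le (j n : ℕ) {x : Space3} {s : ℝ} (hs : 0 < s) (hs1 : s ≤ 1)
    (hx : ‖x‖ ≤ s) :
    ‖solidLegendreDeriv j n x‖ ≤
      ((s ^ (j + 1))⁻¹ + (s ^ (j + 2))⁻¹) * (n ^ (2 * (j + 1)) * s ^ n) := by
  have hpred : |solidLegendre (j + 1) (n - 1) x| ≤
      (s ^ (j + 2))⁻¹ * (n ^ (2 * (j + 1)) * s ^ n) := by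
    cases n with
    | zero => simp [solidLegendre_succ_zero]
    | succ n =>
      refine (abs_solidLegendre_le (j + 1) n hs hx).trans ?_
      have hpow : (s ^ (j + 1))⁻¹ * s ^ n = (s ^ (j + 2))⁻¹ * s ^ (n + 1) := by
        field_simp
        ring
      rw [mul_left_comm, hpow, mul_left_comm]
      gcongr
      simp
  have hproj : ‖(EuclideanSpace.proj 2 : Space3 →L[ℝ] ℝ)‖ ≤ 1 :=
    ContinuousLinearMap.opNorm_le_bound _ zero_le_one fun y => by
      simpa using PiLp.norm_apply_le y 2
  rw [add_mul]
  refine (norm_sub_le _ _).trans (add_le_add ?_ ?_)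
  · rw [norm_smul, Real.norm_eq_abs]
    exact (mul_le_of_le_one_right (abs_nonneg _) hproj).trans (abs_solidLegendre_le _ n hs hx)
  · rw [norm_smul, Real.norm_eq_abs, innerSL_apply_norm]
    exact (mul_le_of_le_one_right (abs_nonneg _) (hx.trans hs1)).trans hpred

/-- The power series with coefficients `β` converges on the open unit disc. -/
def UnitDiscSummable (β : ℕ → ℝ) : Prop :=
  ∀ s : ℝ, 0 ≤ s → s < 1 → Summable fun n => |β n| * s ^ n

theorem UnitDiscSummable.shift {β : ℕ → ℝ} (hβ : UnitDiscSummable β) :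
    UnitDiscSummable fun n => β (n + 1) := by
  intro s hs0 hs1
  obtain ⟨t, hst, ht1⟩ := exists_between hs1
  have ht0 : 0 < t := hs0.trans_lt hst
  refine Summable.of_nonneg_of_le (fun n => by positivity) (fun n => ?_)
    (((summable_nat_add_iff 1).2 (hβ t ht0.le ht1)).mul_left t⁻¹)
  calc |β (n + 1)| * s ^ n ≤ |β (n + 1)| * t ^ n := by gcongr
    _ = t⁻¹ * (|β (n + 1)| * t ^ (n + 1)) := by
      field_simp
      ring

theorem UnitDiscSummable.mul_pow {β : ℕ → ℝ} (hβ : UnitDiscSummable β) (p : ℕ) {s : ℝ}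
    (hs0 : 0 ≤ s) (hs1 : s < 1) : Summable fun n => |β n| * ((n : ℝ) ^ p * s ^ n) := by
  obtain ⟨t, hst, ht1⟩ := exists_between hs1
  refine summable_of_isBigO_nat (hβ t (hs0.trans hst.le) ht1)
    ((Asymptotics.isBigO_refl _ _).mul ?_)
  exact (isLittleO_pow_const_mul_const_pow_const_pow_of_norm_lt p
    (by rwa [Real.norm_of_nonneg hs0])).isBigO

/-- The series `∑ βₙ |x|^(n - j) P_n^{(j)}(x₃ / |x|)`; for `j = 1`, multiplied by `x₁` or `x₂`, it
is the general axially generated harmonic function of azimuthal order one. -/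
noncomputable def solidSeries (j : ℕ) (β : ℕ → ℝ) (x : Space3) : ℝ :=
  ∑' n, β n * solidLegendre j n x

section

variable {β : ℕ → ℝ} (hβ : UnitDiscSummable β) {x : Space3} (hx : ‖x‖ < 1)

include hβ hx

theorem summable_solidSeries (j : ℕ) : Summable fun n => β n * solidLegendre j n x := by
  obtain ⟨s, hxs, hs1⟩ := exists_between hx
  have hs0 : 0 < s := (norm_nonneg x).trans_lt hxs
  refine Summable.of_norm_bounded ((hβ.mul_pow (2 * j) hs0.le hs1).mul_left (s ^ j)⁻¹) fun n => ?_
  rw [Real.norm_eq_abs, abs_mul, mul_left_comm]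
  gcongr
  exact abs_solidLegendre_le j n hs0 hxs.le

theorem hasFDerivAt_solidSeries (j : ℕ) :
    HasFDerivAt (solidSeries j β)
      (solidSeries (j + 1) β x • EuclideanSpace.proj 2 -
        solidSeries (j + 1) (fun n => β (n + 1)) x • innerSL ℝ x : Space3 →L[ℝ] ℝ) x := by
  obtain ⟨s, hxs, hs1⟩ := exists_between hx
  have hs0 : 0 < s := (norm_nonneg x).trans_lt hxs
  have hxs' : x ∈ Metric.ball (0 : Space3) s := mem_ball_zero_iff.2 hxs
  have hderiv : HasFDerivAt (solidSeries j β) (∑' n, β n • solidLegendreDeriv j n x) x := by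
    refine hasFDerivAt_tsum_of_isPreconnected
      ((hβ.mul_pow (2 * (j + 1)) hs0.le hs1).mul_left ((s ^ (j + 1))⁻¹ + (s ^ (j + 2))⁻¹))
      Metric.isOpen_ball (convex_ball (0 : Space3) s).isPreconnected
      (fun n y _ => (hasFDerivAt_solidLegendre j n y).const_mul (β n)) (fun n y hy => ?_) hxs'
      (summable_solidSeries hβ hx j) hxs'
    rw [norm_smul, Real.norm_eq_abs, mul_left_comm]
    gcongr
    exact norm_solidLegendreDeriv_le j n hs0 hs1.le (mem_ball_zero_iff.1 hy).le
  have hsum := summable_solidSeries hβ hx (j + 1)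
  have hsum_shift := summable_solidSeries hβ.shift hx (j + 1)
  have hsum_pred : Summable fun n => β n * solidLegendre (j + 1) (n - 1) x :=
    (summable_nat_add_iff 1).1 hsum_shift
  have htsum_pred : ∑' n, β n * solidLegendre (j + 1) (n - 1) x =
      solidSeries (j + 1) (fun n => β (n + 1)) x := by
    rw [hsum_pred.tsum_eq_zero_add, Nat.zero_sub, solidLegendre_succ_zero, mul_zero, zero_add]
    rfl
  refine hderiv.congr_fderiv ?_
  simp only [solidLegendreDeriv, smul_sub, smul_smul]
  exact ((hsum.smul_const _).tsum_sub (hsum_pred.smul_const _)).trans (by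
    rw [hsum.tsum_smul_const, hsum_pred.tsum_smul_const, htsum_pred]
    rfl)

theorem solidSeries_generating (j : ℕ) :
    solidSeries (j + 2) β x - 2 * x 2 * solidSeries (j + 2) (fun n => β (n + 1)) x +
      ‖x‖ ^ 2 * solidSeries (j + 2) (fun n => β (n + 2)) x =
        (2 * j + 3) * solidSeries (j + 1) (fun n => β (n + 1)) x := by
  have hsum₀ := summable_solidSeries hβ hx (j + 2)
  have hsum₁ := summable_solidSeries hβ.shift hx (j + 2)
  have hsum₂ := summable_solidSeries hβ.shift.shift hx (j + 2)
  have htail₀ : solidSeries (j + 2) β x = ∑' n, β (n + 2) * solidLegendre (j + 2) (n + 2) x := by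
    rw [solidSeries, ← hsum₀.sum_add_tsum_nat_add 2]
    simp [Finset.sum_range_succ, solidLegendre_succ_zero, solidLegendre_succ_one]
  have htail₁ (i : ℕ) : solidSeries (i + 1) (fun n => β (n + 1)) x =
      ∑' n, β (n + 2) * solidLegendre (i + 1) (n + 1) x := by
    rw [solidSeries, (summable_solidSeries hβ.shift hx (i + 1)).tsum_eq_zero_add]
    simp [solidLegendre_succ_zero]
  have hsum₀' := (summable_nat_add_iff 2).2 hsum₀
  have hsum₁' := (summable_nat_add_iff 1).2 hsum₁
  rw [htail₀, htail₁, htail₁, solidSeries, ← tsum_mul_left, ← tsum_mul_left, ← tsum_mul_left,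
    ← hsum₀'.tsum_sub (hsum₁'.mul_left _),
    ← (hsum₀'.sub (hsum₁'.mul_left _)).tsum_add (hsum₂.mul_left _)]
  refine tsum_congr fun n => ?_
  have hgen := solidLegendre_generating (j + 1) n x
  push_cast at hgen
  linear_combination β (n + 2) * hgen

end

theorem contDiffOn_solidSeries (m j : ℕ) {β : ℕ → ℝ} (hβ : UnitDiscSummable β) :
    ContDiffOn ℝ m (solidSeries j β) (Metric.ball 0 1) := by
  induction m generalizing j β with
  | zero =>
    exact contDiffOn_zero.2 fun x hx => (hasFDerivAt_solidSeries hβ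
      (mem_ball_zero_iff.1 hx) j).continuousAt.continuousWithinAt
  | succ m ih =>
    push_cast
    rw [contDiffOn_succ_iff_fderiv_of_isOpen Metric.isOpen_ball]
    refine ⟨fun x hx => (hasFDerivAt_solidSeries hβ
      (mem_ball_zero_iff.1 hx) j).differentiableAt.differentiableWithinAt, by simp, ?_⟩
    exact (((ih (j + 1) hβ).smul contDiffOn_const).sub
      ((ih (j + 1) hβ.shift).smul (innerSL ℝ).contDiff.contDiffOn)).congr
      fun x hx => (hasFDerivAt_solidSeries hβ (mem_ball_zero_iff.1 hx) j).fderiv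

end SolidSeries

section Laplacian

variable {E : Type*} [NormedAddCommGroup E] [InnerProductSpace ℝ E]

theorem fderiv_fderiv_apply {f : E → ℝ} {x : E} (hf : ContDiffAt ℝ 2 f x) (h k : E) :
    fderiv ℝ (fderiv ℝ f) x h k = fderiv ℝ (fun y => fderiv ℝ f y k) x h := by
  have hdiff : DifferentiableAt ℝ (fderiv ℝ f) x :=
    (hf.fderiv_right (m := 1) (by norm_num)).differentiableAt (by norm_num)
  rw [(hdiff.hasFDerivAt.clm_apply (hasFDerivAt_const k x)).fderiv]
  simp

theorem sum_inner_mul_apply {ι : Type*} [Fintype ι] (b : OrthonormalBasis ι ℝ E) (L : E →L[ℝ] ℝ)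
    (x : E) : ∑ i, inner ℝ (b i) x * L (b i) = L x := by
  conv_rhs => rw [← b.sum_repr' x, map_sum]
  simp

variable [FiniteDimensional ℝ E]

theorem laplacian_eq_sum_fderiv_fderiv {ι : Type*} [Fintype ι] (b : OrthonormalBasis ι ℝ E)
    (f : E → ℝ) (x : E) :
    Laplacian.laplacian f x = ∑ i, fderiv ℝ (fderiv ℝ f) x (b i) (b i) := by
  rw [InnerProductSpace.laplacian_eq_iteratedFDeriv_orthonormalBasis f b]
  simp [iteratedFDeriv_two_apply]

theorem laplacian_inner_mul (a : E) {f : E → ℝ} {x : E} (hf : ContDiffAt ℝ 2 f x) :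
    Laplacian.laplacian (fun y => inner ℝ a y * f y) x =
      inner ℝ a x * Laplacian.laplacian f x + 2 * fderiv ℝ f x a := by
  let b := stdOrthonormalBasis ℝ E
  have hinner (y : E) : HasFDerivAt (fun y => inner ℝ a y) (innerSL ℝ a) y :=
    (innerSL ℝ a).hasFDerivAt
  have hcont : ContDiffAt ℝ 2 (fun y => inner ℝ a y * f y) x :=
    (innerSL ℝ a).contDiff.contDiffAt.mul hf
  have hfirst (k : E) : (fun y => fderiv ℝ (fun y => inner ℝ a y * f y) y k) =ᶠ[𝓝 x]
      fun y => inner ℝ a y * fderiv ℝ f y k + f y * inner ℝ a k := by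
    filter_upwards [hf.eventually (by simp)] with y hy
    rw [((hinner y).fun_mul (hy.differentiableAt two_ne_zero).hasFDerivAt).fderiv]
    simp
  have hsecond (k : E) : fderiv ℝ (fderiv ℝ fun y => inner ℝ a y * f y) x k k =
      inner ℝ a x * fderiv ℝ (fderiv ℝ f) x k k + 2 * (inner ℝ k a * fderiv ℝ f x k) := by
    have hdiff : DifferentiableAt ℝ (fun y => fderiv ℝ f y k) x :=
      ((hf.fderiv_right (m := 1) (by norm_num)).differentiableAt one_ne_zero).clm_apply
        (differentiableAt_const k)
    rw [fderiv_fderiv_apply hcont, (hfirst k).fderiv_eq, fderiv_fderiv_apply hf,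
      (((hinner x).fun_mul hdiff.hasFDerivAt).fun_add
        ((hf.differentiableAt two_ne_zero).hasFDerivAt.mul_const (inner ℝ a k))).fderiv,
      real_inner_comm a k]
    simp only [add_apply, smul_apply, innerSL_apply_apply, smul_eq_mul]
    ring
  rw [laplacian_eq_sum_fderiv_fderiv b, laplacian_eq_sum_fderiv_fderiv b, Finset.mul_sum,
    ← sum_inner_mul_apply b _ a, Finset.mul_sum, ← Finset.sum_add_distrib]
  exact Finset.sum_congr rfl fun i _ => hsecond (b i)

end Laplacian

section HarmonicExtension

open InnerProductSpace

variable {β : ℕ → ℝ} (hβ : UnitDiscSummable β) {x : Space3} (hx : ‖x‖ < 1)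

include hβ

theorem contDiffAt_solidSeries (hx : ‖x‖ < 1) (m j : ℕ) : ContDiffAt ℝ m (solidSeries j β) x :=
  (contDiffOn_solidSeries m j hβ).contDiffAt
    (Metric.isOpen_ball.mem_nhds (mem_ball_zero_iff.2 hx))

include hx

theorem fderiv_solidSeries_apply (j : ℕ) (k : Space3) :
    fderiv ℝ (solidSeries j β) x k =
      solidSeries (j + 1) β x * k 2 - solidSeries (j + 1) (fun n => β (n + 1)) x * inner ℝ x k := by
  simp [(hasFDerivAt_solidSeries hβ hx j).fderiv]

theorem fderiv_fderiv_solidSeries_apply (j : ℕ) (k : Space3) :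
    fderiv ℝ (fderiv ℝ (solidSeries j β)) x k k =
      solidSeries (j + 2) β x * k 2 ^ 2 -
        2 * solidSeries (j + 2) (fun n => β (n + 1)) x * k 2 * inner ℝ x k +
        solidSeries (j + 2) (fun n => β (n + 2)) x * inner ℝ x k ^ 2 -
        solidSeries (j + 1) (fun n => β (n + 1)) x * ‖k‖ ^ 2 := by
  have hfirst : (fun y => fderiv ℝ (solidSeries j β) y k) =ᶠ[𝓝 x] fun y =>
      solidSeries (j + 1) β y * k 2 -
        solidSeries (j + 1) (fun n => β (n + 1)) y * innerSL ℝ k y := by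
    filter_upwards [Metric.isOpen_ball.mem_nhds (mem_ball_zero_iff.2 hx)] with y hy
    rw [fderiv_solidSeries_apply hβ (mem_ball_zero_iff.1 hy), innerSL_apply_apply, real_inner_comm]
  have hderiv := ((hasFDerivAt_solidSeries hβ hx (j + 1)).mul_const (k 2)).fun_sub
    ((hasFDerivAt_solidSeries hβ.shift hx (j + 1)).fun_mul (innerSL ℝ k).hasFDerivAt)
  rw [fderiv_fderiv_apply (contDiffAt_solidSeries hβ hx 2 j), hfirst.fderiv_eq, hderiv.fderiv]
  simp only [_root_.add_apply, _root_.sub_apply, _root_.smul_apply, smul_eq_mul,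
    innerSL_apply_apply, PiLp.proj_apply, real_inner_comm x k, real_inner_self_eq_norm_sq]
  ring

theorem laplacian_solidSeries (j : ℕ) :
    Laplacian.laplacian (solidSeries j β) x =
      2 * j * solidSeries (j + 1) (fun n => β (n + 1)) x := by
  have hgen := solidSeries_generating hβ hx j
  rw [EuclideanSpace.real_norm_sq_eq, Fin.sum_univ_three] at hgen
  rw [laplacian_eq_sum_fderiv_fderiv (EuclideanSpace.basisFun (Fin 3) ℝ)]
  simp only [fderiv_fderiv_solidSeries_apply hβ hx, EuclideanSpace.basisFun_apply,
    Fin.sum_univ_three, EuclideanSpace.inner_single_right, PiLp.norm_single]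
  simp
  linear_combination hgen

theorem laplacian_coord_mul_solidSeries {i : Fin 3} (hi : i ≠ 2) :
    Laplacian.laplacian (fun y : Space3 => y i * solidSeries 1 β y) x = 0 := by
  have hcoord (y : Space3) : y i = inner ℝ (EuclideanSpace.single i (1 : ℝ)) y := by
    rw [EuclideanSpace.inner_single_left, map_one, one_mul]
  simp only [hcoord]
  rw [laplacian_inner_mul _ (contDiffAt_solidSeries hβ hx 2 1), laplacian_solidSeries hβ hx,
    fderiv_solidSeries_apply hβ hx, real_inner_comm,
    PiLp.single_apply, if_neg hi.symm]
  push_cast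
  ring

omit hx

theorem harmonicOnNhd_coord_mul_solidSeries {i : Fin 3} (hi : i ≠ 2) :
    HarmonicOnNhd (fun y : Space3 => y i * solidSeries 1 β y) (Metric.ball 0 1) := by
  intro x hx
  refine ⟨(EuclideanSpace.proj i : Space3 →L[ℝ] ℝ).contDiff.contDiffAt.mul
    (contDiffAt_solidSeries hβ (mem_ball_zero_iff.1 hx) 2 1), ?_⟩
  filter_upwards [Metric.isOpen_ball.mem_nhds hx] with y hy
  exact laplacian_coord_mul_solidSeries hβ (mem_ball_zero_iff.1 hy) hi

theorem harmonicOnNhd_solidSeries_smul_sinAzimuth :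
    HarmonicOnNhd (fun y : Space3 => solidSeries 1 β y • sinAzimuth y) (Metric.ball 0 1) := by
  have h₀ := (harmonicOnNhd_coord_mul_solidSeries hβ (i := 0) (by decide)).comp_CLM
    (ContinuousLinearMap.toSpanSingleton ℝ (EuclideanSpace.single 1 1 : Space3))
  have h₁ := (harmonicOnNhd_coord_mul_solidSeries hβ (i := 1) (by decide)).comp_CLM
    (ContinuousLinearMap.toSpanSingleton ℝ (EuclideanSpace.single 0 1 : Space3))
  convert h₀.sub h₁ using 1
  funext y
  ext i
  fin_cases i <;> simp [sinAzimuth, mul_comm]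

omit hβ

theorem sinAzimuth_smul (s : ℝ) (x : Space3) : sinAzimuth (s • x) = s • sinAzimuth x := by
  ext i
  fin_cases i <;> simp [sinAzimuth]

theorem UnitDiscSummable.mul_of_abs_le (hβ : UnitDiscSummable β) {c : ℕ → ℝ} (p : ℕ)
    (hc : ∀ n, |c n| ≤ n ^ p) : UnitDiscSummable fun n => β n * c n := by
  intro s hs0 hs1
  refine Summable.of_nonneg_of_le (fun n => by positivity) (fun n => ?_) (hβ.mul_pow p hs0 hs1)
  rw [abs_mul, mul_assoc]
  gcongr
  exact hc n

theorem UnitDiscSummable.hasDerivAt_tsum (hβ : UnitDiscSummable β) {s : ℝ} (hs : |s| < 1) :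
    HasDerivAt (fun r => ∑' n, β n * r ^ n) (∑' n : ℕ, β n * (n * s ^ (n - 1))) s := by
  obtain ⟨t, hst, ht1⟩ := exists_between hs
  have ht0 : 0 < t := (abs_nonneg s).trans_lt hst
  have hs' : s ∈ Set.Ioo (-t) t := abs_lt.1 hst
  refine hasDerivAt_tsum_of_isPreconnected ((hβ.mul_pow 1 ht0.le ht1).mul_left t⁻¹) isOpen_Ioo
    isPreconnected_Ioo (fun n r _ => (hasDerivAt_pow n r).const_mul (β n)) (fun n r hr => ?_) hs'
    ?_ hs'
  · rw [norm_mul, norm_mul, norm_pow, Real.norm_eq_abs, Real.norm_eq_abs, Real.norm_eq_abs,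
      Nat.abs_cast, mul_left_comm t⁻¹]
    refine mul_le_mul_of_nonneg_left ?_ (abs_nonneg _)
    cases n with
    | zero => simp
    | succ n =>
      calc ((n + 1 : ℕ) : ℝ) * |r| ^ (n + 1 - 1) ≤ (n + 1 : ℕ) * t ^ n := by
            rw [Nat.add_sub_cancel]
            gcongr
            exact (abs_lt.2 hr).le
        _ = t⁻¹ * ((n + 1 : ℕ) ^ 1 * t ^ (n + 1)) := by
          field_simp
          ring
  · refine Summable.of_norm ((hβ |s| (abs_nonneg s) hs).congr fun n => ?_)
    rw [norm_mul, norm_pow, Real.norm_eq_abs, Real.norm_eq_abs]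

theorem abs_eval_derivative_legendrePoly_le (n : ℕ) {x : Space3} (hx : ‖x‖ = 1) :
    |(Polynomial.derivative (legendrePoly n)).eval (x 2)| ≤ n ^ 2 := by
  simpa [solidLegendre_of_norm_eq_one 1 n hx] using pow_mul_abs_solidLegendre_le 1 n hx.le

theorem solidSeries_smul_sinAzimuth_smul (β : ℕ → ℝ) (s : ℝ) {x : Space3} (hx : ‖x‖ = 1) :
    solidSeries 1 β (s • x) • sinAzimuth (s • x) =
      (∑' n, β n * (Polynomial.derivative (legendrePoly n)).eval (x 2) * s ^ n) •
        sinAzimuth x := by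
  rw [sinAzimuth_smul, smul_smul, mul_comm, solidSeries, ← tsum_mul_left]
  congr 1
  refine tsum_congr fun n => ?_
  have hhom := pow_mul_solidLegendre_smul 1 n s x
  rw [solidLegendre_of_norm_eq_one 1 n hx, pow_one, Function.iterate_one] at hhom
  linear_combination β n * hhom

end HarmonicExtension

section SphereIntegration

variable {E : Type*} [NormedAddCommGroup E]

theorem continuous_comp_sphere {F : Type*} [TopologicalSpace F] {h : E → F}
    (hh : ∀ x : Metric.sphere (0 : E) 1, ContinuousAt h x) :
    Continuous fun x : Metric.sphere (0 : E) 1 => h x :=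
  continuous_iff_continuousAt.2 fun x => (hh x).comp continuousAt_subtype_val

theorem integrable_of_continuous_sphere [NormedSpace ℝ E] [FiniteDimensional ℝ E]
    [MeasurableSpace E] [BorelSpace E] {μ : Measure (Metric.sphere (0 : E) 1)}
    [IsFiniteMeasure μ] {F : Type*} [NormedAddCommGroup F] {f : Metric.sphere (0 : E) 1 → F}
    (hf : Continuous f) : Integrable f μ :=
  hf.integrable_of_hasCompactSupport (HasCompactSupport.of_compactSpace _)

theorem hasDerivAt_integral_of_compact {X : Type*} [TopologicalSpace X] [CompactSpace X]
    [MeasurableSpace X] [OpensMeasurableSpace X] {μ : Measure X} [IsFiniteMeasure μ]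
    {F F' : ℝ → X → ℝ} {U : Set ℝ} (hU : IsOpen U) (hF : ∀ t ∈ U, Continuous (F t))
    (hderiv : ∀ t ∈ U, ∀ x, HasDerivAt (F · x) (F' t x) t)
    (hF' : ContinuousOn (Function.uncurry F') (U ×ˢ Set.univ)) {t : ℝ} (ht : t ∈ U) :
    HasDerivAt (fun t => ∫ x, F t x ∂μ) (∫ x, F' t x ∂μ) t := by
  obtain ⟨ε, hε, hεU⟩ := Metric.nhds_basis_closedBall.mem_iff.1 (hU.mem_nhds ht)
  obtain ⟨C, hC⟩ := ((isCompact_closedBall t ε).prod isCompact_univ).exists_bound_of_continuousOn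
    (hF'.mono (Set.prod_mono hεU Set.Subset.rfl))
  have hF't : Continuous (F' t) := by
    rw [← continuousOn_univ]
    exact hF'.comp (f := fun x : X => (t, x)) (by fun_prop) fun x _ => ⟨ht, trivial⟩
  refine (hasDerivAt_integral_of_dominated_loc_of_deriv_le (F := F) (F' := F') (bound := fun _ => C)
    (Metric.closedBall_mem_nhds t hε) ?_ ?_ hF't.aestronglyMeasurable ?_ (integrable_const C) ?_).2
  · filter_upwards [hU.mem_nhds ht] with s hs using (hF s hs).aestronglyMeasurable
  · exact (hF t ht).integrable_of_hasCompactSupport (HasCompactSupport.of_compactSpace _)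
  · exact ae_of_all _ fun x s hs => hC (s, x) ⟨hs, trivial⟩
  · exact ae_of_all _ fun x s hs => hderiv s (hεU hs) x

variable [InnerProductSpace ℝ E]

/-- The derivative of `h` along the linear vector field `x ↦ A x`. For skew-adjoint `A` this field
is tangent to the spheres, and its flow `exp (t A)` consists of rotations. -/
noncomputable def flowDeriv (A : E →L[ℝ] E) (h : E → ℝ) (x : E) : ℝ := fderiv ℝ h x (A x)

theorem contDiffAt_flowDeriv (A : E →L[ℝ] E) {n : WithTop ℕ∞} {h : E → ℝ} {x : E}
    (hh : ContDiffAt ℝ (n + 1) h x) : ContDiffAt ℝ n (flowDeriv A h) x :=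
  (hh.fderiv_right le_rfl).clm_apply A.contDiff.contDiffAt

theorem flowDeriv_mul (A : E →L[ℝ] E) {f g : E → ℝ} {x : E} (hf : DifferentiableAt ℝ f x)
    (hg : DifferentiableAt ℝ g x) :
    flowDeriv A (fun y => f y * g y) x = f x * flowDeriv A g x + flowDeriv A f x * g x := by
  rw [flowDeriv, (hf.hasFDerivAt.fun_mul hg.hasFDerivAt).fderiv]
  simp [flowDeriv, mul_comm]

theorem flowDeriv_flowDeriv (A : E →L[ℝ] E) {f : E → ℝ} {x : E} (hf : ContDiffAt ℝ 2 f x) :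
    flowDeriv A (flowDeriv A f) x =
      fderiv ℝ (fderiv ℝ f) x (A x) (A x) + fderiv ℝ f x (A (A x)) := by
  have hdiff : DifferentiableAt ℝ (fderiv ℝ f) x :=
    (hf.fderiv_right (m := 1) (by norm_num)).differentiableAt one_ne_zero
  have hderiv : HasFDerivAt (flowDeriv A f) _ x := hdiff.hasFDerivAt.clm_apply A.hasFDerivAt
  rw [flowDeriv, hderiv.fderiv]
  simp [add_comm]

/-- The generator `x ↦ ⟪u, x⟫ v - ⟪v, x⟫ u` of the rotations in the plane of orthonormal `u, v`. -/
noncomputable def rotGen (u v : E) : E →L[ℝ] E :=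
  InnerProductSpace.rankOne ℝ v u - InnerProductSpace.rankOne ℝ u v

theorem rotGen_apply (u v x : E) : rotGen u v x = inner ℝ u x • v - inner ℝ v x • u := by
  simp [rotGen]

variable [FiniteDimensional ℝ E]

theorem rotGen_mem_skewAdjoint (u v : E) : rotGen u v ∈ skewAdjoint (E →L[ℝ] E) := by
  rw [skewAdjoint.mem_iff, ContinuousLinearMap.star_eq_adjoint, rotGen, map_sub,
    InnerProductSpace.adjoint_rankOne, InnerProductSpace.adjoint_rankOne, neg_sub]

/-- The angular part of the Laplacian: on functions that are homogeneous of degree zero, and at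
points of the unit sphere, it is the Laplacian itself. -/
noncomputable def angularLaplacian (f : E → ℝ) (x : E) : ℝ :=
  ‖x‖ ^ 2 * Laplacian.laplacian f x - fderiv ℝ (fderiv ℝ f) x x x -
    (Module.finrank ℝ E - 1) * fderiv ℝ f x x

theorem sum_flowDeriv_rotGen_flowDeriv_rotGen {ι : Type*} [Fintype ι] (b : OrthonormalBasis ι ℝ E)
    {f : E → ℝ} {x : E} (hf : ContDiffAt ℝ 2 f x) :
    ∑ i, ∑ j, flowDeriv (rotGen (b i) (b j)) (flowDeriv (rotGen (b i) (b j)) f) x =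
      2 * angularLaplacian f x := by
  classical
  have hgen (i j : ι) : flowDeriv (rotGen (b i) (b j)) (flowDeriv (rotGen (b i) (b j)) f) x =
      inner ℝ (b i) x ^ 2 * fderiv ℝ (fderiv ℝ f) x (b j) (b j) -
        inner ℝ (b i) x * (inner ℝ (b j) x * fderiv ℝ (fderiv ℝ f) x (b i) (b j)) -
        inner ℝ (b j) x * (inner ℝ (b i) x * fderiv ℝ (fderiv ℝ f) x (b j) (b i)) +
        inner ℝ (b j) x ^ 2 * fderiv ℝ (fderiv ℝ f) x (b i) (b i) +
        (if i = j then 2 * (inner ℝ (b i) x * fderiv ℝ f x (b i)) else 0) -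
        inner ℝ (b i) x * fderiv ℝ f x (b i) - inner ℝ (b j) x * fderiv ℝ f x (b j) := by
    rw [flowDeriv_flowDeriv _ hf]
    simp only [rotGen_apply, b.inner_eq_ite, map_sub, map_smul,
      _root_.sub_apply, _root_.smul_apply, smul_eq_mul]
    split_ifs with hij hji hji
    · subst hij
      simp
      ring
    · exact absurd hij.symm hji
    · exact absurd hji.symm hij
    · simp
      ring
  have hsecond : ∑ i, ∑ j, inner ℝ (b i) x * (inner ℝ (b j) x *
      fderiv ℝ (fderiv ℝ f) x (b i) (b j)) = fderiv ℝ (fderiv ℝ f) x x x := by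
    simp only [← Finset.mul_sum, sum_inner_mul_apply b]
    exact sum_inner_mul_apply b ((fderiv ℝ (fderiv ℝ f) x).flip x) x
  have hnorm : ∑ i, inner ℝ (b i) x ^ 2 = ‖x‖ ^ 2 := by
    simpa using b.sum_sq_norm_inner_right x
  have hcard : (Module.finrank ℝ E : ℝ) = Fintype.card ι := by
    rw [Module.finrank_eq_card_basis b.toBasis]
  simp only [hgen, Finset.sum_add_distrib, Finset.sum_sub_distrib, hsecond, Finset.sum_ite_eq,
    Finset.mem_univ, if_true]
  rw [Finset.sum_comm (f := fun i j => inner ℝ (b j) x * (inner ℝ (b i) x *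
    fderiv ℝ (fderiv ℝ f) x (b j) (b i))), hsecond]
  simp only [Finset.sum_const, nsmul_eq_mul, ← Finset.mul_sum, ← Finset.sum_mul, hnorm,
    sum_inner_mul_apply b, ← laplacian_eq_sum_fderiv_fderiv b, Finset.card_univ]
  rw [angularLaplacian, hcard]
  ring

variable [MeasurableSpace E] [BorelSpace E]

open scoped Pointwise in
theorem measurePreserving_sphere (e : E ≃ₗᵢ[ℝ] E)
    {φ : Metric.sphere (0 : E) 1 → Metric.sphere (0 : E) 1} (hφ : ∀ x, (φ x : E) = e x) :
    MeasurePreserving φ (volume : Measure E).toSphere (volume : Measure E).toSphere := by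
  have hφcont : Continuous φ := by
    refine continuous_induced_rng.2 ?_
    simp only [Function.comp_def, hφ]
    fun_prop
  refine ⟨hφcont.measurable, Measure.ext fun s hs => ?_⟩
  rw [Measure.map_apply hφcont.measurable hs, Measure.toSphere_apply' _ hs,
    Measure.toSphere_apply' _ (hφcont.measurable hs)]
  congr 1
  have hcone : Set.Ioo (0 : ℝ) 1 • ((↑) '' (φ ⁻¹' s) : Set E) =
      e ⁻¹' (Set.Ioo (0 : ℝ) 1 • ((↑) '' s : Set E)) := by
    ext y
    simp only [Set.mem_smul, Set.mem_preimage, Set.mem_image]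
    constructor
    · rintro ⟨r, hr, _, ⟨x, hx, rfl⟩, rfl⟩
      exact ⟨r, hr, _, ⟨φ x, hx, rfl⟩, by rw [hφ, map_smul]⟩
    · rintro ⟨r, hr, _, ⟨x, hx, rfl⟩, hy⟩
      let z : Metric.sphere (0 : E) 1 := ⟨e.symm x, by simp⟩
      have hz : φ z = x := Subtype.ext (by simp [hφ, z])
      refine ⟨r, hr, _, ⟨z, by rwa [hz], rfl⟩, e.injective ?_⟩
      rw [map_smul, ← hφ, hz, hy]
  rw [hcone]
  exact e.measurePreserving.measure_preimage_equiv (f := e.toMeasurableEquiv) _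

theorem integral_flowDeriv_eq_zero {A : E →L[ℝ] E} (hA : A ∈ skewAdjoint (E →L[ℝ] E)) {h : E → ℝ}
    (hh : ∀ x : Metric.sphere (0 : E) 1, ContDiffAt ℝ 1 h x) :
    ∫ x : Metric.sphere (0 : E) 1, flowDeriv A h x ∂(volume : Measure E).toSphere = 0 := by
  let _ : NormedAlgebra ℚ (E →L[ℝ] E) := NormedAlgebra.restrictScalars ℚ ℝ _
  have hunitary (t : ℝ) : NormedSpace.exp (t • A) ∈ unitary (E →L[ℝ] E) :=
    NormedSpace.exp_mem_unitary_of_mem_skewAdjoint (skewAdjoint.smul_mem t hA)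
  let rot (t : ℝ) : E ≃ₗᵢ[ℝ] E := Unitary.linearIsometryEquiv ⟨_, hunitary t⟩
  let φ (t : ℝ) (x : Metric.sphere (0 : E) 1) : Metric.sphere (0 : E) 1 := ⟨rot t x, by simp⟩
  have hmp (t : ℝ) := measurePreserving_sphere (rot t) (φ := φ t) fun _ => rfl
  have hφderiv (t : ℝ) (x : Metric.sphere (0 : E) 1) :
      HasDerivAt (fun t => (φ t x : E)) (A (φ t x)) t :=
    (hasDerivAt_exp_smul_const' A t).clm_apply (hasDerivAt_const t (x : E)) |>.congr_deriv <| by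
      simp [φ, rot]
      rfl
  have hexp : Continuous fun t : ℝ => NormedSpace.exp (t • A) :=
    continuous_iff_continuousAt.2 fun t => (hasDerivAt_exp_smul_const' A t).continuousAt
  have hφcont : Continuous fun p : ℝ × Metric.sphere (0 : E) 1 => φ p.1 p.2 :=
    continuous_induced_rng.2 <|
      (hexp.comp continuous_fst).clm_apply (continuous_subtype_val.comp continuous_snd)
  have hcont := continuous_comp_sphere fun x => (hh x).continuousAt
  have hcont' := continuous_comp_sphere fun x =>
    (contDiffAt_flowDeriv A (n := 0) (by simpa using hh x)).continuousAt
  have hinv (t : ℝ) : ∫ x, h (φ t x) ∂(volume : Measure E).toSphere =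
      ∫ x : Metric.sphere (0 : E) 1, h x ∂(volume : Measure E).toSphere := by
    rw [← integral_map (hmp t).measurable.aemeasurable (f := fun x : Metric.sphere (0 : E) 1 => h x)
      hcont.aestronglyMeasurable, (hmp t).map_eq]
  have hderiv := hasDerivAt_integral_of_compact (μ := (volume : Measure E).toSphere)
    (F := fun t x => h (φ t x)) (F' := fun t x => flowDeriv A h (φ t x)) isOpen_univ
    (fun t _ => hcont.comp (hφcont.comp (Continuous.prodMk_right t)))
    (fun t _ x => ((hh (φ t x)).differentiableAt one_ne_zero).hasFDerivAt.comp_hasDerivAt t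
      (hφderiv t x)) (hcont'.comp hφcont).continuousOn (Set.mem_univ 0)
  have hzero : φ 0 = id := funext fun x => Subtype.ext <| by
    simp [φ, rot]
    rfl
  simp only [hinv, hzero, id] at hderiv
  exact hderiv.unique (hasDerivAt_const _ _)

theorem integral_mul_flowDeriv {A : E →L[ℝ] E} (hA : A ∈ skewAdjoint (E →L[ℝ] E)) {f g : E → ℝ}
    (hf : ∀ x : Metric.sphere (0 : E) 1, ContDiffAt ℝ 1 f x)
    (hg : ∀ x : Metric.sphere (0 : E) 1, ContDiffAt ℝ 1 g x) :
    ∫ x : Metric.sphere (0 : E) 1, f x * flowDeriv A g x ∂(volume : Measure E).toSphere =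
      -∫ x : Metric.sphere (0 : E) 1, flowDeriv A f x * g x ∂(volume : Measure E).toSphere := by
  have hint {f g : E → ℝ} (hf : ∀ x : Metric.sphere (0 : E) 1, ContDiffAt ℝ 1 f x)
      (hg : ∀ x : Metric.sphere (0 : E) 1, ContDiffAt ℝ 1 g x) :
      Integrable (fun x : Metric.sphere (0 : E) 1 => f x * flowDeriv A g x)
        (volume : Measure E).toSphere :=
    integrable_of_continuous_sphere (continuous_comp_sphere fun x => (hf x).continuousAt.mul
      (contDiffAt_flowDeriv A (n := 0) (by simpa using hg x)).continuousAt)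
  have hzero := integral_flowDeriv_eq_zero hA (h := fun y => f y * g y) fun x => (hf x).mul (hg x)
  simp only [flowDeriv_mul A ((hf _).differentiableAt one_ne_zero)
    ((hg _).differentiableAt one_ne_zero)] at hzero
  rw [integral_add (hint hf hg) ((hint hg hf).congr (ae_of_all _ fun x => mul_comm _ _))] at hzero
  exact eq_neg_of_add_eq_zero_left hzero

end SphereIntegration

section AngularLaplacian

variable {E : Type*} [NormedAddCommGroup E] [InnerProductSpace ℝ E]

theorem flowDeriv_comp_smul (A : E →L[ℝ] E) (f : E → ℝ) (s : ℝ) :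
    flowDeriv A (fun y => f (s • y)) = fun x => flowDeriv A f (s • x) := by
  funext x
  rw [flowDeriv, fderiv_comp_smul]
  simp [flowDeriv]

theorem contDiffAt_comp_smul {n : WithTop ℕ∞} {f : E → ℝ} {s : ℝ} {x : E}
    (hf : ContDiffAt ℝ n f (s • x)) : ContDiffAt ℝ n (fun y => f (s • y)) x :=
  hf.comp x (contDiff_const_smul s).contDiffAt

variable [FiniteDimensional ℝ E]

theorem norm_sq_mul_laplacian {m : ℕ} (hE : Module.finrank ℝ E = m + 2) {f : E → ℝ} {x : E}
    (hf : ContDiffAt ℝ 2 f x) :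
    ‖x‖ ^ 2 * Laplacian.laplacian f x =
      flowDeriv 1 (flowDeriv 1 f) x + m * flowDeriv 1 f x + angularLaplacian f x := by
  rw [flowDeriv_flowDeriv _ hf, flowDeriv, angularLaplacian, hE]
  push_cast
  simp only [id]
  ring

theorem angularLaplacian_comp_smul {f : E → ℝ} {s : ℝ} {x : E} (hf : ContDiffAt ℝ 2 f (s • x)) :
    angularLaplacian (fun y => f (s • y)) x = angularLaplacian f (s • x) := by
  refine mul_left_cancel₀ (two_ne_zero (α := ℝ)) ?_
  rw [← sum_flowDeriv_rotGen_flowDeriv_rotGen (stdOrthonormalBasis ℝ E) hf,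
    ← sum_flowDeriv_rotGen_flowDeriv_rotGen (stdOrthonormalBasis ℝ E) (contDiffAt_comp_smul hf)]
  simp only [flowDeriv_comp_smul]

variable [MeasurableSpace E] [BorelSpace E]

theorem integral_mul_angularLaplacian {ι : Type*} [Fintype ι] (b : OrthonormalBasis ι ℝ E)
    {f g : E → ℝ} (hf : ∀ x : Metric.sphere (0 : E) 1, ContDiffAt ℝ 1 f x)
    (hg : ∀ x : Metric.sphere (0 : E) 1, ContDiffAt ℝ 2 g x) :
    2 * ∫ x : Metric.sphere (0 : E) 1, f x * angularLaplacian g x ∂(volume : Measure E).toSphere =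
      -∑ i, ∑ j, ∫ x : Metric.sphere (0 : E) 1, flowDeriv (rotGen (b i) (b j)) f x *
        flowDeriv (rotGen (b i) (b j)) g x ∂(volume : Measure E).toSphere := by
  have hderiv (A : E →L[ℝ] E) (x : Metric.sphere (0 : E) 1) : ContDiffAt ℝ 1 (flowDeriv A g) x :=
    contDiffAt_flowDeriv A (by simpa [one_add_one_eq_two] using hg x)
  have hint (A : E →L[ℝ] E) : Integrable (fun x : Metric.sphere (0 : E) 1 =>
      f x * flowDeriv A (flowDeriv A g) x) (volume : Measure E).toSphere :=
    integrable_of_continuous_sphere (continuous_comp_sphere fun x => (hf x).continuousAt.mul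
      (contDiffAt_flowDeriv A (n := 0) (by simpa using hderiv A x)).continuousAt)
  simp only [← integral_const_mul, mul_left_comm (2 : ℝ),
    ← sum_flowDeriv_rotGen_flowDeriv_rotGen b (hg _), Finset.mul_sum, ← Finset.sum_neg_distrib]
  rw [integral_finsetSum _ fun i _ => integrable_finsetSum _ fun j _ => hint _]
  refine Finset.sum_congr rfl fun i _ => ?_
  rw [integral_finsetSum _ fun j _ => hint _]
  exact Finset.sum_congr rfl fun j _ =>
    integral_mul_flowDeriv (rotGen_mem_skewAdjoint _ _) hf (hderiv _)

theorem integral_mul_angularLaplacian_nonpos {f : E → ℝ}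
    (hf : ∀ x : Metric.sphere (0 : E) 1, ContDiffAt ℝ 2 f x) :
    ∫ x : Metric.sphere (0 : E) 1, f x * angularLaplacian f x ∂(volume : Measure E).toSphere ≤
      0 := by
  have hsum := integral_mul_angularLaplacian (stdOrthonormalBasis ℝ E)
    (fun x => (hf x).of_le one_le_two) hf
  have hnonneg : 0 ≤ ∑ i, ∑ j, ∫ x : Metric.sphere (0 : E) 1,
      flowDeriv (rotGen (stdOrthonormalBasis ℝ E i) (stdOrthonormalBasis ℝ E j)) f x *
        flowDeriv (rotGen (stdOrthonormalBasis ℝ E i) (stdOrthonormalBasis ℝ E j)) f x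
        ∂(volume : Measure E).toSphere :=
    Finset.sum_nonneg fun i _ => Finset.sum_nonneg fun j _ =>
      integral_nonneg fun x => mul_self_nonneg _
  linarith

theorem integral_mul_angularLaplacian_comm {f g : E → ℝ}
    (hf : ∀ x : Metric.sphere (0 : E) 1, ContDiffAt ℝ 2 f x)
    (hg : ∀ x : Metric.sphere (0 : E) 1, ContDiffAt ℝ 2 g x) :
    ∫ x : Metric.sphere (0 : E) 1, f x * angularLaplacian g x ∂(volume : Measure E).toSphere =
      ∫ x : Metric.sphere (0 : E) 1, angularLaplacian f x * g x ∂(volume : Measure E).toSphere := by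
  refine mul_left_cancel₀ (two_ne_zero (α := ℝ)) ?_
  simp only [mul_comm (angularLaplacian f _)]
  rw [integral_mul_angularLaplacian (stdOrthonormalBasis ℝ E) (fun x => (hf x).of_le one_le_two) hg,
    integral_mul_angularLaplacian (stdOrthonormalBasis ℝ E) (fun x => (hg x).of_le one_le_two) hf]
  simp only [mul_comm]

end AngularLaplacian

section DirichletToNeumannUniqueness

theorem integral_sq_eq_toReal_eLpNorm_sq {X : Type*} [MeasurableSpace X] {μ : Measure X} {g : X → ℝ}
    (hg : AEStronglyMeasurable g μ) : ∫ x, g x ^ 2 ∂μ = (eLpNorm g 2 μ).toReal ^ 2 := by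
  rw [toReal_eLpNorm hg, lpNorm_eq_integral_norm_rpow_toReal two_ne_zero ENNReal.ofNat_ne_top hg,
    ← Real.rpow_natCast, ← Real.rpow_mul (integral_nonneg fun x => by positivity)]
  simp

variable {E : Type*} [NormedAddCommGroup E]

theorem smul_mem_ball [NormedSpace ℝ E] {s : ℝ} (hs : s ∈ Set.Ioo (-1 : ℝ) 1)
    (x : Metric.sphere (0 : E) 1) : s • (x : E) ∈ Metric.ball (0 : E) 1 := by
  rw [mem_ball_zero_iff, norm_smul, norm_eq_of_mem_sphere, mul_one]
  exact abs_lt.2 hs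

theorem continuous_comp_smul_sphere [NormedSpace ℝ E] {F : Type*} [TopologicalSpace F] {f : E → F}
    (hf : ContinuousOn f (Metric.ball 0 1)) {s : ℝ} (hs : s ∈ Set.Ioo (-1 : ℝ) 1) :
    Continuous fun x : Metric.sphere (0 : E) 1 => f (s • (x : E)) :=
  hf.comp_continuous (by fun_prop) (smul_mem_ball hs)

theorem hasDerivAt_comp_smul_left [NormedSpace ℝ E] {F : Type*} [NormedAddCommGroup F]
    [NormedSpace ℝ F] {f : E → F} {s : ℝ} {x : E} (hf : DifferentiableAt ℝ f (s • x)) :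
    HasDerivAt (fun r : ℝ => f (r • x)) (fderiv ℝ f (s • x) x) s :=
  hf.hasFDerivAt.comp_hasDerivAt s (by simpa using (hasDerivAt_id s).smul_const x)

variable [InnerProductSpace ℝ E] [FiniteDimensional ℝ E]

open InnerProductSpace

theorem contDiffOn_mul_flowDeriv {f : E → ℝ} (hf : HarmonicOnNhd f (Metric.ball 0 1)) :
    ContDiffOn ℝ 1 (fun y => f y * flowDeriv 1 f y) (Metric.ball 0 1) := fun y hy =>
  (((hf y hy).1.of_le one_le_two).mul (contDiffAt_flowDeriv 1 (by
    simpa [one_add_one_eq_two] using (hf y hy).1))).contDiffWithinAt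

variable [MeasurableSpace E] [BorelSpace E]

theorem hasDerivAt_integral_comp_smul {h : E → ℝ} (hh : ContDiffOn ℝ 1 h (Metric.ball 0 1)) {s : ℝ}
    (hs : s ∈ Set.Ioo (-1 : ℝ) 1) :
    HasDerivAt (fun s : ℝ => ∫ x : Metric.sphere (0 : E) 1, h (s • (x : E))
        ∂(volume : Measure E).toSphere)
      (∫ x : Metric.sphere (0 : E) 1, fderiv ℝ h (s • (x : E)) x
        ∂(volume : Measure E).toSphere) s := by
  have hsmul : ContinuousOn (fun p : ℝ × Metric.sphere (0 : E) 1 => p.1 • (p.2 : E))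
    (Set.Ioo (-1 : ℝ) 1 ×ˢ Set.univ) := by fun_prop
  exact hasDerivAt_integral_of_compact (F := fun s (x : Metric.sphere (0 : E) 1) => h (s • (x : E)))
    (F' := fun s (x : Metric.sphere (0 : E) 1) => fderiv ℝ h (s • (x : E)) x) isOpen_Ioo
    (fun t ht => continuous_comp_smul_sphere hh.continuousOn ht)
    (fun t ht x => hasDerivAt_comp_smul_left ((hh.contDiffAt
      (Metric.isOpen_ball.mem_nhds (smul_mem_ball ht x))).differentiableAt one_ne_zero))
    (((hh.continuousOn_fderiv_of_isOpen Metric.isOpen_ball le_rfl).comp hsmul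
      fun p hp => smul_mem_ball hp.1 p.2).clm_apply (by fun_prop)) hs

theorem mul_deriv_integral_comp_smul {h : E → ℝ} (hh : ContDiffOn ℝ 1 h (Metric.ball 0 1)) {s : ℝ}
    (hs : s ∈ Set.Ioo (-1 : ℝ) 1) :
    s * deriv (fun s : ℝ => ∫ x : Metric.sphere (0 : E) 1, h (s • (x : E))
        ∂(volume : Measure E).toSphere) s =
      ∫ x : Metric.sphere (0 : E) 1, flowDeriv 1 h (s • (x : E))
        ∂(volume : Measure E).toSphere := by
  rw [(hasDerivAt_integral_comp_smul hh hs).deriv, ← integral_const_mul]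
  simp [flowDeriv]

variable {m : ℕ} (hE : Module.finrank ℝ E = m + 2) {f : E → ℝ}
  (hf : HarmonicOnNhd f (Metric.ball 0 1))

include hf

theorem mul_deriv_integral_sq_comp_smul {s : ℝ} (hs : s ∈ Set.Ioo (-1 : ℝ) 1) :
    s * deriv (fun s : ℝ => ∫ x : Metric.sphere (0 : E) 1, f (s • (x : E)) ^ 2
        ∂(volume : Measure E).toSphere) s =
      2 * ∫ x : Metric.sphere (0 : E) 1, f (s • (x : E)) * flowDeriv 1 f (s • (x : E))
        ∂(volume : Measure E).toSphere := by
  rw [mul_deriv_integral_comp_smul (h := fun y => f y ^ 2)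
    ((hf.contDiffOn.of_le one_le_two).pow 2) hs, ← integral_const_mul]
  refine integral_congr_ae (ae_of_all _ fun x => ?_)
  have hdiff := (hf _ (smul_mem_ball hs x)).1.differentiableAt two_ne_zero
  simp only [sq, flowDeriv_mul 1 hdiff hdiff]
  ring

include hE

theorem integral_flowDeriv_mul_flowDeriv_nonneg {s : ℝ} (hs : s ∈ Set.Ioo (-1 : ℝ) 1) :
    0 ≤ ∫ x : Metric.sphere (0 : E) 1, flowDeriv 1 (fun y => f y * flowDeriv 1 f y) (s • (x : E))
        ∂(volume : Measure E).toSphere +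
      m * ∫ x : Metric.sphere (0 : E) 1, f (s • (x : E)) * flowDeriv 1 f (s • (x : E))
        ∂(volume : Measure E).toSphere := by
  have hf_at (x : Metric.sphere (0 : E) 1) := hf _ (smul_mem_ball hs x)
  have hderiv (x : Metric.sphere (0 : E) 1) : ContDiffAt ℝ 1 (flowDeriv 1 f) (s • (x : E)) :=
    contDiffAt_flowDeriv 1 (by simpa [one_add_one_eq_two] using (hf_at x).1)
  have hpoint (x : Metric.sphere (0 : E) 1) :
      f (s • (x : E)) * angularLaplacian (fun y => f (s • y)) x = flowDeriv 1 f (s • (x : E)) ^ 2 -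
        (flowDeriv 1 (fun y => f y * flowDeriv 1 f y) (s • (x : E)) +
          m * (f (s • (x : E)) * flowDeriv 1 f (s • (x : E)))) := by
    have hlap := norm_sq_mul_laplacian hE (hf_at x).1
    rw [(hf_at x).2.self_of_nhds, Pi.zero_apply, mul_zero] at hlap
    rw [angularLaplacian_comp_smul (hf_at x).1, flowDeriv_mul 1
      ((hf_at x).1.differentiableAt two_ne_zero) ((hderiv x).differentiableAt one_ne_zero)]
    linear_combination -f (s • (x : E)) * hlap
  have hprod := contDiffOn_mul_flowDeriv hf
  have hint_mul := integrable_of_continuous_sphere (μ := (volume : Measure E).toSphere)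
    (continuous_comp_smul_sphere hprod.continuousOn hs)
  have hint_deriv := integrable_of_continuous_sphere (μ := (volume : Measure E).toSphere)
    (continuous_comp_smul_sphere (f := flowDeriv 1 fun y => f y * flowDeriv 1 f y)
      ((hprod.continuousOn_fderiv_of_isOpen Metric.isOpen_ball le_rfl).clm_apply
        (by fun_prop)) hs)
  have hint_sq := integrable_of_continuous_sphere (μ := (volume : Measure E).toSphere)
    (continuous_comp_smul_sphere (f := fun y => flowDeriv 1 f y ^ 2)
      (((hf.contDiffOn.continuousOn_fderiv_of_isOpen Metric.isOpen_ball one_le_two).clm_apply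
        (by fun_prop)).pow 2) hs)
  have hnonpos := integral_mul_angularLaplacian_nonpos (f := fun y => f (s • y))
    fun x => contDiffAt_comp_smul (hf_at x).1
  simp only [hpoint] at hnonpos
  rw [integral_sub hint_sq (by exact hint_deriv.add (hint_mul.const_mul m)),
    integral_add hint_deriv (hint_mul.const_mul _), integral_const_mul] at hnonpos
  exact (integral_nonneg fun x => sq_nonneg _).trans (sub_nonpos.1 hnonpos)

theorem integral_mul_flowDeriv_nonneg {s : ℝ} (hs : s ∈ Set.Ico (0 : ℝ) 1) :
    0 ≤ ∫ x : Metric.sphere (0 : E) 1, f (s • (x : E)) * flowDeriv 1 f (s • (x : E))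
      ∂(volume : Measure E).toSphere := by
  let K (s : ℝ) := ∫ x : Metric.sphere (0 : E) 1, f (s • (x : E)) * flowDeriv 1 f (s • (x : E))
    ∂(volume : Measure E).toSphere
  have hK {s : ℝ} (hs : s ∈ Set.Ioo (-1 : ℝ) 1) : DifferentiableAt ℝ K s :=
    (hasDerivAt_integral_comp_smul (contDiffOn_mul_flowDeriv hf) hs).differentiableAt
  have hΦ {s : ℝ} (hs : s ∈ Set.Ioo (-1 : ℝ) 1) : DifferentiableAt ℝ (fun s => s ^ m * K s) s :=
    (differentiableAt_id.pow m).mul (hK hs)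
  have hmono : MonotoneOn (fun s => s ^ m * K s) (Set.Ico 0 1) := by
    refine monotoneOn_of_deriv_nonneg (convex_Ico 0 1)
      (fun s hs => (hΦ ⟨by linarith [hs.1], hs.2⟩).continuousAt.continuousWithinAt)
      (fun s hs => ?_) fun s hs => ?_ <;> rw [interior_Ico] at hs
    · exact (hΦ ⟨by linarith [hs.1], hs.2⟩).differentiableWithinAt
    have hs' : s ∈ Set.Ioo (-1 : ℝ) 1 := ⟨by linarith [hs.1], hs.2⟩
    have hderiv : deriv (fun s => s ^ m * K s) s = s ^ m * (s * deriv K s + m * K s) / s := by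
      rw [((hasDerivAt_pow m s).fun_mul (hK hs').hasDerivAt).deriv]
      rcases m with _ | m
      · simp [hs.1.ne']
      · have hs0 := hs.1.ne'
        field_simp
        simp
        ring
    rw [hderiv, mul_deriv_integral_comp_smul (contDiffOn_mul_flowDeriv hf) hs']
    exact div_nonneg (mul_nonneg (pow_nonneg hs.1.le m)
      (integral_flowDeriv_mul_flowDeriv_nonneg hE hf hs')) hs.1.le
  rcases hs.1.eq_or_lt with rfl | hpos
  · simp [flowDeriv]
  · have hzero : K 0 = 0 := by simp [K, flowDeriv]
    have hle := hmono (Set.left_mem_Ico.2 one_pos) hs hpos.le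
    simp only [hzero, mul_zero] at hle
    exact (mul_nonneg_iff_of_pos_left (pow_pos hpos m)).1 hle

theorem monotoneOn_integral_sq_comp_smul :
    MonotoneOn (fun s : ℝ => ∫ x : Metric.sphere (0 : E) 1, f (s • (x : E)) ^ 2
      ∂(volume : Measure E).toSphere) (Set.Ico 0 1) := by
  have hdiff {s : ℝ} (hs : s ∈ Set.Ico 0 1) := (hasDerivAt_integral_comp_smul
    (h := fun y => f y ^ 2) ((hf.contDiffOn.of_le one_le_two).pow 2)
    (s := s) ⟨by linarith [hs.1], hs.2⟩).differentiableAt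
  refine monotoneOn_of_deriv_nonneg (convex_Ico 0 1)
    (fun s hs => (hdiff hs).continuousAt.continuousWithinAt)
    (fun s hs => (hdiff (interior_subset hs)).differentiableWithinAt) fun s hs => ?_
  rw [interior_Ico] at hs
  refine (mul_nonneg_iff_of_pos_left hs.1).1 ?_
  rw [mul_deriv_integral_sq_comp_smul hf ⟨by linarith [hs.1], hs.2⟩]
  exact mul_nonneg zero_le_two (integral_mul_flowDeriv_nonneg hE hf ⟨hs.1.le, hs.2⟩)

theorem eq_zero_of_tendsto_integral_sq
    (hlim : Tendsto (fun s : ℝ => ∫ x : Metric.sphere (0 : E) 1, f (s • (x : E)) ^ 2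
      ∂(volume : Measure E).toSphere) (𝓝[<] 1) (𝓝 0)) {s : ℝ} (hs : s ∈ Set.Ico (0 : ℝ) 1)
    (x : Metric.sphere (0 : E) 1) : f (s • (x : E)) = 0 := by
  have hcont : Continuous fun x : Metric.sphere (0 : E) 1 => f (s • (x : E)) ^ 2 :=
    (continuous_comp_smul_sphere hf.continuousOn ⟨by linarith [hs.1], hs.2⟩).pow 2
  have hle : ∫ x : Metric.sphere (0 : E) 1, f (s • (x : E)) ^ 2 ∂(volume : Measure E).toSphere ≤
      0 := by
    refine ge_of_tendsto hlim ?_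
    filter_upwards [Ioo_mem_nhdsLT hs.2] with r hr
    exact monotoneOn_integral_sq_comp_smul hE hf hs ⟨hs.1.trans hr.1.le, hr.2⟩ hr.1.le
  by_contra hne
  exact hle.not_gt (hcont.integral_pos_of_hasCompactSupport_nonneg_nonzero
    (HasCompactSupport.of_compactSpace _) (fun x => sq_nonneg _) (pow_ne_zero 2 hne))

omit hE hf

theorem eq_zero_of_tendsto_eLpNorm (hE : Module.finrank ℝ E = m + 2) {F : Type*}
    [NormedAddCommGroup F] [InnerProductSpace ℝ F] {f : E → F}
    (hf : HarmonicOnNhd f (Metric.ball 0 1))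
    (hlim : Tendsto (fun s : ℝ => eLpNorm (fun x : Metric.sphere (0 : E) 1 => f (s • (x : E))) 2
      (volume : Measure E).toSphere) (𝓝[<] 1) (𝓝 0)) {s : ℝ} (hs : s ∈ Set.Ico (0 : ℝ) 1)
    (x : Metric.sphere (0 : E) 1) : f (s • (x : E)) = 0 := by
  refine ext_inner_left ℝ fun a => ?_
  rw [inner_zero_right]
  have hfa : HarmonicOnNhd (fun y => inner ℝ a (f y)) (Metric.ball 0 1) := hf.comp_CLM (innerSL ℝ a)
  refine eq_zero_of_tendsto_integral_sq hE hfa ?_ hs x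
  have hlim_inner : Tendsto (fun s : ℝ => eLpNorm (fun x : Metric.sphere (0 : E) 1 =>
      inner ℝ a (f (s • (x : E)))) 2 (volume : Measure E).toSphere) (𝓝[<] 1) (𝓝 0) := by
    refine tendsto_of_tendsto_of_tendsto_of_le_of_le tendsto_const_nhds
      (by simpa using ENNReal.Tendsto.const_mul hlim (Or.inr (ENNReal.coe_ne_top (r := ‖a‖₊))))
      (fun _ => zero_le) fun s => ?_
    have hle := eLpNorm_le_nnreal_smul_eLpNorm_of_ae_le_mul
      (ae_of_all (volume : Measure E).toSphere fun x : Metric.sphere (0 : E) 1 =>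
        nnnorm_inner_le_nnnorm (𝕜 := ℝ) a (f (s • (x : E)))) 2
    rwa [ENNReal.smul_def, smul_eq_mul] at hle
  have hsq := ((ENNReal.tendsto_toReal ENNReal.zero_ne_top).comp hlim_inner).pow 2
  rw [ENNReal.toReal_zero, zero_pow two_ne_zero] at hsq
  refine hsq.congr' ?_
  filter_upwards [Ioo_mem_nhdsLT (neg_one_lt_zero.trans one_pos)] with r hr
  exact (integral_sq_eq_toReal_eLpNorm_sq
    (continuous_comp_smul_sphere hfa.continuousOn hr).aestronglyMeasurable).symm

theorem ae_eq_of_tendsto_eLpNorm_sub {X ι F : Type*} [MeasurableSpace X] {μ : Measure X}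
    [NormedAddCommGroup F] {p : ENNReal} (hp : 1 ≤ p) {l : Filter ι} [l.NeBot] {G : ι → X → F}
    {w₁ w₂ : X → F} (hG : ∀ᶠ i in l, AEStronglyMeasurable (G i) μ)
    (hw₁ : AEStronglyMeasurable w₁ μ) (hw₂ : AEStronglyMeasurable w₂ μ)
    (hlim₁ : Tendsto (fun i => eLpNorm (fun x => G i x - w₁ x) p μ) l (𝓝 0))
    (hlim₂ : Tendsto (fun i => eLpNorm (fun x => G i x - w₂ x) p μ) l (𝓝 0)) : w₁ =ᵐ[μ] w₂ := by
  have hle : ∀ᶠ i in l, eLpNorm (w₂ - w₁) p μ ≤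
      eLpNorm (fun x => G i x - w₁ x) p μ + eLpNorm (fun x => G i x - w₂ x) p μ := by
    filter_upwards [hG] with i hi
    refine (le_of_eq ?_).trans (eLpNorm_sub_le (hi.sub hw₁) (hi.sub hw₂) hp)
    congr 1
    funext x
    simp
  have hzero := ge_of_tendsto (by simpa using hlim₁.add hlim₂) hle
  rw [nonpos_iff_eq_zero, eLpNorm_eq_zero_iff (hw₂.sub hw₁) (one_pos.trans_le hp).ne'] at hzero
  filter_upwards [hzero] with x hx
  exact (sub_eq_zero.1 hx).symm

theorem IsDirichletToNeumann.ae_eq {g w₁ w₂ : Sphere2 → Space3} (h₁ : IsDirichletToNeumann g w₁)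
    (h₂ : IsDirichletToNeumann g w₂) : w₁ =ᵐ[sphereMeasure] w₂ := by
  obtain ⟨hg, hw₁, f₁, hf₁, hb₁, hd₁⟩ := h₁
  obtain ⟨-, hw₂, f₂, hf₂, hb₂, hd₂⟩ := h₂
  have hmeas {f : Space3 → Space3} (hf : HarmonicOnNhd f (Metric.ball 0 1)) :
      ∀ᶠ s : ℝ in 𝓝[<] 1,
        AEStronglyMeasurable (fun x : Sphere2 => f (s • (x : Space3)) - g x) sphereMeasure := by
    filter_upwards [Ioo_mem_nhdsLT (neg_one_lt_zero.trans one_pos)] with s hs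
    exact (continuous_comp_smul_sphere hf.continuousOn hs).aestronglyMeasurable.sub hg.1
  have hlim : Tendsto (fun s : ℝ =>
      eLpNorm (fun x : Sphere2 => (f₁ - f₂) (s • (x : Space3))) 2 sphereMeasure)
      (𝓝[<] 1) (𝓝 0) := by
    refine tendsto_of_tendsto_of_tendsto_of_le_of_le' tendsto_const_nhds
      (by simpa using hb₁.add hb₂) (Eventually.of_forall fun _ => zero_le) ?_
    filter_upwards [hmeas hf₁, hmeas hf₂] with s hs₁ hs₂
    simpa [Pi.sub_def] using eLpNorm_sub_le hs₁ hs₂ one_le_two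
  have heq (x : Sphere2) {s : ℝ} (hs : s ∈ Set.Ioo (0 : ℝ) 1) :
      f₁ (s • (x : Space3)) = f₂ (s • (x : Space3)) :=
    sub_eq_zero.1 (eq_zero_of_tendsto_eLpNorm (m := 1) (by simp) (hf₁.sub hf₂) hlim
      (Set.Ioo_subset_Ico_self hs) x)
  have hmeas_deriv : ∀ᶠ s : ℝ in 𝓝[<] 1, AEStronglyMeasurable
      (fun x : Sphere2 => deriv (fun r : ℝ => f₁ (r • (x : Space3))) s) sphereMeasure := by
    filter_upwards [Ioo_mem_nhdsLT (neg_one_lt_zero.trans one_pos)] with s hs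
    refine Continuous.aestronglyMeasurable ?_
    simp only [fun x : Sphere2 => (hasDerivAt_comp_smul_left
      ((hf₁ _ (smul_mem_ball hs x)).1.differentiableAt two_ne_zero)).deriv]
    exact (continuous_comp_smul_sphere (hf₁.contDiffOn.continuousOn_fderiv_of_isOpen
      Metric.isOpen_ball one_le_two) hs).clm_apply continuous_subtype_val
  refine ae_eq_of_tendsto_eLpNorm_sub one_le_two hmeas_deriv hw₁.1 hw₂.1 hd₁ (hd₂.congr' ?_)
  filter_upwards [Ioo_mem_nhdsLT one_pos] with s hs
  refine congrArg (eLpNorm · 2 sphereMeasure) (funext fun x => congrArg (· - w₂ x) ?_)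
  refine EventuallyEq.deriv_eq ?_
  filter_upwards [isOpen_Ioo.mem_nhds hs] with r hr using (heq x hr).symm

end DirichletToNeumannUniqueness

section RadialExtension

variable {E : Type*} [NormedAddCommGroup E] [InnerProductSpace ℝ E]

theorem contDiffAt_comp_inv_norm_smul {n : WithTop ℕ∞} {f : E → ℝ} (hf : ContDiff ℝ n f) {x : E}
    (hx : x ≠ 0) : ContDiffAt ℝ n (fun y => f (‖y‖⁻¹ • y)) x :=
  hf.contDiffAt.comp x (((contDiffAt_norm ℝ hx).inv (norm_ne_zero_iff.2 hx)).smul contDiffAt_id)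

theorem flowDeriv_one_comp_inv_norm_smul {f : E → ℝ} (hf : ContDiff ℝ 1 f) {x : E} (hx : x ≠ 0) :
    flowDeriv 1 (fun y => f (‖y‖⁻¹ • y)) x = 0 := by
  have hdiff : DifferentiableAt ℝ (fun y => f (‖y‖⁻¹ • y)) ((1 : ℝ) • x) := by
    rw [one_smul]
    exact (contDiffAt_comp_inv_norm_smul hf hx).differentiableAt one_ne_zero
  have hderiv := hasDerivAt_comp_smul_left hdiff
  rw [one_smul] at hderiv
  refine hderiv.unique ((hasDerivAt_const (1 : ℝ) (f (‖x‖⁻¹ • x))).congr_of_eventuallyEq ?_)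
  filter_upwards [lt_mem_nhds (zero_lt_one' ℝ)] with r hr
  rw [norm_smul, Real.norm_of_nonneg hr.le, smul_smul, mul_inv_rev, mul_assoc,
    inv_mul_cancel₀ hr.ne', mul_one]

theorem laplacian_comp_inv_norm_smul_eq_angularLaplacian [FiniteDimensional ℝ E] {m : ℕ}
    (hE : Module.finrank ℝ E = m + 2) {f : E → ℝ} (hf : ContDiff ℝ 2 f)
    (x : Metric.sphere (0 : E) 1) :
    Laplacian.laplacian (fun y => f (‖y‖⁻¹ • y)) (x : E) =
      angularLaplacian (fun y => f (‖y‖⁻¹ • y)) (x : E) := by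
  have hx : (x : E) ≠ 0 := ne_zero_of_mem_unit_sphere x
  have hflow : flowDeriv 1 (fun y => f (‖y‖⁻¹ • y)) =ᶠ[𝓝 (x : E)] fun _ => (0 : ℝ) := by
    filter_upwards [isOpen_ne.mem_nhds hx] with y hy using
      flowDeriv_one_comp_inv_norm_smul (hf.of_le one_le_two) hy
  have hflow_flow : flowDeriv 1 (flowDeriv 1 fun y => f (‖y‖⁻¹ • y)) (x : E) = 0 := by
    rw [flowDeriv, hflow.fderiv_eq, fderiv_const_apply, zero_apply]
  have hlap := norm_sq_mul_laplacian hE (contDiffAt_comp_inv_norm_smul hf hx)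
  rw [hflow_flow, hflow.self_of_nhds, norm_eq_of_mem_sphere] at hlap
  linarith

theorem continuous_laplacian_comp_inv_norm_smul [FiniteDimensional ℝ E] {f : E → ℝ}
    (hf : ContDiff ℝ 2 f) : Continuous fun x : Metric.sphere (0 : E) 1 =>
      Laplacian.laplacian (fun y => f (‖y‖⁻¹ • y)) (x : E) := by
  refine continuous_comp_sphere fun x => ?_
  have hcont : ContinuousAt (fderiv ℝ (fderiv ℝ fun y => f (‖y‖⁻¹ • y))) (x : E) :=
    (((contDiffAt_comp_inv_norm_smul hf (ne_zero_of_mem_unit_sphere x)).fderiv_right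
      (m := 1) (by norm_num)).fderiv_right (m := 0) (by norm_num)).continuousAt
  rw [funext (laplacian_eq_sum_fderiv_fderiv (stdOrthonormalBasis ℝ E) _)]
  fun_prop

end RadialExtension

section ZonalIntegrals

open Polynomial

theorem contDiff_eval_zonal (q : ℝ[X]) {n : WithTop ℕ∞} :
    ContDiff ℝ n fun y : Space3 => q.eval (y 2) :=
  ContDiff.comp (g := fun t : ℝ => q.eval t) (by simpa using q.contDiff_aeval (𝕜 := ℝ) n)
    (EuclideanSpace.proj (𝕜 := ℝ) (2 : Fin 3)).contDiff

theorem hasFDerivAt_eval_zonal (q : ℝ[X]) (x : Space3) :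
    HasFDerivAt (fun y : Space3 => q.eval (y 2))
      ((derivative q).eval (x 2) • EuclideanSpace.proj (𝕜 := ℝ) (2 : Fin 3)) x :=
  HasDerivAt.comp_hasFDerivAt (h₂ := fun t : ℝ => q.eval t) (f := fun y : Space3 => y 2) x
    (q.hasDerivAt (x 2)) (EuclideanSpace.proj (𝕜 := ℝ) (2 : Fin 3)).hasFDerivAt

theorem continuous_eval_zonal (q : ℝ[X]) : Continuous fun x : Sphere2 => q.eval ((x : Space3) 2) :=
  (contDiff_eval_zonal q (n := 0)).continuous.comp continuous_subtype_val

theorem fderiv_fderiv_eval_zonal (q : ℝ[X]) (x k : Space3) :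
    fderiv ℝ (fderiv ℝ fun y : Space3 => q.eval (y 2)) x k k =
      (derivative (derivative q)).eval (x 2) * k 2 ^ 2 := by
  rw [fderiv_fderiv_apply (contDiff_eval_zonal q).contDiffAt]
  simp only [(hasFDerivAt_eval_zonal q _).fderiv, smul_apply, smul_eq_mul]
  rw [((hasFDerivAt_eval_zonal (derivative q) x).mul_const _).fderiv]
  simp
  ring

theorem angularLaplacian_eval_zonal (q : ℝ[X]) (x : Sphere2) :
    angularLaplacian (fun y : Space3 => q.eval (y 2)) (x : Space3) =
      (derivative ((1 - X ^ 2) * derivative q)).eval ((x : Space3) 2) := by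
  rw [angularLaplacian, laplacian_eq_sum_fderiv_fderiv (EuclideanSpace.basisFun (Fin 3) ℝ)]
  simp only [fderiv_fderiv_eval_zonal, (hasFDerivAt_eval_zonal q _).fderiv, norm_eq_of_mem_sphere]
  simp
  ring

/-- Integration of the zonal functions `q (cos θ)` over the sphere. -/
noncomputable def zonalIntegral : ℝ[X] →ₗ[ℝ] ℝ where
  toFun q := ∫ x : Sphere2, q.eval ((x : Space3) 2) ∂sphereMeasure
  map_add' p q := by
    simp only [eval_add]
    exact integral_add (integrable_of_continuous_sphere (continuous_eval_zonal p))
      (integrable_of_continuous_sphere (continuous_eval_zonal q))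
  map_smul' c q := by
    simp only [eval_smul, smul_eq_mul, RingHom.id_apply]
    exact integral_const_mul _ _

theorem zonalIntegral_apply (q : ℝ[X]) :
    zonalIntegral q = ∫ x : Sphere2, q.eval ((x : Space3) 2) ∂sphereMeasure := rfl

theorem zonalIntegral_C_mul (c : ℝ) (q : ℝ[X]) :
    zonalIntegral (C c * q) = c * zonalIntegral q := by
  rw [C_mul', map_smul, smul_eq_mul]

theorem zonalIntegral_mul_derivative_comm (p q : ℝ[X]) :
    zonalIntegral (p * derivative ((1 - X ^ 2) * derivative q)) =
      zonalIntegral (derivative ((1 - X ^ 2) * derivative p) * q) := by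
  have hcomm := integral_mul_angularLaplacian_comm
    (fun x : Sphere2 => (contDiff_eval_zonal p (n := 2)).contDiffAt (x := (x : Space3)))
    (fun x : Sphere2 => (contDiff_eval_zonal q).contDiffAt)
  simpa only [angularLaplacian_eval_zonal, zonalIntegral_apply, eval_mul] using hcomm

theorem zonalIntegral_derivative_mul_derivative (p q : ℝ[X]) :
    zonalIntegral ((1 - X ^ 2) * derivative p * derivative q) =
      -zonalIntegral (p * derivative ((1 - X ^ 2) * derivative q)) := by
  have hzero : zonalIntegral (derivative ((1 - X ^ 2) * derivative (p * q))) = 0 := by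
    simpa using zonalIntegral_mul_derivative_comm 1 (p * q)
  have hleibniz : derivative ((1 - X ^ 2) * derivative (p * q)) =
      derivative ((1 - X ^ 2) * derivative p) * q + p * derivative ((1 - X ^ 2) * derivative q) +
        2 • ((1 - X ^ 2) * derivative p * derivative q) := by
    simp only [derivative_mul, derivative_sub, derivative_one, derivative_X_pow, derivative_add]
    ring
  rw [hleibniz, map_add, map_add, map_nsmul, ← zonalIntegral_mul_derivative_comm p q,
    nsmul_eq_mul, Nat.cast_ofNat] at hzero
  linarith

theorem zonalIntegral_mul_derivative_legendrePoly (p : ℝ[X]) (l : ℕ) :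
    zonalIntegral (p * derivative ((1 - X ^ 2) * derivative (legendrePoly l))) =
      -((l : ℝ) * (l + 1)) * zonalIntegral (p * legendrePoly l) := by
  rw [derivative_one_sub_X_sq_mul_derivative_legendrePoly, mul_neg, mul_left_comm, map_neg,
    zonalIntegral_C_mul, neg_mul]

theorem zonalIntegral_legendrePoly_mul_of_ne {l m : ℕ} (hlm : l ≠ m) :
    zonalIntegral (legendrePoly l * legendrePoly m) = 0 := by
  have hcomm := zonalIntegral_mul_derivative_comm (legendrePoly l) (legendrePoly m)
  rw [mul_comm _ (legendrePoly m), zonalIntegral_mul_derivative_legendrePoly,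
    zonalIntegral_mul_derivative_legendrePoly, mul_comm (legendrePoly m)] at hcomm
  have hprod : ((l : ℝ) - m) * ((l : ℝ) + m + 1) *
      zonalIntegral (legendrePoly l * legendrePoly m) = 0 := by
    linear_combination hcomm
  have hsub : (l : ℝ) - m ≠ 0 := sub_ne_zero.2 (by exact_mod_cast hlm)
  have hadd : (l : ℝ) + m + 1 ≠ 0 := by positivity
  simpa [hsub, hadd] using hprod

theorem zonalIntegral_X_mul_legendrePoly_mul_legendrePoly_succ (l : ℕ) :
    (2 * (l : ℝ) + 3) * zonalIntegral (X * legendrePoly (l + 1) * legendrePoly l) =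
      ((l : ℝ) + 1) * zonalIntegral (legendrePoly l * legendrePoly l) := by
  have h := congrArg (fun q => zonalIntegral (q * legendrePoly l)) (legendrePoly_add_two l)
  simp only [sub_mul, mul_assoc, zonalIntegral_C_mul, map_sub] at h
  rw [zonalIntegral_legendrePoly_mul_of_ne (by omega)] at h
  rw [mul_assoc]
  linarith

theorem zonalIntegral_legendrePoly_succ_sq (l : ℕ) :
    (2 * (l : ℝ) + 3) * zonalIntegral (legendrePoly (l + 1) * legendrePoly (l + 1)) =
      (2 * (l : ℝ) + 1) * zonalIntegral (legendrePoly l * legendrePoly l) := by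
  have hlower := zonalIntegral_X_mul_legendrePoly_mul_legendrePoly_succ l
  rcases l with _ | l
  · simpa [legendrePoly_zero, legendrePoly_one] using hlower
  have hupper := congrArg (fun q => zonalIntegral (q * legendrePoly (l + 2)))
    (legendrePoly_add_two l)
  simp only [sub_mul, mul_assoc, zonalIntegral_C_mul, map_sub] at hupper
  rw [zonalIntegral_legendrePoly_mul_of_ne (l := l) (m := l + 2) (by omega),
    mul_comm (legendrePoly (l + 1)), ← mul_assoc X] at hupper
  have hl : (l : ℝ) + 2 ≠ 0 := by positivity
  refine mul_left_cancel₀ hl ?_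
  push_cast at hlower ⊢
  linear_combination (2 * (l : ℝ) + 5) * hupper + (2 * (l : ℝ) + 3) * hlower

theorem zonalIntegral_legendrePoly_sq (l : ℕ) :
    (2 * (l : ℝ) + 1) * zonalIntegral (legendrePoly l * legendrePoly l) = zonalIntegral 1 := by
  induction l with
  | zero => simp [legendrePoly_zero]
  | succ l ih =>
    rw [← ih, ← zonalIntegral_legendrePoly_succ_sq l]
    push_cast
    ring

theorem zonalIntegral_derivative_legendrePoly_sq (l : ℕ) :
    (2 * (l : ℝ) + 1) *
        zonalIntegral ((1 - X ^ 2) * derivative (legendrePoly l) * derivative (legendrePoly l)) =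
      l * (l + 1) * zonalIntegral 1 := by
  rw [zonalIntegral_derivative_mul_derivative, zonalIntegral_mul_derivative_legendrePoly,
    ← zonalIntegral_legendrePoly_sq l]
  ring

end ZonalIntegrals

section LaplaceBeltrami

theorem sphereLaplacian_eq_angularLaplacian {f : Space3 → ℝ} (hf : ContDiff ℝ 2 f) (x : Sphere2) :
    sphereLaplacian f x = angularLaplacian (fun y => f (‖y‖⁻¹ • y)) (x : Space3) :=
  laplacian_comp_inv_norm_smul_eq_angularLaplacian (m := 1) (by simp) hf x

theorem continuous_sphereLaplacian {f : Space3 → ℝ} (hf : ContDiff ℝ 2 f) :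
    Continuous (sphereLaplacian f) :=
  continuous_laplacian_comp_inv_norm_smul hf

theorem integral_legendrePoly_mul_sphereLaplacian (l : ℕ) {f : Space3 → ℝ}
    (hf : ContDiff ℝ 2 f) :
    ∫ x : Sphere2, (legendrePoly l).eval ((x : Space3) 2) * sphereLaplacian f x ∂sphereMeasure =
      -((l : ℝ) * (l + 1)) *
        ∫ x : Sphere2, (legendrePoly l).eval ((x : Space3) 2) * f x ∂sphereMeasure := by
  simp only [sphereLaplacian_eq_angularLaplacian hf]
  rw [integral_mul_angularLaplacian_comm
      (fun x : Sphere2 => (contDiff_eval_zonal (legendrePoly l)).contDiffAt (x := (x : Space3)))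
      (fun x => contDiffAt_comp_inv_norm_smul hf (ne_zero_of_mem_unit_sphere x)),
    ← integral_const_mul]
  refine integral_congr_ae (ae_of_all _ fun x => ?_)
  simp only [angularLaplacian_eval_zonal, derivative_one_sub_X_sq_mul_derivative_legendrePoly,
    norm_eq_of_mem_sphere, inv_one, one_smul, Polynomial.eval_neg, Polynomial.eval_mul,
    Polynomial.eval_C]
  ring

theorem memLp_of_continuous_sphere {E : Type*} [NormedAddCommGroup E] {f : Sphere2 → E}
    (hf : Continuous f) (p : ENNReal) : MemLp f p sphereMeasure :=
  hf.memLp_of_hasCompactSupport (HasCompactSupport.of_compactSpace _)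

theorem ae_eq_zero_of_integral_mul_smooth_eq_zero {w : Sphere2 → ℝ}
    (hw : Integrable w sphereMeasure)
    (h : ∀ f : Space3 → ℝ, ContDiff ℝ ∞ f → ∫ x : Sphere2, w x * f x ∂sphereMeasure = 0) :
    w =ᵐ[sphereMeasure] 0 := by
  have hemb : MeasurableEmbedding (Subtype.val : Sphere2 → Space3) :=
    MeasurableEmbedding.subtype_coe Metric.isClosed_sphere.measurableSet
  let W : Space3 → ℝ := Function.extend Subtype.val w 0
  have hW (x : Sphere2) : W x = w x := Subtype.val_injective.extend_apply _ _ _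
  have hWint : Integrable W (Measure.map Subtype.val sphereMeasure) :=
    hemb.integrable_map_iff.2 (hw.congr (ae_of_all _ fun x => (hW x).symm))
  have hzero := ae_eq_zero_of_integral_contDiff_smul_eq_zero hWint.locallyIntegrable
    fun g hg _ => by
      rw [hemb.integral_map, ← h g hg]
      exact integral_congr_ae (ae_of_all _ fun x => by simp only [hW, smul_eq_mul, mul_comm])
  filter_upwards [hemb.ae_map_iff.1 hzero] with x hx
  rw [← hW, hx, Pi.zero_apply]

theorem IsLaplaceBeltrami.ae_eq {u w₁ w₂ : Sphere2 → ℝ} (h₁ : IsLaplaceBeltrami u w₁)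
    (h₂ : IsLaplaceBeltrami u w₂) : w₁ =ᵐ[sphereMeasure] w₂ := by
  obtain ⟨-, hw₁, h₁⟩ := h₁
  obtain ⟨-, hw₂, h₂⟩ := h₂
  have hint {w : Sphere2 → ℝ} {f : Space3 → ℝ} (hw : MemLp w 2 sphereMeasure)
      (hf : ContDiff ℝ ∞ f) : Integrable (fun x : Sphere2 => w x * f x) sphereMeasure :=
    hw.integrable_mul (memLp_of_continuous_sphere (hf.continuous.comp continuous_subtype_val) 2)
  have hzero := ae_eq_zero_of_integral_mul_smooth_eq_zero (w := fun x => w₁ x - w₂ x)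
    ((hw₁.sub hw₂).integrable one_le_two) fun f hf => by
      simp only [sub_mul]
      rw [integral_sub (hint hw₁ hf) (hint hw₂ hf), ← h₁ f hf, ← h₂ f hf, sub_self]
  filter_upwards [hzero] with x hx
  exact sub_eq_zero.1 hx

end LaplaceBeltrami

section ZonalFields

open Polynomial

/-- Square integrable vector fields on the sphere. -/
abbrev L2Field : Type := Lp Space3 2 sphereMeasure

/-- The field `sin θ e_φ` as a continuous map on the sphere. -/
noncomputable def azimuthMap : C(Sphere2, Space3) where
  toFun x := sinAzimuth x
  continuous_toFun := by
    unfold sinAzimuth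
    fun_prop

/-- Multiplication by the field `sin θ e_φ`, as an operator on `L²`. -/
noncomputable def azimuthMul : L2Sphere →L[ℝ] L2Field :=
  ((ContinuousLinearMap.lsmul ℝ ℝ : ℝ →L[ℝ] Space3 →L[ℝ] Space3).holderL
    sphereMeasure 2 ⊤ 2).flip (ContinuousMap.toLp ⊤ sphereMeasure ℝ azimuthMap)

/-- The inner product with the field `sin θ e_φ`, as an operator on `L²`. -/
noncomputable def azimuthInner : L2Field →L[ℝ] L2Sphere :=
  (innerSL ℝ : Space3 →L[ℝ] Space3 →L[ℝ] ℝ).holderL sphereMeasure ⊤ 2 2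
    (ContinuousMap.toLp ⊤ sphereMeasure ℝ azimuthMap)

/-- The zonal function `q(cos θ)` in `L²`, for a polynomial `q`. -/
noncomputable def zonalLp : ℝ[X] →ₗ[ℝ] L2Sphere :=
  (ContinuousMap.toLp 2 sphereMeasure ℝ).toLinearMap ∘ₗ
    (aeval (⟨fun x => (x : Space3) 2, by fun_prop⟩ : C(Sphere2, ℝ))).toLinearMap

/-- The azimuthal field `q(cos θ) sin θ e_φ` in `L²`, for a polynomial `q`. -/
noncomputable def azimuthalLp : ℝ[X] →ₗ[ℝ] L2Field := azimuthMul.toLinearMap ∘ₗ zonalLp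

theorem azimuthMul_coe (u : L2Sphere) :
    azimuthMul u =ᵐ[sphereMeasure] fun x => u x • sinAzimuth x := by
  filter_upwards [(ContinuousLinearMap.lsmul ℝ ℝ : ℝ →L[ℝ] Space3 →L[ℝ] Space3).coeFn_holder
      (r := 2) u (ContinuousMap.toLp ⊤ sphereMeasure ℝ azimuthMap),
    ContinuousMap.coeFn_toLp (p := ⊤) (𝕜 := ℝ) sphereMeasure azimuthMap] with x hmul hazimuth
  rw [hazimuth] at hmul
  exact hmul

theorem azimuthInner_coe (G : L2Field) :
    azimuthInner G =ᵐ[sphereMeasure] fun x => inner ℝ (sinAzimuth x) (G x) := by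
  filter_upwards [(innerSL ℝ : Space3 →L[ℝ] Space3 →L[ℝ] ℝ).coeFn_holder (r := 2)
      (ContinuousMap.toLp ⊤ sphereMeasure ℝ azimuthMap) G,
    ContinuousMap.coeFn_toLp (p := ⊤) (𝕜 := ℝ) sphereMeasure azimuthMap] with x hinner hazimuth
  rw [hazimuth] at hinner
  exact hinner

theorem zonalLp_coe (q : ℝ[X]) :
    zonalLp q =ᵐ[sphereMeasure] fun x => q.eval ((x : Space3) 2) := by
  filter_upwards [ContinuousMap.coeFn_toLp (p := 2) (𝕜 := ℝ) sphereMeasure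
    (aeval (⟨fun x => (x : Space3) 2, by fun_prop⟩ : C(Sphere2, ℝ)) q)] with x hx
  exact hx.trans (by rw [aeval_continuousMap_apply, ContinuousMap.coe_mk])

theorem azimuthalLp_coe (q : ℝ[X]) :
    azimuthalLp q =ᵐ[sphereMeasure] fun x => q.eval ((x : Space3) 2) • sinAzimuth x := by
  filter_upwards [azimuthMul_coe (zonalLp q), zonalLp_coe q] with x hmul hq
  exact hmul.trans (by rw [hq])

theorem inner_sinAzimuth_self (x : Sphere2) :
    inner ℝ (sinAzimuth x) (sinAzimuth x) = 1 - (x : Space3) 2 ^ 2 := by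
  have hx : (x : Space3) 0 ^ 2 + (x : Space3) 1 ^ 2 + (x : Space3) 2 ^ 2 = 1 := by
    rw [← Fin.sum_univ_three fun i => (x : Space3) i ^ 2, ← EuclideanSpace.real_norm_sq_eq,
      norm_eq_of_mem_sphere, one_pow]
  simp only [sinAzimuth, PiLp.inner_apply, Fin.sum_univ_three, RCLike.inner_apply, conj_trivial]
  simp
  linear_combination hx

theorem inner_zonalLp (p q : ℝ[X]) : inner ℝ (zonalLp p) (zonalLp q) = zonalIntegral (p * q) := by
  rw [L2.inner_def, zonalIntegral_apply]
  refine integral_congr_ae ?_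
  filter_upwards [zonalLp_coe p, zonalLp_coe q] with x hp hq
  rw [hp, hq, eval_mul, mul_comm]
  rfl

theorem norm_sq_azimuthalLp (q : ℝ[X]) :
    ‖azimuthalLp q‖ ^ 2 = zonalIntegral ((1 - X ^ 2) * q * q) := by
  rw [← real_inner_self_eq_norm_sq, L2.inner_def, zonalIntegral_apply]
  refine integral_congr_ae ?_
  filter_upwards [azimuthalLp_coe q] with x hq
  rw [hq, inner_smul_left, inner_smul_right, inner_sinAzimuth_self]
  simp only [conj_trivial, eval_mul, eval_sub, eval_one, eval_pow, eval_X]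
  ring

theorem azimuthInner_azimuthalLp (q : ℝ[X]) :
    azimuthInner (azimuthalLp q) = zonalLp ((1 - X ^ 2) * q) := by
  refine Lp.ext ?_
  filter_upwards [azimuthInner_coe (azimuthalLp q), azimuthalLp_coe q,
    zonalLp_coe ((1 - X ^ 2) * q)] with x hinner hq hprod
  rw [hinner, hq, hprod, inner_smul_right, inner_sinAzimuth_self]
  simp only [eval_mul, eval_sub, eval_one, eval_pow, eval_X]
  ring

end ZonalFields

section AzimuthalHarmonics

open Polynomial

/-- The azimuthal harmonic `P_n'(cos θ) sin θ e_φ`, a vector spherical harmonic of degree `n`. It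
vanishes for `n = 0`. -/
noncomputable def azimuthalHarmonic (n : ℕ) : L2Field := azimuthalLp (derivative (legendrePoly n))

theorem azimuthalHarmonic_zero : azimuthalHarmonic 0 = 0 := by
  rw [azimuthalHarmonic, legendrePoly_zero, derivative_one, map_zero]

theorem norm_smul_azimuthalHarmonic_le (c : ℝ) (n : ℕ) :
    ‖c • azimuthalHarmonic n‖ ≤ ‖(n * c) • azimuthalHarmonic n‖ := by
  rcases n.eq_zero_or_pos with rfl | hn
  · simp [azimuthalHarmonic_zero]
  · rw [mul_smul, norm_smul (n : ℝ), Real.norm_natCast]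
    exact le_mul_of_one_le_left (norm_nonneg _) (by exact_mod_cast hn)

theorem norm_sq_azimuthalHarmonic (n : ℕ) :
    (2 * (n : ℝ) + 1) * ‖azimuthalHarmonic n‖ ^ 2 = n * (n + 1) * zonalIntegral 1 := by
  rw [azimuthalHarmonic, norm_sq_azimuthalLp, zonalIntegral_derivative_legendrePoly_sq]

theorem azimuthMul_zonalLp_legendrePoly_succ (l : ℕ) :
    (2 * (l : ℝ) + 3) • azimuthMul (zonalLp (legendrePoly (l + 1))) =
      azimuthalHarmonic (l + 2) - azimuthalHarmonic l := by
  rw [azimuthalHarmonic, derivative_legendrePoly_add_two, ← smul_eq_C_mul, map_add, map_smul,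
    azimuthalHarmonic, add_sub_cancel_left]
  rfl

theorem azimuthMul_zonalLp_legendrePoly_zero :
    azimuthMul (zonalLp (legendrePoly 0)) = azimuthalHarmonic 1 := by
  rw [azimuthalHarmonic, legendrePoly_one, legendrePoly_zero, derivative_X]
  rfl

theorem coeFn_tsum_toLp {X F ι : Type*} [TopologicalSpace X] [CompactSpace X] [MeasurableSpace X]
    [BorelSpace X] [NormedAddCommGroup F] [NormedSpace ℝ F] [SecondCountableTopologyEither X F]
    {p : ENNReal} [Fact (1 ≤ p)] (ν : Measure X) [IsFiniteMeasure ν] {f : ι → C(X, F)}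
    (hf : Summable f) :
    (∑' i, ContinuousMap.toLp p ν ℝ (f i) : Lp F p ν) =ᵐ[ν] fun x => ∑' i, f i x := by
  rw [← ContinuousLinearMap.map_tsum _ hf]
  filter_upwards [ContinuousMap.coeFn_toLp (p := p) (𝕜 := ℝ) ν (∑' i, f i)] with x hx
  exact hx.trans (ContinuousMap.tsum_apply hf x).symm

theorem coeFn_tsum_smul_azimuthalHarmonic {a : ℕ → ℝ}
    (ha : Summable fun n : ℕ => |a n| * (n : ℝ) ^ 2) :
    (∑' n, a n • azimuthalHarmonic n : L2Field) =ᵐ[sphereMeasure] fun x =>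
      (∑' n, a n * (derivative (legendrePoly n)).eval ((x : Space3) 2)) • sinAzimuth x := by
  let height : C(Sphere2, ℝ) := ⟨fun x => (x : Space3) 2, by fun_prop⟩
  let term (n : ℕ) : C(Sphere2, ℝ) := a n • aeval height (derivative (legendrePoly n))
  have hterm (n : ℕ) (x : Sphere2) :
      term n x = a n * (derivative (legendrePoly n)).eval ((x : Space3) 2) := by
    simp [term, height, aeval_continuousMap_apply]
  have hsum : Summable term := by
    refine ha.of_norm_bounded fun n => (ContinuousMap.norm_le _ (by positivity)).2 fun x => ?_
    rw [hterm, norm_mul, Real.norm_eq_abs, Real.norm_eq_abs]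
    gcongr
    exact abs_eval_derivative_legendrePoly_le n (norm_eq_of_mem_sphere x)
  have hseries : (∑' n, a n • azimuthalHarmonic n : L2Field) =
      azimuthMul (∑' n, ContinuousMap.toLp 2 sphereMeasure ℝ (term n)) := by
    rw [ContinuousLinearMap.map_tsum _ (hsum.mapL _)]
    refine tsum_congr fun n => ?_
    rw [map_smul, map_smul]
    rfl
  rw [hseries]
  filter_upwards [azimuthMul_coe (∑' n, ContinuousMap.toLp 2 sphereMeasure ℝ (term n)),
    coeFn_tsum_toLp (p := 2) sphereMeasure hsum] with x hmul hx
  rw [hmul, hx, tsum_congr (hterm · x)]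

theorem tendsto_tsum_pow_smul {E : Type*} [NormedAddCommGroup E] [NormedSpace ℝ E]
    [CompleteSpace E] {h : ℕ → E} (hh : Summable fun n => ‖h n‖) (k : ℕ → ℕ) :
    Tendsto (fun s : ℝ => ∑' n, s ^ k n • h n) (𝓝[<] 1) (𝓝 (∑' n, h n)) := by
  refine tendsto_tsum_of_dominated_convergence hh (fun n => ?_) ?_
  · have hcont : Continuous fun s : ℝ => s ^ k n • h n := by fun_prop
    simpa using (hcont.tendsto 1).mono_left nhdsWithin_le_nhds
  · filter_upwards [Ioo_mem_nhdsLT (zero_lt_one' ℝ)] with s hs n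
    rw [norm_smul, norm_pow, Real.norm_of_nonneg hs.1.le]
    exact mul_le_of_le_one_left (norm_nonneg _) (pow_le_one₀ hs.1.le hs.2.le)

theorem tendsto_eLpNorm_azimuthal_series {a : ℕ → ℝ} (hdisc : UnitDiscSummable a)
    (ha : Summable fun n => ‖a n • azimuthalHarmonic n‖) {k : ℕ → ℕ} (hk : ∀ n, n ≤ k n + 1) :
    Tendsto (fun s : ℝ => eLpNorm (fun x : Sphere2 =>
      (∑' n, a n * (derivative (legendrePoly n)).eval ((x : Space3) 2) * s ^ k n) • sinAzimuth x -
        (∑' n, a n • azimuthalHarmonic n : L2Field) x) 2 sphereMeasure) (𝓝[<] 1) (𝓝 0) := by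
  refine (tendsto_iff_edist_tendsto_0.1 (tendsto_tsum_pow_smul ha k)).congr' ?_
  filter_upwards [Ioo_mem_nhdsLT (zero_lt_one' ℝ)] with s hs
  have hsum : Summable fun n : ℕ => |s ^ k n * a n| * (n : ℝ) ^ 2 := by
    refine Summable.of_nonneg_of_le (fun n => by positivity) (fun n => ?_)
      ((hdisc.mul_pow 2 hs.1.le hs.2).mul_left s⁻¹)
    have hpow : s ^ k n ≤ s⁻¹ * s ^ n := by
      rw [inv_mul_eq_div, le_div_iff₀ hs.1, ← pow_succ]
      exact pow_le_pow_of_le_one hs.1.le hs.2.le (hk n)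
    calc |s ^ k n * a n| * (n : ℝ) ^ 2 = s ^ k n * (|a n| * (n : ℝ) ^ 2) := by
          rw [abs_mul, abs_of_pos (pow_pos hs.1 _), mul_assoc]
      _ ≤ s⁻¹ * s ^ n * (|a n| * (n : ℝ) ^ 2) := by gcongr
      _ = s⁻¹ * (|a n| * ((n : ℝ) ^ 2 * s ^ n)) := by ring
  rw [Lp.edist_def]
  refine eLpNorm_congr_ae ?_
  filter_upwards [coeFn_tsum_smul_azimuthalHarmonic hsum] with x hx
  simp only [Pi.sub_apply, smul_smul]
  rw [hx]
  congr 3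
  funext n
  ring

theorem isDirichletToNeumann_tsum_azimuthalHarmonic {a : ℕ → ℝ} (hdisc : UnitDiscSummable a)
    (ha : Summable fun n : ℕ => ‖(n * a n) • azimuthalHarmonic n‖) {g : Sphere2 → Space3}
    (hg : g =ᵐ[sphereMeasure] (∑' n, a n • azimuthalHarmonic n : L2Field)) :
    IsDirichletToNeumann g (∑' n : ℕ, (n * a n) • azimuthalHarmonic n : L2Field) := by
  have ha' : Summable fun n => ‖a n • azimuthalHarmonic n‖ := ha.of_nonneg_of_le
    (fun n => norm_nonneg _) fun n => norm_smul_azimuthalHarmonic_le (a n) n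
  have hdisc' : UnitDiscSummable fun n : ℕ => n * a n := by
    simpa only [mul_comm] using hdisc.mul_of_abs_le (c := fun n => (n : ℝ)) 1 fun n => by simp
  refine ⟨(Lp.memLp _).ae_eq hg.symm, Lp.memLp _, fun y => solidSeries 1 a y • sinAzimuth y,
    harmonicOnNhd_solidSeries_smul_sinAzimuth hdisc, ?_, ?_⟩
  · refine (tendsto_eLpNorm_azimuthal_series hdisc ha' (k := id) fun n => n.le_succ).congr
      fun s => eLpNorm_congr_ae ?_
    filter_upwards [hg] with x hx
    rw [hx, solidSeries_smul_sinAzimuth_smul a s (norm_eq_of_mem_sphere x)]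
    rfl
  · refine (tendsto_eLpNorm_azimuthal_series hdisc' ha (k := fun n => n - 1)
      fun n => by lia).congr' ?_
    filter_upwards [Ioo_mem_nhdsLT (zero_lt_one' ℝ)] with s hs
    congr 1
    funext x
    have hseries : (fun r : ℝ => solidSeries 1 a (r • (x : Space3)) • sinAzimuth (r • x)) =
        fun r => (∑' n, a n * (derivative (legendrePoly n)).eval ((x : Space3) 2) * r ^ n) •
          sinAzimuth x :=
      funext fun r => solidSeries_smul_sinAzimuth_smul a r (norm_eq_of_mem_sphere x)
    have hderiv := (hdisc.mul_of_abs_le 2 fun n => abs_eval_derivative_legendrePoly_le n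
      (norm_eq_of_mem_sphere x)).hasDerivAt_tsum (s := s) (abs_lt.2 ⟨by linarith [hs.1], hs.2⟩)
    rw [hseries, (hderiv.smul_const (sinAzimuth (x : Space3))).deriv]
    congr 3
    funext n
    ring

end AzimuthalHarmonics

section ZonalSeries

open Polynomial

theorem zonalIntegral_one : zonalIntegral 1 = 4 * Real.pi := by
  have hvolume : volume (Metric.ball (0 : Space3) 1) = ENNReal.ofReal (Real.pi * 4 / 3) := by
    simp [EuclideanSpace.volume_ball_fin_three]
  simp only [zonalIntegral_apply, eval_one, integral_const, smul_eq_mul, mul_one, Measure.real,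
    Measure.toSphere_apply_univ, hvolume, finrank_euclideanSpace_fin]
  rw [ENNReal.toReal_mul, ENNReal.toReal_natCast, ENNReal.toReal_ofReal (by positivity)]
  ring

/-- The normalization constant of the zonal spherical harmonic `Y_l^0`. -/
noncomputable def zonalConst (l : ℕ) : ℝ := Real.sqrt ((2 * (l : ℝ) + 1) / (4 * Real.pi))

theorem zonalConst_sq (l : ℕ) : zonalConst l ^ 2 = (2 * (l : ℝ) + 1) / (4 * Real.pi) :=
  Real.sq_sqrt (by positivity)

theorem zonalConst_pos (l : ℕ) : 0 < zonalConst l := Real.sqrt_pos.2 (by positivity)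

theorem zonalL2_eq (l : ℕ) : zonalL2 l = zonalConst l • zonalLp (legendrePoly l) := by
  refine Lp.ext ?_
  filter_upwards [ContinuousMap.coeFn_toLp (p := 2) (𝕜 := ℝ) sphereMeasure (zonalHarmonic l),
    Lp.coeFn_smul (zonalConst l) (zonalLp (legendrePoly l)), zonalLp_coe (legendrePoly l)]
    with x hzonal hsmul hlegendre
  rw [hsmul, Pi.smul_apply, hlegendre]
  exact hzonal

theorem orthonormal_zonalL2 : Orthonormal ℝ zonalL2 := by
  rw [orthonormal_iff_ite]
  intro l m
  rw [zonalL2_eq, zonalL2_eq, inner_smul_left, inner_smul_right, inner_zonalLp, conj_trivial]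
  split_ifs with hlm
  · rw [← hlm, ← mul_assoc, ← sq, zonalConst_sq, div_mul_eq_mul_div, zonalIntegral_legendrePoly_sq,
      zonalIntegral_one, div_self (by positivity)]
  · rw [zonalIntegral_legendrePoly_mul_of_ne hlm, mul_zero, mul_zero]

theorem summable_smul_of_orthonormal {ι E : Type*} [NormedAddCommGroup E] [InnerProductSpace ℝ E]
    [CompleteSpace E] {e : ι → E} (he : Orthonormal ℝ e) {c : ι → ℝ}
    (hc : Summable fun i => c i ^ 2) : Summable fun i => c i • e i :=
  (he.orthogonalFamily.summable_iff_norm_sq_summable c).2 (by simpa using hc)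

theorem inner_toLp_sphere (f : C(Sphere2, ℝ)) (u : L2Sphere) :
    inner ℝ (ContinuousMap.toLp 2 sphereMeasure ℝ f) u = ∫ x, u x * f x ∂sphereMeasure := by
  rw [L2.inner_def]
  refine integral_congr_ae ?_
  filter_upwards [ContinuousMap.coeFn_toLp (p := 2) (𝕜 := ℝ) sphereMeasure f] with x hx
  rw [hx]
  rfl

theorem integral_zonalL2_mul (l : ℕ) (g : Sphere2 → ℝ) :
    ∫ x, zonalL2 l x * g x ∂sphereMeasure =
      zonalConst l * ∫ x : Sphere2, (legendrePoly l).eval ((x : Space3) 2) * g x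
        ∂sphereMeasure := by
  rw [← integral_const_mul]
  refine integral_congr_ae ?_
  filter_upwards [ContinuousMap.coeFn_toLp (p := 2) (𝕜 := ℝ) sphereMeasure (zonalHarmonic l)]
    with x hx
  rw [zonalL2, hx, ← mul_assoc]
  rfl

theorem isLaplaceBeltrami_of_hasSum {v : ℕ → ℝ} {u L : L2Sphere}
    (hu : HasSum (fun l => v l • zonalL2 l) u)
    (hL : HasSum (fun l : ℕ => (-((l : ℝ) * (l + 1)) * v l) • zonalL2 l) L) :
    IsLaplaceBeltrami u L := by
  refine ⟨Lp.memLp u, Lp.memLp L, fun f hf => ?_⟩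
  have hf' : ContDiff ℝ 2 f := contDiff_infty.1 hf 2
  let lap : C(Sphere2, ℝ) := ⟨sphereLaplacian f, continuous_sphereLaplacian hf'⟩
  let res : C(Sphere2, ℝ) := ⟨fun x => f x, hf.continuous.comp continuous_subtype_val⟩
  have hharmonic (l : ℕ) : inner ℝ (ContinuousMap.toLp 2 sphereMeasure ℝ lap) (zonalL2 l) =
      -((l : ℝ) * (l + 1)) * inner ℝ (ContinuousMap.toLp 2 sphereMeasure ℝ res) (zonalL2 l) := by
    rw [inner_toLp_sphere, inner_toLp_sphere, integral_zonalL2_mul, integral_zonalL2_mul,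
      mul_left_comm]
    exact congrArg _ (integral_legendrePoly_mul_sphereLaplacian l hf')
  have hlap := (innerSL ℝ (ContinuousMap.toLp 2 sphereMeasure ℝ lap)).hasSum hu
  have hres := (innerSL ℝ (ContinuousMap.toLp 2 sphereMeasure ℝ res)).hasSum hL
  refine (inner_toLp_sphere lap u).symm.trans (Eq.trans ?_ (inner_toLp_sphere res L))
  refine hlap.unique (hres.congr_fun fun l => ?_)
  simp only [innerSL_apply_apply, inner_smul_right, hharmonic]
  ring

end ZonalSeries

section AzimuthalSeries

/-- The coefficient `γ_l` in `Y_l^0 sin θ e_φ = γ_l (H_{l+1} - H_{l-1})`, where `H_n` are the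
azimuthal harmonics. -/
noncomputable def azimuthalConst (l : ℕ) : ℝ := zonalConst l / (2 * (l : ℝ) + 1)

theorem azimuthMul_zonalL2 (l : ℕ) :
    azimuthMul (zonalL2 l) =
      azimuthalConst l • (azimuthalHarmonic (l + 1) - azimuthalHarmonic (l - 1)) := by
  have hlegendre : (2 * (l : ℝ) + 1) • azimuthMul (zonalLp (legendrePoly l)) =
      azimuthalHarmonic (l + 1) - azimuthalHarmonic (l - 1) := by
    cases l with
    | zero => simp [azimuthMul_zonalLp_legendrePoly_zero, azimuthalHarmonic_zero]
    | succ l =>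
      rw [add_tsub_cancel_right, ← azimuthMul_zonalLp_legendrePoly_succ]
      congr 1
      push_cast
      ring
  rw [zonalL2_eq, map_smul, ← hlegendre, smul_smul, azimuthalConst,
    div_mul_cancel₀ _ (by positivity)]

theorem azimuthalConst_nonneg (l : ℕ) : 0 ≤ azimuthalConst l :=
  div_nonneg (zonalConst_pos l).le (by positivity)

theorem azimuthalConst_sq (l : ℕ) :
    azimuthalConst l ^ 2 = 1 / (4 * Real.pi * (2 * (l : ℝ) + 1)) := by
  rw [azimuthalConst, div_pow, zonalConst_sq]
  field_simp

theorem azimuthalConst_le_one (l : ℕ) : azimuthalConst l ≤ 1 := by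
  rw [← sq_le_one_iff₀ (azimuthalConst_nonneg l), azimuthalConst_sq, div_le_one (by positivity)]
  nlinarith [Real.pi_gt_three, (Nat.cast_nonneg l : (0 : ℝ) ≤ l)]

theorem azimuthalConst_mul_norm_azimuthalHarmonic_le {l n : ℕ} (hn : n ≤ l + 1) :
    azimuthalConst l * ‖azimuthalHarmonic n‖ ≤ 1 := by
  have hn' : (n : ℝ) ≤ l + 1 := by exact_mod_cast hn
  have hnorm : ‖azimuthalHarmonic n‖ ^ 2 = n * (n + 1) * (4 * Real.pi) / (2 * (n : ℝ) + 1) := by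
    rw [eq_div_iff (by positivity), mul_comm, norm_sq_azimuthalHarmonic, zonalIntegral_one]
  rw [← sq_le_one_iff₀ (mul_nonneg (azimuthalConst_nonneg l) (norm_nonneg _)), mul_pow,
    azimuthalConst_sq, hnorm]
  have hcancel : 1 / (4 * Real.pi * (2 * (l : ℝ) + 1)) *
      (n * (n + 1) * (4 * Real.pi) / (2 * (n : ℝ) + 1)) =
      n * (n + 1) / ((2 * l + 1) * (2 * n + 1)) := by
    field_simp
  rw [hcancel, div_le_one (by positivity)]
  nlinarith [(Nat.cast_nonneg n : (0 : ℝ) ≤ n), (Nat.cast_nonneg l : (0 : ℝ) ≤ l)]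

theorem summable_succ_mul_abs {v : ℕ → ℝ}
    (hv : Summable fun l : ℕ => ((l : ℝ) + 1) ^ 4 * v l ^ 2) :
    Summable fun l : ℕ => ((l : ℝ) + 1) * |v l| := by
  have hinv : Summable fun l : ℕ => 1 / ((l : ℝ) + 1) ^ 2 := by
    simpa using (summable_nat_add_iff 1).2 (Real.summable_one_div_nat_pow.2 one_lt_two)
  refine Summable.of_nonneg_of_le (fun l => by positivity) (fun l => ?_) (hv.add hinv)
  calc ((l : ℝ) + 1) * |v l| ≤ 2 * (((l : ℝ) + 1) * |v l|) := by
        linarith [show 0 ≤ ((l : ℝ) + 1) * |v l| by positivity]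
    _ = 2 * (((l : ℝ) + 1) ^ 2 * |v l|) * (1 / ((l : ℝ) + 1)) := by field_simp
    _ ≤ (((l : ℝ) + 1) ^ 2 * |v l|) ^ 2 + (1 / ((l : ℝ) + 1)) ^ 2 := two_mul_le_add_sq _ _
    _ = ((l : ℝ) + 1) ^ 4 * v l ^ 2 + 1 / ((l : ℝ) + 1) ^ 2 := by
        rw [mul_pow, sq_abs, ← pow_mul, div_pow, one_pow]

theorem hasSum_smul_sub_shift {E : Type*} [NormedAddCommGroup E] [NormedSpace ℝ E] {h : ℕ → E}
    (h_zero : h 0 = 0) {b : ℕ → ℝ} (hup : Summable fun n => b n • h (n + 1))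
    (hdown : Summable fun n => b (n + 1) • h n) :
    HasSum (fun l => b l • (h (l + 1) - h (l - 1))) (∑' n, (b (n - 1) - b (n + 1)) • h n) := by
  have hup' : HasSum (fun n => b (n - 1) • h n) (∑' n, b n • h (n + 1)) := by
    simpa [h_zero] using (hasSum_nat_add_iff (f := fun n => b (n - 1) • h n) 1).1 hup.hasSum
  have hdown' : HasSum (fun l => b l • h (l - 1)) (∑' n, b (n + 1) • h n) := by
    simpa [h_zero] using (hasSum_nat_add_iff (f := fun l => b l • h (l - 1)) 1).1 hdown.hasSum
  have htsum : ∑' n, (b (n - 1) - b (n + 1)) • h n =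
      ∑' n, b n • h (n + 1) - ∑' n, b (n + 1) • h n := by
    simpa only [sub_smul] using (hup'.sub hdown.hasSum).tsum_eq
  rw [htsum]
  simpa only [smul_sub] using hup.hasSum.sub hdown'

/-- The coefficient of the azimuthal harmonic of degree `n ≥ 1` in `(∑ v_l Y_l^0) sin θ e_φ`. The
value at `n = 0` is irrelevant, since the azimuthal harmonic of degree zero vanishes. -/
noncomputable def azimuthalCoeff (v : ℕ → ℝ) (n : ℕ) : ℝ :=
  v (n - 1) * azimuthalConst (n - 1) - v (n + 1) * azimuthalConst (n + 1)

theorem norm_smul_natCast_smul_azimuthalHarmonic_le (v : ℕ → ℝ) {l n : ℕ} (hn : n ≤ l + 1) :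
    ‖(v l * azimuthalConst l) • ((n : ℝ) • azimuthalHarmonic n)‖ ≤ ((l : ℝ) + 1) * |v l| := by
  have hn' : (n : ℝ) ≤ l + 1 := by exact_mod_cast hn
  rw [norm_smul, norm_smul, norm_mul, Real.norm_eq_abs, Real.norm_natCast,
    Real.norm_of_nonneg (azimuthalConst_nonneg l)]
  calc |v l| * azimuthalConst l * (n * ‖azimuthalHarmonic n‖)
      = n * |v l| * (azimuthalConst l * ‖azimuthalHarmonic n‖) := by ring
    _ ≤ n * |v l| := mul_le_of_le_one_right (by positivity)
        (azimuthalConst_mul_norm_azimuthalHarmonic_le hn)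
    _ ≤ ((l : ℝ) + 1) * |v l| := by gcongr

variable {v : ℕ → ℝ} (hv : Summable fun l : ℕ => ((l : ℝ) + 1) * |v l|)

include hv

theorem unitDiscSummable_azimuthalCoeff : UnitDiscSummable (azimuthalCoeff v) := by
  have hsum : Summable fun l => v l * azimuthalConst l := by
    refine Summable.of_norm_bounded hv fun l => ?_
    rw [norm_mul, Real.norm_eq_abs, Real.norm_of_nonneg (azimuthalConst_nonneg l), mul_comm]
    gcongr
    exact (azimuthalConst_le_one l).trans (by linarith [(Nat.cast_nonneg l : (0 : ℝ) ≤ l)])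
  have hpred : Summable fun n => v (n - 1) * azimuthalConst (n - 1) :=
    (summable_nat_add_iff 1).1 hsum
  have hcoeff : Summable fun n => |azimuthalCoeff v n| :=
    (hpred.sub ((summable_nat_add_iff 1).2 hsum)).abs
  exact fun s hs0 hs1 => hcoeff.of_nonneg_of_le (fun n => by positivity)
    fun n => mul_le_of_le_one_right (abs_nonneg _) (pow_le_one₀ hs0 hs1.le)

theorem summable_norm_azimuthalCoeff_up : Summable fun n : ℕ =>
    ‖(v n * azimuthalConst n) • (((n + 1 : ℕ) : ℝ) • azimuthalHarmonic (n + 1))‖ :=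
  hv.of_nonneg_of_le (fun _ => norm_nonneg _)
    fun _ => norm_smul_natCast_smul_azimuthalHarmonic_le v le_rfl

theorem summable_norm_azimuthalCoeff_down : Summable fun n : ℕ =>
    ‖(v (n + 1) * azimuthalConst (n + 1)) • ((n : ℝ) • azimuthalHarmonic n)‖ :=
  ((summable_nat_add_iff 1).2 hv).of_nonneg_of_le (fun _ => norm_nonneg _)
    fun n => norm_smul_natCast_smul_azimuthalHarmonic_le v (by lia)

theorem summable_norm_natCast_mul_azimuthalCoeff_smul :
    Summable fun n : ℕ => ‖(n * azimuthalCoeff v n) • azimuthalHarmonic n‖ := by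
  have hpred : Summable fun n : ℕ =>
      ‖(v (n - 1) * azimuthalConst (n - 1)) • ((n : ℝ) • azimuthalHarmonic n)‖ :=
    (summable_nat_add_iff 1).1 (summable_norm_azimuthalCoeff_up hv)
  refine (hpred.add (summable_norm_azimuthalCoeff_down hv)).of_nonneg_of_le
    (fun _ => norm_nonneg _) fun n => ?_
  rw [mul_comm, mul_smul, azimuthalCoeff, sub_smul]
  exact norm_sub_le _ _

theorem hasSum_azimuthMul_zonalL2 : HasSum (fun l => v l • azimuthMul (zonalL2 l))
    (∑' n, azimuthalCoeff v n • azimuthalHarmonic n) := by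
  have hdrop (c : ℝ) (n : ℕ) :
      ‖c • azimuthalHarmonic n‖ ≤ ‖c • ((n : ℝ) • azimuthalHarmonic n)‖ := by
    simpa only [smul_smul, mul_comm c] using norm_smul_azimuthalHarmonic_le c n
  have hsum := hasSum_smul_sub_shift azimuthalHarmonic_zero
    (b := fun l => v l * azimuthalConst l)
    ((summable_norm_azimuthalCoeff_up hv).of_norm_bounded fun n => hdrop _ (n + 1))
    ((summable_norm_azimuthalCoeff_down hv).of_norm_bounded fun n => hdrop _ n)
  simpa only [azimuthMul_zonalL2, smul_smul, azimuthalCoeff] using hsum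

theorem hasSum_natCast_smul_azimuthalHarmonic :
    HasSum (fun l : ℕ => (v l * azimuthalConst l) •
        (((l + 1 : ℕ) : ℝ) • azimuthalHarmonic (l + 1) -
          ((l - 1 : ℕ) : ℝ) • azimuthalHarmonic (l - 1)))
      (∑' n : ℕ, (n * azimuthalCoeff v n) • azimuthalHarmonic n) := by
  have hsum := hasSum_smul_sub_shift (h := fun n : ℕ => (n : ℝ) • azimuthalHarmonic n)
    (by rw [azimuthalHarmonic_zero, smul_zero]) (b := fun l => v l * azimuthalConst l)
    (summable_norm_azimuthalCoeff_up hv).of_norm (summable_norm_azimuthalCoeff_down hv).of_norm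
  have htsum : ∑' n : ℕ, (n * azimuthalCoeff v n) • azimuthalHarmonic n =
      ∑' n : ℕ, azimuthalCoeff v n • ((n : ℝ) • azimuthalHarmonic n) :=
    tsum_congr fun n => by rw [smul_smul, mul_comm]
  rw [htsum]
  exact hsum

theorem isDirichletToNeumann_of_hasSum {u : L2Sphere} (hu : HasSum (fun l => v l • zonalL2 l) u) :
    IsDirichletToNeumann (fun x => u x • sinAzimuth x)
      (∑' n : ℕ, (n * azimuthalCoeff v n) • azimuthalHarmonic n : L2Field) := by
  have hfield : azimuthMul u = ∑' n, azimuthalCoeff v n • azimuthalHarmonic n := by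
    simpa only [map_smul] using
      (azimuthMul.hasSum hu).unique (by simpa using hasSum_azimuthMul_zonalL2 hv)
  refine isDirichletToNeumann_tsum_azimuthalHarmonic (unitDiscSummable_azimuthalCoeff hv)
    (summable_norm_natCast_mul_azimuthalCoeff_smul hv) ?_
  rw [← hfield]
  exact (azimuthMul_coe u).symm

end AzimuthalSeries

section LinearizedOperator

theorem IsLinearizedOperator.unique {μ : ℝ} {u w₁ w₂ : L2Sphere} (h₁ : IsLinearizedOperator μ u w₁)
    (h₂ : IsLinearizedOperator μ u w₂) : w₁ = w₂ := by
  obtain ⟨G₁, L₁, hG₁, hL₁, hw₁⟩ := h₁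
  obtain ⟨G₂, L₂, hG₂, hL₂, hw₂⟩ := h₂
  refine Lp.ext ?_
  filter_upwards [hw₁, hw₂, hG₁.ae_eq hG₂, hL₁.ae_eq hL₂] with x hx₁ hx₂ hG hL
  rw [hx₁, hx₂, hG, hL]

theorem isLinearizedOperator_of_isDirichletToNeumann (μ : ℝ) {u L : L2Sphere} {G : L2Field}
    (hG : IsDirichletToNeumann (fun x => u x • sinAzimuth x) G) (hL : IsLaplaceBeltrami u L) :
    IsLinearizedOperator μ u
      (azimuthInner ((2 : ℝ) • azimuthMul u - G) - μ • (L + (2 : ℝ) • u)) := by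
  refine ⟨G, L, hG, hL, ?_⟩
  filter_upwards [Lp.coeFn_sub (azimuthInner ((2 : ℝ) • azimuthMul u - G)) (μ • (L + (2 : ℝ) • u)),
    azimuthInner_coe ((2 : ℝ) • azimuthMul u - G), Lp.coeFn_sub ((2 : ℝ) • azimuthMul u) G,
    Lp.coeFn_smul (2 : ℝ) (azimuthMul u), azimuthMul_coe u, Lp.coeFn_smul μ (L + (2 : ℝ) • u),
    Lp.coeFn_add L ((2 : ℝ) • u), Lp.coeFn_smul (2 : ℝ) u]
    with x hsub hinner hfield htwo hmul hmu hadd hu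
  simp only [hsub, Pi.sub_apply, hinner, hfield, htwo, Pi.smul_apply, hmul, hmu, hadd, Pi.add_apply,
    hu, smul_eq_mul]

/-- The value of the linearized operator on `Y_l^0`. -/
noncomputable def linearizedZonal (μ : ℝ) (l : ℕ) : L2Sphere :=
  azimuthInner ((2 : ℝ) • azimuthMul (zonalL2 l) - azimuthalConst l •
      (((l + 1 : ℕ) : ℝ) • azimuthalHarmonic (l + 1) -
        ((l - 1 : ℕ) : ℝ) • azimuthalHarmonic (l - 1))) -
    μ • ((2 - (l : ℝ) * (l + 1)) • zonalL2 l)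

theorem exists_isLinearizedOperator_hasSum_linearizedZonal (μ : ℝ) {v : ℕ → ℝ}
    (hv : Summable fun l : ℕ => ((l : ℝ) + 1) ^ 4 * v l ^ 2) :
    ∃ u w : L2Sphere, HasSum (fun l => v l • zonalL2 l) u ∧ IsLinearizedOperator μ u w ∧
      HasSum (fun l => v l • linearizedZonal μ l) w := by
  have hsummable {c : ℕ → ℝ} (hc : ∀ l, |c l| ≤ ((l : ℝ) + 1) ^ 2) :
      Summable fun l => (c l * v l) • zonalL2 l := by
    refine summable_smul_of_orthonormal orthonormal_zonalL2
      (hv.of_nonneg_of_le (fun l => sq_nonneg _) fun l => ?_)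
    rw [mul_pow, ← sq_abs (c l), show ((l : ℝ) + 1) ^ 4 = (((l : ℝ) + 1) ^ 2) ^ 2 by ring]
    gcongr
    exact hc l
  obtain ⟨u, hu⟩ : Summable fun l => v l • zonalL2 l := by
    refine (hsummable (c := 1) fun l => ?_).congr fun l => by rw [Pi.one_apply, one_mul]
    rw [Pi.one_apply, abs_one]
    exact one_le_pow₀ (by linarith [(Nat.cast_nonneg l : (0 : ℝ) ≤ l)])
  obtain ⟨L, hL⟩ := hsummable (c := fun l => -((l : ℝ) * (l + 1))) fun l => by
    rw [abs_neg, abs_of_nonneg (by positivity)]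
    nlinarith
  have hv' := summable_succ_mul_abs hv
  refine ⟨u, _, hu, isLinearizedOperator_of_isDirichletToNeumann μ
    (isDirichletToNeumann_of_hasSum hv' hu) (isLaplaceBeltrami_of_hasSum hu hL), ?_⟩
  have hfield := ((azimuthMul.hasSum hu).const_smul (2 : ℝ)).sub
    (hasSum_natCast_smul_azimuthalHarmonic hv')
  refine ((azimuthInner.hasSum hfield).sub
    ((hL.add (hu.const_smul (2 : ℝ))).const_smul μ)).congr_fun fun l => ?_
  simp only [linearizedZonal, map_smul, map_sub]
  module

end LinearizedOperator

section MatrixEntries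

open Polynomial

theorem zonalLp_legendrePoly (n : ℕ) :
    zonalLp (legendrePoly n) = (zonalConst n)⁻¹ • zonalL2 n := by
  rw [zonalL2_eq, inv_smul_smul₀ (zonalConst_pos n).ne']

/-- The coefficient `ρ_n` in `(1 - x²) P_{n+1}' = ρ_n (P_n - P_{n+2})`. -/
noncomputable def derivRatio (n : ℕ) : ℝ := ((n : ℝ) + 1) * (n + 2) / (2 * n + 3)

theorem azimuthInner_azimuthalHarmonic_succ (n : ℕ) :
    azimuthInner (azimuthalHarmonic (n + 1)) = derivRatio n •
      ((zonalConst n)⁻¹ • zonalL2 n - (zonalConst (n + 2))⁻¹ • zonalL2 (n + 2)) := by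
  have hlegendre := congrArg zonalLp (one_sub_X_sq_mul_derivative_legendrePoly_eq_sub n)
  rw [← smul_eq_C_mul, ← smul_eq_C_mul, map_smul, map_smul, map_sub, zonalLp_legendrePoly,
    zonalLp_legendrePoly] at hlegendre
  rw [azimuthalHarmonic, azimuthInner_azimuthalLp, derivRatio, div_eq_inv_mul, mul_smul,
    ← hlegendre, inv_smul_smul₀ (by positivity)]

theorem linearizedZonal_add_two (μ : ℝ) (m : ℕ) :
    linearizedZonal μ (m + 2) =
      (-(azimuthalConst (m + 2) * (zonalConst (m + 2))⁻¹ *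
          ((m + 1) * derivRatio (m + 2) + (m - 1) * derivRatio m)) -
        μ * (2 - ((m : ℝ) + 2) * (m + 3))) • zonalL2 (m + 2) +
      (azimuthalConst (m + 2) * (zonalConst (m + 4))⁻¹ * ((m + 1) * derivRatio (m + 2))) •
        zonalL2 (m + 4) +
      (azimuthalConst (m + 2) * (zonalConst m)⁻¹ * ((m - 1) * derivRatio m)) • zonalL2 m := by
  rw [linearizedZonal, azimuthMul_zonalL2, show m + 2 - 1 = m + 1 by lia]
  simp only [map_sub, map_smul, azimuthInner_azimuthalHarmonic_succ]
  push_cast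
  module

theorem zonalConst_mul_inv (l m : ℕ) :
    zonalConst l * (zonalConst m)⁻¹ = Real.sqrt ((2 * (l : ℝ) + 1) / (2 * m + 1)) := by
  rw [← div_eq_mul_inv, zonalConst, zonalConst, ← Real.sqrt_div (by positivity),
    div_div_div_cancel_right₀ (by positivity)]

theorem azimuthalConst_mul_inv (l m : ℕ) :
    azimuthalConst l * (zonalConst m)⁻¹ =
      (2 * (l : ℝ) + 1)⁻¹ * Real.sqrt ((2 * (l : ℝ) + 1) / (2 * m + 1)) := by
  rw [← zonalConst_mul_inv, azimuthalConst]
  ring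

theorem coeffA_succ (μ : ℝ) (j : ℕ) :
    coeffA μ (j + 1) = -((4 * (j : ℝ) + 5)⁻¹ *
        ((2 * j + 1) * derivRatio (2 * j + 2) + (2 * j - 1) * derivRatio (2 * j))) -
      μ * (2 - (2 * (j : ℝ) + 2) * (2 * j + 3)) := by
  simp only [coeffA, derivRatio]
  push_cast
  rw [show 4 * ((j : ℝ) + 1) + 1 = 4 * j + 5 by ring,
    show 4 * ((j : ℝ) + 1) - 1 = 4 * j + 3 by ring,
    show 4 * ((j : ℝ) + 1) + 3 = 4 * j + 7 by ring,
    show 2 * (2 * (j : ℝ) + 2) + 3 = 4 * j + 7 by ring,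
    show 2 * (2 * (j : ℝ)) + 3 = 4 * j + 3 by ring]
  field_simp
  ring

theorem coeffC_eq_derivRatio (j : ℕ) :
    coeffC j = (4 * (j : ℝ) + 5)⁻¹ * Real.sqrt ((4 * j + 5) / (4 * j + 1)) *
      ((2 * j - 1) * derivRatio (2 * j)) := by
  simp only [coeffC, derivRatio]
  push_cast
  rw [show 2 * (2 * (j : ℝ)) + 3 = 4 * j + 3 by ring]
  field_simp

theorem coeffB_add_two (j : ℕ) :
    coeffB (j + 2) = (4 * (j : ℝ) + 5)⁻¹ * Real.sqrt ((4 * j + 5) / (4 * j + 9)) *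
      ((2 * j + 1) * derivRatio (2 * j + 2)) := by
  simp only [coeffB, derivRatio]
  push_cast
  rw [show 4 * ((j : ℝ) + 2) - 3 = 4 * j + 5 by ring,
    show 4 * ((j : ℝ) + 2) + 1 = 4 * j + 9 by ring,
    show 4 * ((j : ℝ) + 2) - 1 = 4 * j + 7 by ring,
    show 2 * (2 * (j : ℝ) + 2) + 3 = 4 * j + 7 by ring]
  field_simp
  ring

theorem linearizedZonal_two_mul_succ (μ : ℝ) (j : ℕ) :
    linearizedZonal μ (2 * (j + 1)) = coeffA μ (j + 1) • zonalL2 (2 * (j + 1)) +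
      coeffB (j + 2) • zonalL2 (2 * (j + 2)) + coeffC j • zonalL2 (2 * j) := by
  have hlower : 2 * ((2 * j : ℕ) : ℝ) + 1 = 4 * j + 1 := by push_cast; ring
  have hmiddle : 2 * ((2 * j + 2 : ℕ) : ℝ) + 1 = 4 * j + 5 := by push_cast; ring
  have hupper : 2 * ((2 * j + 4 : ℕ) : ℝ) + 1 = 4 * j + 9 := by push_cast; ring
  rw [show 2 * (j + 1) = 2 * j + 2 by ring, show 2 * (j + 2) = 2 * j + 4 by ring,
    linearizedZonal_add_two, coeffA_succ, coeffB_add_two, coeffC_eq_derivRatio]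
  simp only [azimuthalConst_mul_inv, hlower, hmiddle, hupper]
  rw [div_self (by positivity), Real.sqrt_one, mul_one]
  push_cast
  rfl

theorem coeffB_succ_eq_coeffC {k : ℕ} (hk : 1 ≤ k) : coeffB (k + 1) = coeffC k := by
  obtain ⟨j, rfl⟩ := Nat.exists_eq_add_of_le' hk
  have hsqrt (a b : ℝ) (ha : 0 < a) (hb : 0 < b) :
      a⁻¹ * Real.sqrt (a / b) = b⁻¹ * Real.sqrt (b / a) := by
    rw [Real.sqrt_div ha.le, Real.sqrt_div hb.le]
    field_simp
    rw [Real.sq_sqrt ha.le, Real.sq_sqrt hb.le, mul_comm]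
  rw [coeffB_add_two, coeffC_eq_derivRatio, hsqrt _ _ (by positivity) (by positivity)]
  push_cast
  ring_nf

theorem coeffB_zero : coeffB 0 = 0 := by simp [coeffB]

theorem abs_coeffA_le (μ : ℝ) {k : ℕ} (hk : 1 ≤ k) :
    |coeffA μ k| ≤ (6 * |μ| + 2) * (k : ℝ) ^ 2 := by
  have ht : (1 : ℝ) ≤ k := by exact_mod_cast hk
  simp only [coeffA]
  set t : ℝ := (k : ℝ)
  have hlaplace : |μ * (2 * t - 1) * (2 * t + 2)| ≤ |μ| * (6 * t ^ 2) := by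
    have hnonneg : 0 ≤ (2 * t - 1) * (2 * t + 2) := mul_nonneg (by linarith) (by linarith)
    rw [mul_assoc, abs_mul, abs_of_nonneg hnonneg]
    exact mul_le_mul_of_nonneg_left (by nlinarith) (abs_nonneg μ)
  have hlower : |2 * t * (2 * t - 3) * (2 * t - 1) / ((4 * t + 1) * (4 * t - 1))| ≤ t ^ 2 := by
    have hpos : 0 < (4 * t + 1) * (4 * t - 1) := mul_pos (by linarith) (by linarith)
    rw [abs_div, abs_of_pos hpos, div_le_iff₀ hpos, abs_le]
    constructor <;> nlinarith [mul_nonneg (sub_nonneg.2 ht) (sq_nonneg t), sq_nonneg (t ^ 2)]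
  have hupper : |(2 * t - 1) * (2 * t + 1) * (2 * t + 2) / ((4 * t + 1) * (4 * t + 3))| ≤
      t ^ 2 := by
    have hfactor : 0 ≤ 2 * t - 1 := by linarith
    rw [abs_of_nonneg (by positivity), div_le_iff₀ (by positivity)]
    nlinarith [mul_nonneg (sub_nonneg.2 ht) (sq_nonneg t), sq_nonneg (t ^ 2)]
  refine (abs_sub _ _).trans ((add_le_add_left (abs_sub _ _) _).trans ?_)
  linarith

theorem abs_coeffC_le {k : ℕ} (hk : 1 ≤ k) : |coeffC k| ≤ 2 * (k : ℝ) ^ 2 := by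
  have ht : (1 : ℝ) ≤ k := by exact_mod_cast hk
  simp only [coeffC]
  set t : ℝ := (k : ℝ)
  have hfactor : 0 ≤ 2 * t - 1 := by linarith
  have hratio : (2 * t - 1) * (2 * t + 1) * (2 * t + 2) / ((4 * t + 3) * (4 * t + 5)) ≤ t ^ 2 := by
    rw [div_le_iff₀ (by positivity)]
    nlinarith [mul_nonneg (sub_nonneg.2 ht) (sq_nonneg t), sq_nonneg (t ^ 2)]
  have hsqrt : Real.sqrt ((4 * t + 5) / (4 * t + 1)) ≤ 2 := by
    rw [Real.sqrt_le_left (by norm_num), div_le_iff₀ (by positivity)]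
    linarith
  rw [abs_of_nonneg (by positivity), mul_comm]
  gcongr

end MatrixEntries

section TridiagonalMatrix

/-- The tridiagonal matrix of the linearized operator, acting on sequences indexed by the natural
numbers. In row zero, `k - 1` truncates to zero, which is harmless because `coeffB 0 = 0`. -/
noncomputable def tridiagonal (μ : ℝ) : (ℕ → ℝ) →ₗ[ℝ] ℕ → ℝ where
  toFun x k := coeffA μ k * x k + coeffB k * x (k - 1) + coeffC k * x (k + 1)
  map_add' x y := by
    ext k
    simp only [Pi.add_apply]
    ring
  map_smul' c x := by
    ext k
    simp only [Pi.smul_apply, smul_eq_mul, RingHom.id_apply]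
    ring

theorem tridiagonal_apply (μ : ℝ) (x : ℕ → ℝ) (k : ℕ) :
    tridiagonal μ x k = coeffA μ k * x k + coeffB k * x (k - 1) + coeffC k * x (k + 1) := rfl

theorem mul_sq_le_of_abs_le {c M t y : ℝ} (hc : |c| ≤ M * t ^ 2) :
    (c * y) ^ 2 ≤ M ^ 2 * (t ^ 4 * y ^ 2) := by
  calc (c * y) ^ 2 = |c| ^ 2 * y ^ 2 := by rw [mul_pow, sq_abs]
    _ ≤ (M * t ^ 2) ^ 2 * y ^ 2 := by gcongr
    _ = M ^ 2 * (t ^ 4 * y ^ 2) := by ring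

theorem abs_coeffC_le_succ {k : ℕ} (hk : 1 ≤ k) : |coeffC k| ≤ 2 * ((k + 1 : ℕ) : ℝ) ^ 2 :=
  (abs_coeffC_le hk).trans (by gcongr; lia)

section Summability

variable {x : ℕ → ℝ} (hx : Summable fun k : ℕ => (k : ℝ) ^ 4 * x k ^ 2)

include hx

theorem summable_sq_of_summable_pow_four_mul_sq : Summable fun k => x k ^ 2 := by
  refine (summable_nat_add_iff 1).1 (((summable_nat_add_iff 1).2 hx).of_nonneg_of_le
    (fun k => sq_nonneg _) fun k => le_mul_of_one_le_left (sq_nonneg _) (one_le_pow₀ ?_))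
  exact_mod_cast Nat.le_add_left 1 k

theorem summable_coeffA_mul_sq (μ : ℝ) : Summable fun k => (coeffA μ k * x k) ^ 2 :=
  (summable_nat_add_iff 1).1 ((((summable_nat_add_iff 1).2 hx).mul_left _).of_nonneg_of_le
    (fun _ => sq_nonneg _) fun k => mul_sq_le_of_abs_le (abs_coeffA_le μ (Nat.le_add_left 1 k)))

theorem summable_coeffC_mul_succ_sq : Summable fun k => (coeffC k * x (k + 1)) ^ 2 :=
  (summable_nat_add_iff 1).1 ((((summable_nat_add_iff 2).2 hx).mul_left _).of_nonneg_of_le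
    (fun _ => sq_nonneg _) fun k =>
      mul_sq_le_of_abs_le (abs_coeffC_le_succ (Nat.le_add_left 1 k)))

theorem summable_coeffB_succ_mul_sq : Summable fun k => (coeffB (k + 1) * x k) ^ 2 := by
  refine (summable_nat_add_iff 1).1 ((((summable_nat_add_iff 1).2 hx).mul_left (2 ^ 2)
    ).of_nonneg_of_le (fun _ => sq_nonneg _) fun k => ?_)
  rw [coeffB_succ_eq_coeffC (Nat.le_add_left 1 k)]
  exact mul_sq_le_of_abs_le (abs_coeffC_le (Nat.le_add_left 1 k))

theorem exists_isLinearizedOperator_hasSum_even (μ : ℝ) (hx0 : x 0 = 0) :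
    ∃ u w : L2Sphere, HasSum (fun k => x k • zonalL2 (2 * k)) u ∧ IsLinearizedOperator μ u w ∧
      HasSum (fun k => x k • linearizedZonal μ (2 * k)) w := by
  have hinj : Function.Injective fun k : ℕ => 2 * k := mul_right_injective₀ two_ne_zero
  let v : ℕ → ℝ := Function.extend (fun k : ℕ => 2 * k) x (0 : ℕ → ℝ)
  have hv_even (k : ℕ) : v (2 * k) = x k := hinj.extend_apply x (0 : ℕ → ℝ) k
  have hv_odd (l : ℕ) (hl : l ∉ Set.range fun k : ℕ => 2 * k) : v l = 0 :=
    Function.extend_apply' x (0 : ℕ → ℝ) l hl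
  have hv : Summable fun l : ℕ => ((l : ℝ) + 1) ^ 4 * v l ^ 2 := by
    refine (hinj.summable_iff fun l hl => by simp [hv_odd l hl]).1
      ((hx.mul_left (3 ^ 4)).of_nonneg_of_le
        (fun k => mul_nonneg (by positivity) (sq_nonneg _)) fun k => ?_)
    rw [Function.comp_apply, hv_even]
    rcases Nat.eq_zero_or_pos k with rfl | hk
    · simp [hx0]
    · have hk' : (1 : ℝ) ≤ k := by exact_mod_cast hk
      rw [← mul_assoc, ← mul_pow]
      push_cast
      gcongr
      linarith
  obtain ⟨u, w, hu, huw, hw⟩ := exists_isLinearizedOperator_hasSum_linearizedZonal μ hv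
  rw [← hinj.hasSum_iff fun l hl => by simp [hv_odd l hl]] at hu hw
  simp only [Function.comp_def, hv_even] at hu hw
  exact ⟨u, w, hu, huw, hw⟩

theorem hasSum_tridiagonal_smul {μ : ℝ} (hx0 : x 0 = 0) {w : L2Sphere}
    (hw : HasSum (fun k => x k • linearizedZonal μ (2 * k)) w) :
    HasSum (fun k => tridiagonal μ x k • zonalL2 (2 * k)) w := by
  have heven : Orthonormal ℝ fun k : ℕ => zonalL2 (2 * k) :=
    orthonormal_zonalL2.comp _ (mul_right_injective₀ two_ne_zero)
  obtain ⟨a, ha⟩ := summable_smul_of_orthonormal heven (summable_coeffA_mul_sq hx μ)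
  obtain ⟨b, hb⟩ : Summable fun k => (coeffB (k + 1) * x k) • zonalL2 (2 * (k + 1)) :=
    summable_smul_of_orthonormal (heven.comp _ (add_left_injective 1))
      (summable_coeffB_succ_mul_sq hx)
  obtain ⟨c, hc⟩ := summable_smul_of_orthonormal heven (summable_coeffC_mul_succ_sq hx)
  have hb' : HasSum (fun k => (coeffB k * x (k - 1)) • zonalL2 (2 * k)) b := by
    simpa [coeffB_zero] using
      (hasSum_nat_add_iff (f := fun k => (coeffB k * x (k - 1)) • zonalL2 (2 * k)) 1).1 hb
  have hc' : HasSum (fun k => (coeffC (k - 1) * x k) • zonalL2 (2 * (k - 1))) c := by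
    simpa [hx0] using
      (hasSum_nat_add_iff (f := fun k => (coeffC (k - 1) * x k) • zonalL2 (2 * (k - 1))) 1).1 hc
  have hcolumns : HasSum (fun k => x k • linearizedZonal μ (2 * k)) (a + b + c) := by
    refine ((ha.add hb).add hc').congr_fun fun k => ?_
    rcases k with _ | j
    · simp [hx0]
    · rw [linearizedZonal_two_mul_succ, Nat.add_sub_cancel]
      module
  rw [hw.unique hcolumns]
  refine ((ha.add hb').add hc).congr_fun fun k => ?_
  rw [tridiagonal_apply]
  module

end Summability

theorem summable_mul_of_summable_sq {ι : Type*} {f g : ι → ℝ} (hf : Summable fun i => f i ^ 2)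
    (hg : Summable fun i => g i ^ 2) : Summable fun i => f i * g i := by
  refine Summable.of_norm_bounded (hf.add hg) fun i => ?_
  rw [Real.norm_eq_abs, abs_le]
  constructor <;> nlinarith [sq_nonneg (f i + g i), sq_nonneg (f i - g i)]

theorem hasSum_tridiagonal_mul (μ : ℝ) {x y : ℕ → ℝ} (hx0 : x 0 = 0)
    (hx : Summable fun k : ℕ => (k : ℝ) ^ 4 * x k ^ 2)
    (hy : Summable fun k : ℕ => (k : ℝ) ^ 4 * y k ^ 2) :
    HasSum (fun k => tridiagonal μ x k * y k) (∑' k, coeffA μ k * (x k * y k) +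
      (∑' k, coeffC k * (x k * y (k + 1)) + ∑' k, coeffC k * (y k * x (k + 1)))) := by
  have hx_sq := summable_sq_of_summable_pow_four_mul_sq hx
  have hy_sq := summable_sq_of_summable_pow_four_mul_sq hy
  have hdiag : Summable fun k => coeffA μ k * (x k * y k) :=
    (summable_mul_of_summable_sq (summable_coeffA_mul_sq hx μ) hy_sq).congr fun k => by ring
  have hupper : Summable fun k => coeffC k * (y k * x (k + 1)) :=
    (summable_mul_of_summable_sq (summable_coeffC_mul_succ_sq hx) hy_sq).congr fun k => by ring
  have hlower : Summable fun k => coeffC k * (x k * y (k + 1)) :=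
    (summable_mul_of_summable_sq (summable_coeffC_mul_succ_sq hy) hx_sq).congr fun k => by ring
  have hlower' : HasSum (fun k => coeffB k * (x (k - 1) * y k))
      (∑' k, coeffC k * (x k * y (k + 1))) := by
    refine (hasSum_nat_add_iff' 1).1 ?_
    simp only [Finset.sum_range_one, coeffB_zero, zero_mul, sub_zero]
    refine hlower.hasSum.congr_fun fun k => ?_
    rcases Nat.eq_zero_or_pos k with rfl | hk
    · simp [hx0]
    · rw [coeffB_succ_eq_coeffC hk, Nat.add_sub_cancel]
  refine (hdiag.hasSum.add (hlower'.add hupper.hasSum)).congr_fun fun k => ?_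
  rw [tridiagonal_apply]
  ring

section Weighted

variable {α : ℝ}

theorem weighted_mul_sq_le (hα : 0 ≤ α) {k i : ℕ} (hk : 1 ≤ k) (hki : k ≤ 2 * i) {c M y : ℝ}
    (hc : |c| ≤ M * (i : ℝ) ^ 2) :
    (k : ℝ) ^ (2 * α) * (c * y) ^ 2 ≤
      (2 : ℝ) ^ (2 * α) * M ^ 2 * ((i : ℝ) ^ (2 * (α + 2)) * y ^ 2) := by
  have hi : (0 : ℝ) < i := by exact_mod_cast (by lia : 0 < i)
  have hweight : (k : ℝ) ^ (2 * α) ≤ (2 : ℝ) ^ (2 * α) * (i : ℝ) ^ (2 * α) := by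
    rw [← Real.mul_rpow two_pos.le hi.le]
    exact Real.rpow_le_rpow k.cast_nonneg (by exact_mod_cast hki) (by positivity)
  have hrpow : (i : ℝ) ^ (2 * (α + 2)) = (i : ℝ) ^ (2 * α) * (i : ℝ) ^ 4 := by
    rw [← Real.rpow_natCast, ← Real.rpow_add hi]
    congr 1
    push_cast
    ring
  calc (k : ℝ) ^ (2 * α) * (c * y) ^ 2
      ≤ (2 : ℝ) ^ (2 * α) * (i : ℝ) ^ (2 * α) * (M ^ 2 * ((i : ℝ) ^ 4 * y ^ 2)) := by
        gcongr
        exact mul_sq_le_of_abs_le hc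
    _ = (2 : ℝ) ^ (2 * α) * M ^ 2 * ((i : ℝ) ^ (2 * (α + 2)) * y ^ 2) := by
        rw [hrpow]
        ring

theorem weighted_tridiagonal_sq_le (hα : 0 ≤ α) (μ : ℝ) {x : ℕ → ℝ} (hx0 : x 0 = 0) (j : ℕ) :
    ((j + 1 : ℕ) : ℝ) ^ (2 * α) * tridiagonal μ x (j + 1) ^ 2 ≤
      3 * ((2 : ℝ) ^ (2 * α) * (6 * |μ| + 2) ^ 2) *
        (((j + 1 : ℕ) : ℝ) ^ (2 * (α + 2)) * x (j + 1) ^ 2 + (j : ℝ) ^ (2 * (α + 2)) * x j ^ 2 +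
          ((j + 2 : ℕ) : ℝ) ^ (2 * (α + 2)) * x (j + 2) ^ 2) := by
  have hM (t : ℝ) : 2 * t ^ 2 ≤ (6 * |μ| + 2) * t ^ 2 := by
    gcongr
    linarith [abs_nonneg μ]
  have hdiag := weighted_mul_sq_le (y := x (j + 1)) hα (Nat.le_add_left 1 j) (by lia)
    (abs_coeffA_le μ (Nat.le_add_left 1 j))
  have hupper := weighted_mul_sq_le (y := x (j + 2)) hα (Nat.le_add_left 1 j) (by lia)
    ((abs_coeffC_le_succ (Nat.le_add_left 1 j)).trans (hM _))
  have hlower : ((j + 1 : ℕ) : ℝ) ^ (2 * α) * (coeffB (j + 1) * x j) ^ 2 ≤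
      (2 : ℝ) ^ (2 * α) * (6 * |μ| + 2) ^ 2 * ((j : ℝ) ^ (2 * (α + 2)) * x j ^ 2) := by
    rcases Nat.eq_zero_or_pos j with rfl | hj
    · simp [hx0]
    · refine weighted_mul_sq_le hα (Nat.le_add_left 1 j) (by lia) ?_
      rw [coeffB_succ_eq_coeffC hj]
      exact (abs_coeffC_le hj).trans (hM _)
  have hsq (a b c : ℝ) : (a + b + c) ^ 2 ≤ 3 * (a ^ 2 + b ^ 2 + c ^ 2) := by
    linarith [sq_nonneg (a - b), sq_nonneg (a - c), sq_nonneg (b - c)]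
  have htotal := mul_le_mul_of_nonneg_left
    (hsq (coeffA μ (j + 1) * x (j + 1)) (coeffB (j + 1) * x j) (coeffC (j + 1) * x (j + 2)))
    (by positivity : (0 : ℝ) ≤ ((j + 1 : ℕ) : ℝ) ^ (2 * α))
  rw [tridiagonal_apply, Nat.add_sub_cancel]
  linarith

variable {x : ℕ → ℝ} (hx : Summable fun n : ℕ => (n : ℝ) ^ (2 * (α + 2)) * x n ^ 2)

include hx

theorem summable_pow_four_mul_sq (hα : 0 ≤ α) : Summable fun k : ℕ => (k : ℝ) ^ 4 * x k ^ 2 := by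
  refine (summable_nat_add_iff 1).1 (((summable_nat_add_iff 1).2 hx).of_nonneg_of_le
    (fun _ => by positivity) fun k => ?_)
  rw [← Real.rpow_natCast]
  gcongr
  · exact_mod_cast Nat.le_add_left 1 k
  · push_cast
    linarith

theorem summable_weighted_tridiagonal_sq (hα : 0 ≤ α) (μ : ℝ) (hx0 : x 0 = 0) :
    Summable fun j : ℕ => ((j + 1 : ℕ) : ℝ) ^ (2 * α) * tridiagonal μ x (j + 1) ^ 2 :=
  (((((summable_nat_add_iff 1).2 hx).add hx).add ((summable_nat_add_iff 2).2 hx)).mul_left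
    _).of_nonneg_of_le (fun _ => by positivity) (weighted_tridiagonal_sq_le hα μ hx0)

theorem tsum_weighted_tridiagonal_sq_le (hα : 0 ≤ α) (μ : ℝ) (hx0 : x 0 = 0) :
    ∑' j : ℕ, ((j + 1 : ℕ) : ℝ) ^ (2 * α) * tridiagonal μ x (j + 1) ^ 2 ≤
      9 * ((2 : ℝ) ^ (2 * α) * (6 * |μ| + 2) ^ 2) *
        ∑' n : ℕ, (n : ℝ) ^ (2 * (α + 2)) * x n ^ 2 := by
  have hshift (m : ℕ) : ∑' n : ℕ, ((n + m : ℕ) : ℝ) ^ (2 * (α + 2)) * x (n + m) ^ 2 ≤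
      ∑' n : ℕ, (n : ℝ) ^ (2 * (α + 2)) * x n ^ 2 :=
    tsum_comp_le_tsum_of_inj hx (fun n => by positivity) (add_left_injective m)
  have hone := (summable_nat_add_iff 1).2 hx
  have htwo := (summable_nat_add_iff 2).2 hx
  refine ((summable_weighted_tridiagonal_sq hx hα μ hx0).tsum_le_tsum
    (weighted_tridiagonal_sq_le hα μ hx0) (((hone.add hx).add htwo).mul_left _)).trans ?_
  rw [tsum_mul_left, (hone.add hx).tsum_add htwo, hone.tsum_add hx]
  rw [show (9 : ℝ) * ((2 : ℝ) ^ (2 * α) * (6 * |μ| + 2) ^ 2) =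
    3 * ((2 : ℝ) ^ (2 * α) * (6 * |μ| + 2) ^ 2) * 3 by ring, mul_assoc _ 3]
  gcongr
  linarith [hshift 1, hshift 2]

end Weighted

end TridiagonalMatrix

section LinearizedSequences

/-- The extension by zero of a sequence indexed by the positive integers. -/
noncomputable def seqExtend : (ℕ+ → ℝ) →ₗ[ℝ] ℕ → ℝ := Function.ExtendByZero.linearMap ℝ PNat.val

theorem seqExtend_zero (v : ℕ+ → ℝ) : seqExtend v 0 = 0 :=
  Function.extend_apply' v (0 : ℕ → ℝ) 0 fun ⟨k, hk⟩ => k.ne_zero hk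

theorem seqExtend_coe (v : ℕ+ → ℝ) (k : ℕ+) : seqExtend v k = v k :=
  PNat.coe_injective.extend_apply v (0 : ℕ → ℝ) k

theorem hasSum_comp_pnat_iff {E : Type*} [AddCommMonoid E] [TopologicalSpace E] {f : ℕ → E}
    (hf : f 0 = 0) {s : E} : HasSum (fun k : ℕ+ => f k) s ↔ HasSum f s := by
  refine PNat.coe_injective.hasSum_iff (f := f) fun n hn => ?_
  obtain rfl | hpos := Nat.eq_zero_or_pos n
  · exact hf
  · exact absurd ⟨⟨n, hpos⟩, rfl⟩ hn

variable {α : ℝ}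

theorem hasSum_seqExtend (v : SeqSpace α) :
    HasSum (fun n : ℕ => (n : ℝ) ^ (2 * α) * seqExtend v.1 n ^ 2)
      (∑' k : ℕ+, (k : ℝ) ^ (2 * α) * v.1 k ^ 2) := by
  have hv : Summable fun k : ℕ+ => (k : ℝ) ^ (2 * α) * v.1 k ^ 2 := v.2
  refine (hasSum_comp_pnat_iff (by simp [seqExtend_zero])).1 (hv.hasSum.congr_fun fun k => ?_)
  rw [seqExtend_coe]

/-- The linearized operator `𝒜(μ)` modulo constants, read in the basis `Y_{2k}^0`. -/
noncomputable def linearizedSeq (hα : 0 ≤ α) (μ : ℝ) : SeqSpace (α + 2) →ₗ[ℝ] SeqSpace α :=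
  (LinearMap.funLeft ℝ ℝ PNat.val ∘ₗ tridiagonal μ ∘ₗ seqExtend ∘ₗ
    (SeqSpace (α + 2)).subtype).codRestrict (SeqSpace α) fun v =>
      summable_pnat_iff_summable_succ
        (f := fun k : ℕ => (k : ℝ) ^ (2 * α) * tridiagonal μ (seqExtend v.1) k ^ 2) |>.2
        (summable_weighted_tridiagonal_sq (hasSum_seqExtend v).summable hα μ (seqExtend_zero _))

variable (hα : 0 ≤ α) (μ : ℝ) (v w : SeqSpace (α + 2))

theorem linearizedSeq_apply (k : ℕ+) :
    (linearizedSeq hα μ v).1 k = tridiagonal μ (seqExtend v.1) k := rfl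

theorem linearizedSeq_apply_one :
    (linearizedSeq hα μ v).1 1 = coeffA μ 1 * v.1 1 + coeffC 1 * v.1 2 := by
  have hone : seqExtend v.1 1 = v.1 1 := seqExtend_coe v.1 1
  have htwo : seqExtend v.1 2 = v.1 2 := seqExtend_coe v.1 2
  rw [linearizedSeq_apply, tridiagonal_apply, PNat.one_coe, hone, Nat.sub_self, seqExtend_zero,
    mul_zero, add_zero, htwo]

theorem linearizedSeq_apply_add_one (k : ℕ+) :
    (linearizedSeq hα μ v).1 (k + 1) =
      coeffA μ ((k : ℕ) + 1) * v.1 (k + 1) + coeffB ((k : ℕ) + 1) * v.1 k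
        + coeffC ((k : ℕ) + 1) * v.1 (k + 2) := by
  have hsucc : seqExtend v.1 (k + 1) = v.1 (k + 1) := seqExtend_coe v.1 (k + 1)
  have hadd_two : seqExtend v.1 (k + 1 + 1) = v.1 (k + 2) := seqExtend_coe v.1 (k + 2)
  rw [linearizedSeq_apply, tridiagonal_apply, PNat.add_coe, PNat.one_coe, Nat.add_sub_cancel,
    hsucc, hadd_two, seqExtend_coe]

theorem tridiagonal_seqExtend_zero (x : ℕ+ → ℝ) :
    tridiagonal μ (seqExtend x) 0 = coeffC 0 * x 1 := by
  have hone : seqExtend x 1 = x 1 := seqExtend_coe x 1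
  rw [tridiagonal_apply, seqExtend_zero, coeffB_zero, mul_zero, zero_mul, zero_add, zero_add, hone]

theorem exists_hasSum_linearizedSeq :
    ∃ u w : L2Sphere, HasSum (fun k : ℕ+ => v.1 k • zonalL2 (2 * (k : ℕ))) u ∧
      IsLinearizedOperator μ u w ∧
      HasSum (fun k : ℕ+ => (linearizedSeq hα μ v).1 k • zonalL2 (2 * (k : ℕ)))
        (w - (coeffC 0 * v.1 1) • zonalL2 0) := by
  have hv := summable_pow_four_mul_sq (hasSum_seqExtend v).summable hα
  obtain ⟨u, w, hu, huw, hw⟩ := exists_isLinearizedOperator_hasSum_even hv μ (seqExtend_zero v.1)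
  refine ⟨u, w, ?_, huw, ?_⟩
  · simpa only [seqExtend_coe] using (hasSum_comp_pnat_iff (by simp [seqExtend_zero])).2 hu
  · have hrows := (hasSum_nat_add_iff' 1).2 (hasSum_tridiagonal_smul hv (seqExtend_zero v.1) hw)
    rw [Finset.sum_range_one, tridiagonal_seqExtend_zero] at hrows
    exact (Equiv.pnatEquivNat.symm.hasSum_iff (f := fun k : ℕ+ =>
      (linearizedSeq hα μ v).1 k • zonalL2 (2 * (k : ℕ)))).1 hrows

theorem seqNorm_linearizedSeq_le :
    seqNorm α (linearizedSeq hα μ v) ≤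
      Real.sqrt (9 * ((2 : ℝ) ^ (2 * α) * (6 * |μ| + 2) ^ 2)) * seqNorm (α + 2) v := by
  have hrows : ∑' k : ℕ+, (k : ℝ) ^ (2 * α) * (linearizedSeq hα μ v).1 k ^ 2 =
      ∑' j : ℕ, ((j + 1 : ℕ) : ℝ) ^ (2 * α) * tridiagonal μ (seqExtend v.1) (j + 1) ^ 2 :=
    tsum_pnat_eq_tsum_succ
      (f := fun k : ℕ => (k : ℝ) ^ (2 * α) * tridiagonal μ (seqExtend v.1) k ^ 2)
  have hv := hasSum_seqExtend v
  rw [seqNorm, seqNorm, hrows, ← hv.tsum_eq, ← Real.sqrt_mul (by positivity)]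
  exact Real.sqrt_le_sqrt (tsum_weighted_tridiagonal_sq_le hv.summable hα μ (seqExtend_zero v.1))

theorem hasSum_linearizedSeq_mul :
    HasSum (fun k : ℕ+ => (linearizedSeq hα μ v).1 k * w.1 k)
      (∑' k, coeffA μ k * (seqExtend v.1 k * seqExtend w.1 k) +
        (∑' k, coeffC k * (seqExtend v.1 k * seqExtend w.1 (k + 1)) +
          ∑' k, coeffC k * (seqExtend w.1 k * seqExtend v.1 (k + 1)))) := by
  have hsum := (hasSum_comp_pnat_iff (by rw [seqExtend_zero, mul_zero])).2
    (hasSum_tridiagonal_mul μ (seqExtend_zero v.1)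
      (summable_pow_four_mul_sq (hasSum_seqExtend v).summable hα)
      (summable_pow_four_mul_sq (hasSum_seqExtend w).summable hα))
  refine hsum.congr_fun fun k => ?_
  rw [linearizedSeq_apply, seqExtend_coe]

theorem tsum_linearizedSeq_mul_comm :
    ∑' k : ℕ+, (linearizedSeq hα μ v).1 k * w.1 k =
      ∑' k : ℕ+, v.1 k * (linearizedSeq hα μ w).1 k := by
  simp only [mul_comm (v.1 _)]
  rw [(hasSum_linearizedSeq_mul hα μ v w).tsum_eq, (hasSum_linearizedSeq_mul hα μ w v).tsum_eq,
    add_comm (∑' k, coeffC k * (seqExtend v.1 k * seqExtend w.1 (k + 1)))]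
  simp only [mul_comm (seqExtend v.1 _) (seqExtend w.1 _)]

end LinearizedSequences

theorem mainTheorem5 (α : ℝ) (hα : 0 ≤ α) (μ : ℝ) :
    ∃ T : SeqSpace (α + 2) →ₗ[ℝ] SeqSpace α,
      -- `T` is the operator `𝒜(μ)` in the basis `Y_{2k}^0`
      (∀ v : SeqSpace (α + 2), ∃ u w : L2Sphere,
        HasSum (fun k : ℕ+ => v.1 k • zonalL2 (2 * (k : ℕ))) u ∧
        (∀ w' : L2Sphere, IsLinearizedOperator μ u w' ↔ w' = w) ∧
        HasSum (fun k : ℕ+ => (T v).1 k • zonalL2 (2 * (k : ℕ)))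
          (w - (coeffC 0 * v.1 1) • zonalL2 0)) ∧
      -- the matrix entries
      (∀ v : SeqSpace (α + 2),
        (T v).1 1 = coeffA μ 1 * v.1 1 + coeffC 1 * v.1 2) ∧
      (∀ (v : SeqSpace (α + 2)) (k : ℕ+),
        (T v).1 (k + 1) =
          coeffA μ ((k : ℕ) + 1) * v.1 (k + 1) + coeffB ((k : ℕ) + 1) * v.1 k
            + coeffC ((k : ℕ) + 1) * v.1 (k + 2)) ∧
      -- boundedness and symmetry
      (∃ K : ℝ, ∀ v : SeqSpace (α + 2), seqNorm α (T v) ≤ K * seqNorm (α + 2) v) ∧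
      (∀ k : ℕ, 1 ≤ k → coeffB (k + 1) = coeffC k) ∧
      (∀ v w : SeqSpace (α + 2),
        Summable (fun k : ℕ+ => (T v).1 k * w.1 k) ∧
        Summable (fun k : ℕ+ => v.1 k * (T w).1 k) ∧
        ∑' k : ℕ+, (T v).1 k * w.1 k = ∑' k : ℕ+, v.1 k * (T w).1 k) := by
  refine ⟨linearizedSeq hα μ, fun v => ?_, linearizedSeq_apply_one hα μ,
    linearizedSeq_apply_add_one hα μ, ⟨_, seqNorm_linearizedSeq_le hα μ⟩,
    fun k hk => coeffB_succ_eq_coeffC hk, fun v w => ⟨?_, ?_, ?_⟩⟩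
  · obtain ⟨u, w, hu, huw, hw⟩ := exists_hasSum_linearizedSeq hα μ v
    exact ⟨u, w, hu, fun w' => ⟨fun hw' => hw'.unique huw, fun hw' => hw' ▸ huw⟩, hw⟩
  · exact (hasSum_linearizedSeq_mul hα μ v w).summable
  · simpa only [mul_comm] using (hasSum_linearizedSeq_mul hα μ w v).summable
  · exact tsum_linearizedSeq_mul_comm hα μ v w
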